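/- Let $(\Sigma,\langle\cdot,\cdot\rangle)$ be a connected complete smooth Riemannian manifold without boundary, of dimension $m$, with Riemannian volume measure $d\mathrm{vol}$, and let $f\in C^\infty(\Sigma)$. Write $\Sigma_f$ for $\Sigma$ endowed with the measure $e^{-f}d\mathrm{vol}$; $L^2(\Sigma_f)$, $L^1(\Sigma_f)$ and $L^1_{loc}(\Sigma_f)$ are taken with respect to this measure. For a vector field $X$ put $\mathrm{div}_f X=e^{f}\,\mathrm{div}(e^{-f}X)$, and for $u\in C^2(\Sigma)$ put $\Delta_f u=\mathrm{div}_f(\nabla u)=\Delta u-\langle\nabla u,\nabla f\rangle$. The weighted manifold $\Sigma_f$ is called $f$-parabolic if every $u\in C^2(\Sigma)$ with $\Delta_f u\ge 0$ and $u^*=\sup_\Sigma u<+\infty$ satisfies $u\equiv u^*$. Theorem (weighted Kelvin–Nevanlinna–Royden criterion). $\Sigma_f$ is $f$-parabolic if and only if $$\int_\Sigma \mathrm{div}_f(X)\,e^{-f}\,d\mathrm{vol}=0$$ (in particular $\mathrm{div}_f X\in L^1(\Sigma_f)$) for every measurable vector field $X$ on $\Sigma$ that has a distributional weighted divergence $\mathrm{div}_f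 X$ which is a locally integrable function, satisfies (i) $|X|\in L^2(\Sigma_f)$, (ii) $(\mathrm{div}_f X)_-\in L^1_{loc}(\Sigma_f)$, and is such that the integral $\int_\Sigma \mathrm{div}_f(X)\,e^{-f}\,d\mathrm{vol}$ is defined as an element of $[-\infty,+\infty]$, that is, $(\mathrm{div}_f X)_-\in L^1(\Sigma_f)$ or $(\mathrm{div}_f X)_+\in L^1(\Sigma_f)$. Here $t_\pm=\max(\pm t,0)$, and $w\in L^1_{loc}(\Sigma_f)$ is the distributional weighted divergence of $X$ if $\int_\Sigma\langle X,\nabla\varphi\rangle e^{-f}d\mathrm{vol}=-\int_\Sigma\varphi\, w\, e^{-f}d\mathrm{vol}$ for all $\varphi\in C^\infty_c(\Sigma)$. -/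

import Mathlib

open MeasureTheory Bundle Manifold
open scoped ContDiff

namespace WeightedManifold

noncomputable section

section Riemannian

variable {m : ℕ} {M : Type*} [MetricSpace M] [ChartedSpace (EuclideanSpace ℝ (Fin m)) M]
  [IsManifold (𝓡 m) ∞ M] [RiemannianBundle (fun x : M => TangentSpace (𝓡 m) x)]

/-- The coordinate expression, in the chart `chartAt p`, of the value at `q` of the vector
field `X`. -/
def coordField (p : M) (X : ∀ x : M, TangentSpace (𝓡 m) x) (q : M) : EuclideanSpace ℝ (Fin m) :=
  (trivializationAt (EuclideanSpace ℝ (Fin m)) (TangentSpace (𝓡 m)) p ⟨q, X q⟩).2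

/-- The coordinate vector field `∂ᵢ` of the chart `chartAt p`, evaluated at the point `q` of the
chart domain. -/
def coordVec (p q : M) (i : Fin m) : TangentSpace (𝓡 m) q :=
  (trivializationAt (EuclideanSpace ℝ (Fin m)) (TangentSpace (𝓡 m)) p).symm q
    (EuclideanSpace.single i (1 : ℝ))

variable (m) in
/-- `√(det (gᵢⱼ))` at the point `q`, with `gᵢⱼ = ⟨∂ᵢ, ∂ⱼ⟩` in the chart `chartAt p`. -/
def volDensity (p q : M) : ℝ :=
  √ (Matrix.of fun i j : Fin m =>
    inner ℝ (coordVec p q i : TangentSpace (𝓡 m) q) (coordVec p q j)).det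

variable (m) in
/-- The Riemannian volume measure of the domain of the chart `chartAt p`: the push-forward to `M`
of `√(det g) dy`, where `dy` is Lebesgue measure on the image of the chart. -/
def chartVolume [MeasurableSpace M] (p : M) : Measure M :=
  (((volume : Measure (EuclideanSpace ℝ (Fin m))).restrict (extChartAt (𝓡 m) p).target).withDensity
    fun y => ENNReal.ofReal (volDensity m p ((extChartAt (𝓡 m) p).symm y))).map
      (extChartAt (𝓡 m) p).symm

variable (m M) in
/-- The Riemannian volume measure `dvol`. The measures `chartVolume p` agree on the overlaps of
the chart domains, and their supremum in the lattice of measures is the measure that they glue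
to. -/
def riemannianVolume [MeasurableSpace M] : Measure M :=
  ⨆ p : M, chartVolume m p

/-- The gradient `∇u`: the tangent vector at `x` that represents `du`, that is,
`⟨∇u, v⟩ = du(v)`. -/
def grad (u : M → ℝ) (x : M) : TangentSpace (𝓡 m) x :=
  haveI : FiniteDimensional ℝ (TangentSpace (𝓡 m) x) :=
    inferInstanceAs (FiniteDimensional ℝ (EuclideanSpace ℝ (Fin m)))
  haveI : CompleteSpace (TangentSpace (𝓡 m) x) := FiniteDimensional.complete ℝ _
  (InnerProductSpace.toDual ℝ (TangentSpace (𝓡 m) x)).symm (mfderiv (𝓡 m) 𝓘(ℝ, ℝ) u x)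

/-- The divergence of a `C¹` vector field, `div X = (1 / √(det g)) ∑ᵢ ∂ᵢ (√(det g) Xⁱ)`, computed
at `x` in the chart `chartAt x`. -/
def divergence (X : ∀ x : M, TangentSpace (𝓡 m) x) (x : M) : ℝ :=
  (volDensity m x x)⁻¹ * ∑ i : Fin m,
    fderiv ℝ (fun y : EuclideanSpace ℝ (Fin m) =>
        volDensity m x ((extChartAt (𝓡 m) x).symm y) *
          coordField x X ((extChartAt (𝓡 m) x).symm y) i)
      (extChartAt (𝓡 m) x x) (EuclideanSpace.single i (1 : ℝ))

/-- The weighted divergence `div_f X = e^f div (e^{-f} X)` of a `C¹` vector field. -/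
def fDivergence (f : M → ℝ) (X : ∀ x : M, TangentSpace (𝓡 m) x) (x : M) : ℝ :=
  Real.exp (f x) * divergence (fun q => Real.exp (-f q) • X q) x

variable (m) in
/-- The `f`-Laplacian `Δ_f u = e^f div (e^{-f} ∇u)` of a `C²` function. -/
def fLaplacian (f u : M → ℝ) (x : M) : ℝ :=
  fDivergence (m := m) f (grad u) x

variable (m) in
/-- `f`-parabolicity: a function that is bounded above and satisfies `Δ_f u ≥ 0` is constantly
equal to its supremum. -/
def IsFParabolic (f : M → ℝ) : Prop :=
  ∀ u : M → ℝ, ContMDiff (𝓡 m) 𝓘(ℝ, ℝ) 2 u → (∀ x, 0 ≤ fLaplacian m f u x) →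
    BddAbove (Set.range u) → ∀ x, u x = ⨆ y, u y

variable (m) in
/-- The weighted measure `e^{-f} dvol`. -/
def weightedVolume [MeasurableSpace M] (f : M → ℝ) : Measure M :=
  (riemannianVolume m M).withDensity fun x => ENNReal.ofReal (Real.exp (-f x))

/-- Measurability (up to null sets) of a vector field: its components in every chart are
measurable. -/
def MeasurableField [MeasurableSpace M] (X : ∀ x : M, TangentSpace (𝓡 m) x) : Prop :=
  ∀ p : M, AEStronglyMeasurable (coordField p X)
    ((riemannianVolume m M).restrict (chartAt (EuclideanSpace ℝ (Fin m)) p).source)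

/-- The locally integrable function `w` is the weighted divergence `div_f X` of the vector field
`X` in the sense of distributions: `∫ ⟨X, ∇φ⟩ e^{-f} dvol = -∫ φ w e^{-f} dvol` for all
`φ ∈ C_c^∞(M)`, where `⟨X, ∇φ⟩ = dφ(X)`. -/
def HasWeakFDivergence [MeasurableSpace M] (f : M → ℝ) (X : ∀ x : M, TangentSpace (𝓡 m) x)
    (w : M → ℝ) : Prop :=
  LocallyIntegrable w (weightedVolume m f) ∧
    ∀ φ : M → ℝ, ContMDiff (𝓡 m) 𝓘(ℝ, ℝ) ∞ φ → HasCompactSupport φ →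
      ∫ x, inner ℝ (X x) (grad φ x) ∂(weightedVolume m f) =
        -∫ x, φ x * w x ∂(weightedVolume m f)

end Riemannian

end

end WeightedManifold

/-!
Parabolicity is compared with the vector field condition through a third property, the vanishing of
a capacity. Fix a positive smooth integrable function `ρ` on `M` and let `capacity` be the infimum of
the energy `∫ (|∇φ|² + ρ (1 - φ)²) e^{-f} dvol` over `φ ∈ C_c^∞(M)`. Both sides of the equivalence
are shown to be equivalent to `capacity = 0`.

*The minimizer.* The energy is a quadratic functional, so near-minimizers are close to each other
(`quad_sub_le`) and nearly satisfy the Euler-Lagrange equation (`euler_sq_le`). A fast minimizing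
sequence of test functions, truncated to be uniformly bounded (`exists_bounded_test`), therefore
converges almost everywhere together with its gradients, and the gradients are dominated in `L²`
(`exists_limit`). The limits `u` of the functions and `Y` of the gradients satisfy
`div_f Y = -ρ (1 - u)` in the sense of distributions (`IsMinimizing.integral_inner`), and
`∫ ρ (1 - u) = capacity` (`IsMinimizing.integral_eq_capacity`). Completeness of a Sobolev space is
not used.

*The vector field condition and the capacity.* The field `Y` is admissible, and the integral of its
weighted divergence is `-capacity`, so the condition gives `capacity = 0`
(`capacity_eq_zero_of_kelvinNevanlinnaRoyden`). Conversely, if `capacity = 0`, the minimizing sequence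
consists of functions `φₙ` that tend to `1` almost everywhere and have Dirichlet energy at most
`16⁻ⁿ`. For an admissible `X` the integrals `∫ φₙ² div_f X = -∫ 2 φₙ ⟨X, ∇φₙ⟩` then tend to zero, and
Fatou's lemma and dominated convergence, available because one of the parts of `div_f X` is
integrable, give `∫ div_f X = 0` (`kelvinNevanlinnaRoyden_of_capacity_eq_zero`).

*Parabolicity and the capacity.* If `capacity = 0` and `u` is bounded above with `Δ_f u ≥ 0`, testing
with `φₙ² e^{2u}` gives `∫ φₙ² e^{2u} |∇u|² ≤ sup e^{2u} ∫ |∇φₙ|² → 0`, so `u` is constant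
(`isFParabolic_of_capacity_eq_zero`). Conversely, `v = 1 - u` is a bounded very weak solution of
`Δ_f v = ρ v`. By elliptic regularity it is a classical solution, so that
`Δ_f (v²) = 2 ρ v² + 2 |∇v|² ≥ 0`; parabolicity makes `v²` constant, whence `ρ v² = 0`, `v = 0` and
`capacity = ∫ ρ v = 0` (`capacity_eq_zero_of_isFParabolic`).

*Elliptic regularity.* In a chart `v` solves, in the sense of distributions, a second order equation
with smooth coefficients. Near a point the leading coefficients are a small perturbation of
constants, and the constant coefficient operator is inverted by a Fourier multiplier that gains two
derivatives (`exists_parametrix`). The localized equation thus takes the form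
`w = K + ∑ gᵢ(D) (bᵢ w)` with bounded symbols `gᵢ` and small coefficients `bᵢ`; a Neumann series
argument, followed by differentiation of the equation, shows that `w` is as regular as `K` in the
scale of the spaces `H^k` (`memSobolev_of_eq_add`), and a bootstrap and the Sobolev embedding yield a
`C²` representative (`exists_contDiff_two_of_weak`).

The remaining work relates the global objects to their expressions in charts: the measure
`e^{-f} dvol` (`weightedVolume_restrict`), the weighted Laplacian (`chartLap_eq_fLaplacian`) and
Green's formula (`integral_mul_fLaplacian`).
-/

/-! ### Multiplication operators and Fourier multipliers on `L²` -/

section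
open TemperedDistribution FourierTransform LineDeriv
open scoped SchwartzMap ENNReal Real

variable {E : Type*} [NormedAddCommGroup E] [InnerProductSpace ℝ E] [FiniteDimensional ℝ E]
  [MeasurableSpace E] [BorelSpace E]

/-- Multiplication by a bounded function of temperate growth is a bounded operator on `L²`. -/
theorem exists_clm_smulLeftCLM {b : E → ℂ} (hb : b.HasTemperateGrowth) {C : ℝ} (hC0 : 0 ≤ C)
    (hC : ∀ x, ‖b x‖ ≤ C) :
    ∃ T : Lp ℂ 2 (volume : Measure E) →L[ℂ] Lp ℂ 2 (volume : Measure E), ‖T‖ ≤ C ∧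
      ∀ f, ((T f : Lp ℂ 2 (volume : Measure E)) : 𝓢'(E, ℂ)) = smulLeftCLM ℂ b (f : 𝓢'(E, ℂ)) := by
  have hm : MemLp b ∞ (volume : Measure E) :=
    memLp_top_of_bound hb.1.continuous.aestronglyMeasurable C (.of_forall hC)
  let L : Lp ℂ 2 (volume : Measure E) →ₗ[ℂ] Lp ℂ 2 (volume : Measure E) :=
    { toFun := fun f => (hm.toLp b • f : Lp ℂ 2 (volume : Measure E))
      map_add' := fun f g => by rw [Lp.add_smul]
      map_smul' := fun c f => by rw [RingHom.id_apply, Lp.smul_comm] }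
  have hL : ∀ f, ‖L f‖ ≤ C * ‖f‖ := fun f => by
    refine (Lp.norm_smul_le _ _).trans ?_
    gcongr
    rw [Lp.norm_toLp]
    refine ENNReal.toReal_le_of_le_ofReal hC0 ?_
    rw [eLpNorm_exponent_top]
    exact eLpNormEssSup_le_of_ae_bound (.of_forall hC)
  refine ⟨L.mkContinuous C hL, L.mkContinuous_norm_le hC0 hL, fun f => ?_⟩
  exact Lp.toTemperedDistribution_smul_eq hb hm f

/-- A Fourier multiplier with bounded symbol is a bounded operator on `L²`. -/
theorem exists_clm_fourierMultiplierCLM {g : E → ℂ} (hg : g.HasTemperateGrowth) {C : ℝ}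
    (hC0 : 0 ≤ C) (hC : ∀ x, ‖g x‖ ≤ C) :
    ∃ T : Lp ℂ 2 (volume : Measure E) →L[ℂ] Lp ℂ 2 (volume : Measure E), ‖T‖ ≤ C ∧
      ∀ f, ((T f : Lp ℂ 2 (volume : Measure E)) : 𝓢'(E, ℂ)) =
        fourierMultiplierCLM ℂ g (f : 𝓢'(E, ℂ)) := by
  obtain ⟨T, hT, hTf⟩ := exists_clm_smulLeftCLM hg hC0 hC
  let F := Lp.fourierTransformₗᵢ E ℂ
  refine ⟨(F.symm.toContinuousLinearEquiv : _ →L[ℂ] _) ∘L T ∘L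
    (F.toContinuousLinearEquiv : _ →L[ℂ] _), ?_, fun f => ?_⟩
  · refine ContinuousLinearMap.opNorm_le_bound _ hC0 fun f => ?_
    have h1 : ‖F.symm (T (F f))‖ ≤ C * ‖f‖ := by
      rw [LinearIsometryEquiv.norm_map, ← LinearIsometryEquiv.norm_map F f]
      exact T.le_of_opNorm_le hT _
    exact h1
  · change ((𝓕⁻ (T (𝓕 f)) : Lp ℂ 2 (volume : Measure E)) : 𝓢'(E, ℂ)) = _
    rw [← Lp.fourierInv_toTemperedDistribution_eq, hTf, ← Lp.fourier_toTemperedDistribution_eq]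
    rfl

/-- Leibniz rule for the product of a function of temperate growth and a tempered distribution. -/
theorem lineDerivOp_smulLeftCLM {E : Type*} [NormedAddCommGroup E] [NormedSpace ℝ E] {b : E → ℂ}
    (hb : b.HasTemperateGrowth) (e : E) (hb' : (fun x => fderiv ℝ b x e).HasTemperateGrowth) (f : 𝓢'(E, ℂ)) :
    ∂_{e} (smulLeftCLM ℂ b f) =
      smulLeftCLM ℂ b (∂_{e} f) + smulLeftCLM ℂ (fun x => fderiv ℝ b x e) f := by
  ext u
  simp only [lineDerivOp_apply_apply, smulLeftCLM_apply_apply, add_apply]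
  have : SchwartzMap.smulLeftCLM ℂ b (-∂_{e} u) =
    -∂_{e} (SchwartzMap.smulLeftCLM ℂ b u) +
      SchwartzMap.smulLeftCLM ℂ (fun x => fderiv ℝ b x e) u := by
    ext x
    simp only [add_apply, neg_apply,
      SchwartzMap.lineDerivOp_apply_eq_fderiv, SchwartzMap.smulLeftCLM_apply_apply hb,
      SchwartzMap.smulLeftCLM_apply_apply hb', smul_eq_mul]
    rw [SchwartzMap.smulLeftCLM_apply hb]
    have h := fderiv_fun_mul (hb.1.differentiable (by simp) x) u.differentiableAt
    simp only [smul_eq_mul]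
    change _ = -(fderiv ℝ (fun y => b y * u y) x) e + _
    rw [h]
    simp
    ring
  rw [this, map_add]

/-- If `f` and all its first derivatives lie in `H^s`, then `f` lies in `H^{s+1}`. -/
theorem memSobolev_add_one {ι : Type*} [Fintype ι] (v : OrthonormalBasis ι ℝ E) {s : ℝ}
    {f : 𝓢'(E, ℂ)} (hf : MemSobolev s 2 f) (hd : ∀ i, MemSobolev s 2 (∂_{v i} f)) :
    MemSobolev (s + 1) 2 f := by
  -- `1 + |ξ|²` is the symbol of `1 - (2π)⁻² Δ`
  have key : besselPotential E ℂ 2 f = f - (((2 * π) ^ 2 : ℝ) : ℂ)⁻¹ • Laplacian.laplacian f := by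
    rw [laplacian_eq_fourierMultiplierCLM, besselPotential, ← Complex.coe_smul, smul_smul]
    have h1 : (fun x : E => (((1 + ‖x‖ ^ 2) ^ ((2:ℝ) / 2) : ℝ) : ℂ)) =
        (fun _ => (1:ℂ)) + fun x => ((‖x‖ ^ 2 : ℝ) : ℂ) := by
      ext x; simp
    rw [h1]
    have h2 : fourierMultiplierCLM ℂ ((fun _ => (1:ℂ)) + fun x : E => ((‖x‖ ^ 2 : ℝ) : ℂ)) f =
        fourierMultiplierCLM ℂ (fun _ => (1:ℂ)) f +
          fourierMultiplierCLM ℂ (fun x : E => ((‖x‖ ^ 2 : ℝ) : ℂ)) f := by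
      simp only [fourierMultiplierCLM_apply]
      rw [smulLeftCLM_add (by fun_prop) (by fun_prop)]
      simp [FourierTransform.fourierInv_add]
    rw [h2]
    have : (((2 * π) ^ 2 : ℝ) : ℂ) ≠ 0 := by
      norm_cast; positivity
    rw [show ((((2 * π) ^ 2 : ℝ) : ℂ)⁻¹ * ((-(2 * π) ^ 2 : ℝ) : ℂ)) = -1 by
      push_cast at this ⊢
      field_simp]
    simp
  have h1 : MemSobolev (s - 1) 2 (besselPotential E ℂ 2 f) := by
    rw [key]
    refine (hf.mono (by linarith)).sub (MemSobolev.smul _ ?_)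
    rw [laplacian_eq_sum v]
    have : ∀ S : Finset ι, MemSobolev (s - 1) 2 (∑ i ∈ S, ∂_{v i} (∂_{v i} f)) := by
      classical
      intro S
      induction S using Finset.induction_on with
      | empty => simp
      | insert a S ha ih => rw [Finset.sum_insert ha]; exact (hd a).lineDerivOp.add ih
    exact this _
  rw [memSobolev_besselPotential_iff] at h1
  convert h1 using 1
  ring

end

/-! ### Sobolev regularity for small perturbations of the identity -/

section
open TemperedDistribution FourierTransform LineDeriv Filter
open scoped SchwartzMap ENNReal Real Topology

/-- If `w = K + S w` with `‖S‖ ≤ 1/2` and a closed relation `G` is preserved by the affine map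
`(U, V) ↦ (K + S U, K₁ + S V + S₁ U)`, then `w` is in the domain of the relation: the iterates of
that map converge. -/
theorem exists_mem_of_eq_add_of_isClosed {H : Type*} [NormedAddCommGroup H] [NormedSpace ℂ H]
    [CompleteSpace H] {S S₁ : H →L[ℂ] H} (hS : ‖S‖ ≤ 1 / 2) {K K₁ w : H} (hw : w = K + S w)
    {G : Set (H × H)} (hG : IsClosed G) (h0 : (0, 0) ∈ G)
    (hstep : ∀ U V, (U, V) ∈ G → (K + S U, K₁ + S V + S₁ U) ∈ G) :
    ∃ V, (w, V) ∈ G := by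
  -- the second component of the fixed point of the affine map
  obtain ⟨V, hV⟩ : ∃ V, V = K₁ + S V + S₁ w := by
    have hu : IsUnit (1 - S) := isUnit_one_sub_of_norm_lt_one (by linarith)
    obtain ⟨T, hT⟩ := hu.exists_right_inv
    refine ⟨T (K₁ + S₁ w), ?_⟩
    have := DFunLike.congr_fun hT (K₁ + S₁ w)
    simp only [mul_apply_eq_comp, sub_apply, one_apply_eq_self] at this
    rw [sub_eq_iff_eq_add] at this
    exact this.trans (by abel)
  refine ⟨V, ?_⟩
  let Φ : H × H → H × H := fun p => (K + S p.1, K₁ + S p.2 + S₁ p.1)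
  let x : ℕ → H × H := fun n => Φ^[n] (0, 0)
  have hxG : ∀ n, x n ∈ G := fun n => by
    induction n with
    | zero => exact h0
    | succ n ih =>
      simp only [x, Function.iterate_succ_apply']
      exact hstep _ _ ih
  -- the weight `M` in the norm `‖V‖ + M ‖U‖` makes the affine map a contraction of ratio `3/4`
  set M : ℝ := 4 * ‖S₁‖ + 1
  have hM : 0 < M := by positivity
  let e : H × H → ℝ := fun p => ‖p.2 - V‖ + M * ‖p.1 - w‖
  have he : ∀ p, e (Φ p) ≤ 3 / 4 * e p := fun p => by
    have h1 : ‖(Φ p).1 - w‖ ≤ 1 / 2 * ‖p.1 - w‖ := by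
      have : (Φ p).1 - w = S (p.1 - w) := by
        simp only [Φ, map_sub]
        nth_rewrite 1 [hw]
        abel
      rw [this]
      exact S.le_of_opNorm_le hS _
    have h2 : ‖(Φ p).2 - V‖ ≤ 1 / 2 * ‖p.2 - V‖ + ‖S₁‖ * ‖p.1 - w‖ := by
      have : (Φ p).2 - V = S (p.2 - V) + S₁ (p.1 - w) := by
        simp only [Φ, map_sub]
        nth_rewrite 1 [hV]
        abel
      rw [this]
      exact (norm_add_le _ _).trans (add_le_add (S.le_of_opNorm_le hS _) (S₁.le_opNorm _))
    have h3 := norm_nonneg (p.1 - w)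
    have h4 := norm_nonneg (p.2 - V)
    have h5 := mul_le_mul_of_nonneg_left h1 hM.le
    simp only [e]
    nlinarith
  have hen : ∀ n, e (x n) ≤ (3 / 4) ^ n * e (x 0) := fun n => by
    induction n with
    | zero => simp
    | succ n ih =>
      have : x (n + 1) = Φ (x n) := by simp only [x, Function.iterate_succ_apply']
      rw [this, pow_succ]
      refine (he _).trans ?_
      nlinarith
  have hlim : Tendsto (fun n => e (x n)) atTop (𝓝 0) := by
    refine squeeze_zero (fun n => by positivity) hen ?_
    simpa using (tendsto_pow_atTop_nhds_zero_of_lt_one (by norm_num : (0:ℝ) ≤ 3 / 4)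
      (by norm_num)).mul_const (e (x 0))
  refine hG.mem_of_tendsto (f := x) (b := atTop) ?_ (.of_forall hxG)
  refine (Prod.tendsto_iff _ _).2 ⟨?_, ?_⟩
  · rw [tendsto_iff_norm_sub_tendsto_zero]
    refine squeeze_zero (fun n => norm_nonneg _) (fun n => ?_) (hlim.div_const M |>.trans (by simp))
    rw [le_div_iff₀ hM]
    simp only [e]
    nlinarith [norm_nonneg ((x n).2 - V)]
  · rw [tendsto_iff_norm_sub_tendsto_zero]
    refine squeeze_zero (fun n => norm_nonneg _) (fun n => ?_) hlim
    simp only [e]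
    nlinarith [norm_nonneg ((x n).1 - w)]

variable {E : Type*} [NormedAddCommGroup E] [InnerProductSpace ℝ E] [FiniteDimensional ℝ E]
  [MeasurableSpace E] [BorelSpace E]

theorem hasTemperateGrowth_fderiv_apply {E : Type*} [NormedAddCommGroup E] [NormedSpace ℝ E]
    {b : E → ℂ} (hb : ContDiff ℝ ∞ b) (hc : HasCompactSupport b) (e : E) :
    (fun x => fderiv ℝ b x e).HasTemperateGrowth :=
  (hc.fderiv_apply ℝ e).hasTemperateGrowth (hb.fderiv_right le_rfl |>.clm_apply contDiff_const)

/-- Multiplication by a test function preserves the Sobolev space `H^k`. -/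
theorem memSobolev_smulLeftCLM {b : E → ℂ} (hb : ContDiff ℝ ∞ b) (hc : HasCompactSupport b)
    (k : ℕ) {f : 𝓢'(E, ℂ)} (hf : MemSobolev k 2 f) : MemSobolev k 2 (smulLeftCLM ℂ b f) := by
  induction k generalizing b f with
  | zero =>
    rw [Nat.cast_zero, memSobolev_zero_iff] at hf ⊢
    obtain ⟨f', rfl⟩ := hf
    obtain ⟨C, hC⟩ := hc.exists_bound_of_continuous hb.continuous
    obtain ⟨T, -, hT⟩ := exists_clm_smulLeftCLM (hc.hasTemperateGrowth hb)
      ((norm_nonneg _).trans (hC 0)) hC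
    exact ⟨T f', (hT f').symm⟩
  | succ k ih =>
    rw [Nat.cast_succ] at hf ⊢
    have hf' : MemSobolev k 2 f := hf.mono (by linarith)
    refine memSobolev_add_one (stdOrthonormalBasis ℝ E) (ih hb hc hf') fun i => ?_
    rw [lineDerivOp_smulLeftCLM (hc.hasTemperateGrowth hb) _
      (hasTemperateGrowth_fderiv_apply hb hc _)]
    refine (ih hb hc ?_).add (ih (hb.fderiv_right le_rfl |>.clm_apply contDiff_const)
      (hc.fderiv_apply ℝ _) hf')
    simpa using hf.lineDerivOp (m := stdOrthonormalBasis ℝ E i)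

theorem lineDerivOp_fourierMultiplierCLM {g : E → ℂ} (hg : g.HasTemperateGrowth) (e : E)
    (f : 𝓢'(E, ℂ)) :
    ∂_{e} (fourierMultiplierCLM ℂ g f) = fourierMultiplierCLM ℂ g (∂_{e} f) := by
  rw [lineDeriv_eq_fourierMultiplierCLM, lineDeriv_eq_fourierMultiplierCLM,
    ContinuousLinearMap.map_smul, fourierMultiplierCLM_fourierMultiplierCLM_apply hg (by fun_prop),
    fourierMultiplierCLM_fourierMultiplierCLM_apply (by fun_prop) hg, mul_comm g]

theorem memSobolev_sum {ι : Type*} (S : Finset ι) {s : ℝ} {f : ι → 𝓢'(E, ℂ)}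
    (hf : ∀ i ∈ S, MemSobolev s 2 (f i)) : MemSobolev s 2 (∑ i ∈ S, f i) := by
  classical
  induction S using Finset.induction_on with
  | empty => simp
  | insert a S ha ih =>
    rw [Finset.sum_insert ha]
    exact (hf a (by simp)).add (ih fun i hi => hf i (by simp [hi]))

section Perturbation

variable {ι : Type*} [Fintype ι] {g b : ι → E → ℂ} {C : ℝ}

/-- The operator `w ↦ ∑ᵢ gᵢ(D) (bᵢ w)` is bounded on `L²`, with a norm that is small when the `bᵢ`
are small. -/
theorem exists_clm_sum (hg : ∀ i, (g i).HasTemperateGrowth) (hC0 : 0 ≤ C)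
    (hC : ∀ i x, ‖g i x‖ ≤ C) (hb : ∀ i, ContDiff ℝ ∞ (b i)) (hc : ∀ i, HasCompactSupport (b i))
    {δ : ℝ} (hδ0 : 0 ≤ δ) (hδ : ∀ i x, ‖b i x‖ ≤ δ) :
    ∃ T : Lp ℂ 2 (volume : Measure E) →L[ℂ] Lp ℂ 2 (volume : Measure E),
      ‖T‖ ≤ Fintype.card ι * (C * δ) ∧
      ∀ f, ((T f : Lp ℂ 2 (volume : Measure E)) : 𝓢'(E, ℂ)) =
        ∑ i, fourierMultiplierCLM ℂ (g i) (smulLeftCLM ℂ (b i) (f : 𝓢'(E, ℂ))) := by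
  choose T hT hTf using fun i => exists_clm_fourierMultiplierCLM (hg i) hC0 (hC i)
  choose B hB hBf using fun i =>
    exists_clm_smulLeftCLM ((hc i).hasTemperateGrowth (hb i)) hδ0 (hδ i)
  refine ⟨∑ i, T i ∘L B i, ?_, fun f => ?_⟩
  · refine (norm_sum_le _ _).trans ?_
    refine (Finset.sum_le_card_nsmul _ _ (C * δ) fun i _ => ?_).trans (by simp)
    refine (ContinuousLinearMap.opNorm_comp_le _ _).trans ?_
    exact mul_le_mul (hT i) (hB i) (norm_nonneg _) hC0
  · rw [← Lp.toTemperedDistributionCLM_apply, sum_apply, map_sum]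
    refine Finset.sum_congr rfl fun i _ => ?_
    rw [Lp.toTemperedDistributionCLM_apply, ContinuousLinearMap.comp_apply, hTf, hBf]

/-- The first step of the regularity argument for `w = K + ∑ᵢ gᵢ(D) (bᵢ w)`, where the
coefficients `bᵢ` are small: `K ∈ H¹` implies `w ∈ H¹`. The derivative of `w` is obtained as a limit
of the derivatives of the Neumann iterates, since differentiation is a closed operator. -/
theorem memSobolev_one_of_eq_add (hg : ∀ i, (g i).HasTemperateGrowth) (hC0 : 0 ≤ C)
    (hC : ∀ i x, ‖g i x‖ ≤ C) (hb : ∀ i, ContDiff ℝ ∞ (b i)) (hc : ∀ i, HasCompactSupport (b i))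
    {δ : ℝ} (hδ0 : 0 ≤ δ) (hδ : ∀ i x, ‖b i x‖ ≤ δ) (hsmall : Fintype.card ι * (C * δ) ≤ 1 / 2)
    {w K : 𝓢'(E, ℂ)} (hw : MemSobolev 0 2 w) (hK : MemSobolev 1 2 K)
    (h : w = K + ∑ i, fourierMultiplierCLM ℂ (g i) (smulLeftCLM ℂ (b i) w)) :
    MemSobolev 1 2 w := by
  rw [show (1:ℝ) = 0 + 1 by norm_num]
  refine memSobolev_add_one (stdOrthonormalBasis ℝ E) hw fun j => ?_
  set e := stdOrthonormalBasis ℝ E j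
  obtain ⟨w, rfl⟩ := memSobolev_zero_iff.1 hw
  have hKd : MemSobolev 0 2 (∂_{e} K) := by simpa using hK.lineDerivOp (m := e)
  obtain ⟨K, rfl⟩ := memSobolev_zero_iff.1 (hK.mono zero_le_one)
  obtain ⟨K₁, hK₁⟩ := memSobolev_zero_iff.1 hKd
  obtain ⟨S, hS, hSf⟩ := exists_clm_sum hg hC0 hC hb hc hδ0 hδ
  have hb' : ∀ i, ContDiff ℝ ∞ (fun x => fderiv ℝ (b i) x e) := fun i =>
    (hb i).fderiv_right le_rfl |>.clm_apply contDiff_const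
  have hc' : ∀ i, HasCompactSupport (fun x => fderiv ℝ (b i) x e) := fun i =>
    (hc i).fderiv_apply ℝ _
  choose δ₁ hδ₁ using fun i => (hc' i).exists_bound_of_continuous (hb' i).continuous
  have hδ₁' : ∀ i x, ‖fderiv ℝ (b i) x e‖ ≤ ∑ i, |δ₁ i| := fun i x =>
    ((hδ₁ i x).trans (le_abs_self _)).trans
      (Finset.single_le_sum (f := fun i => |δ₁ i|) (fun i _ => abs_nonneg _) (Finset.mem_univ i))
  obtain ⟨S₁, -, hS₁f⟩ := exists_clm_sum hg hC0 hC hb' hc'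
    (Finset.sum_nonneg fun i _ => abs_nonneg _) hδ₁'
  have hinj : Function.Injective (Lp.toTemperedDistributionCLM ℂ (volume : Measure E) 2) :=
    LinearMap.ker_eq_bot.1 Lp.ker_toTemperedDistributionCLM_eq_bot
  have hcl : IsClosed {p : Lp ℂ 2 (volume : Measure E) × Lp ℂ 2 (volume : Measure E) |
      ∂_{e} (p.1 : 𝓢'(E, ℂ)) = p.2} := by
    refine isClosed_eq ?_ ?_
    · exact (lineDerivOpCLM ℂ 𝓢'(E, ℂ) e).continuous.comp
        ((Lp.toTemperedDistributionCLM ℂ (volume : Measure E) 2).continuous.comp continuous_fst)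
    · exact (Lp.toTemperedDistributionCLM ℂ (volume : Measure E) 2).continuous.comp continuous_snd
  obtain ⟨V, hV⟩ := exists_mem_of_eq_add_of_isClosed (S₁ := S₁) (K := K) (K₁ := K₁) (w := w)
    (hS.trans hsmall)
    (by
      apply hinj
      rw [map_add]
      simp only [Lp.toTemperedDistributionCLM_apply]
      rw [hSf]
      exact h) hcl
    (by
      simp only [Set.mem_ofPred_eq]
      simp only [← Lp.toTemperedDistributionCLM_apply, map_zero]
      exact map_zero (lineDerivOpCLM ℂ 𝓢'(E, ℂ) e))
    (by
      intro U V hUV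
      simp only [Set.mem_ofPred_eq] at hUV ⊢
      have e1 : ((K + S U : Lp ℂ 2 (volume : Measure E)) : 𝓢'(E, ℂ)) =
          (K : 𝓢'(E, ℂ)) + ((S U : Lp ℂ 2 (volume : Measure E)) : 𝓢'(E, ℂ)) := by
        simp only [← Lp.toTemperedDistributionCLM_apply, map_add]
      have e2 : ((K₁ + S V + S₁ U : Lp ℂ 2 (volume : Measure E)) : 𝓢'(E, ℂ)) =
          (K₁ : 𝓢'(E, ℂ)) + ((S V : Lp ℂ 2 (volume : Measure E)) : 𝓢'(E, ℂ)) +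
          ((S₁ U : Lp ℂ 2 (volume : Measure E)) : 𝓢'(E, ℂ)) := by
        simp only [← Lp.toTemperedDistributionCLM_apply, map_add]
      rw [e1, e2, hSf, hSf, hS₁f, lineDerivOp_add, hK₁, add_assoc]
      congr 1
      rw [← lineDerivOpCLM_apply (R := ℂ), map_sum, ← Finset.sum_add_distrib]
      refine Finset.sum_congr rfl fun i _ => ?_
      rw [lineDerivOpCLM_apply, lineDerivOp_fourierMultiplierCLM (hg i),
        lineDerivOp_smulLeftCLM ((hc i).hasTemperateGrowth (hb i)) _
        (hasTemperateGrowth_fderiv_apply (hb i) (hc i) _), map_add, hUV])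
  exact memSobolev_zero_iff.2 ⟨V, hV⟩

/-- Regularity for `w = K + ∑ᵢ gᵢ(D) (bᵢ w)` with small coefficients `bᵢ`: `K ∈ H^k` implies
`w ∈ H^k`, because the derivatives of `w` satisfy equations of the same form. -/
theorem memSobolev_of_eq_add (hg : ∀ i, (g i).HasTemperateGrowth) (hC0 : 0 ≤ C)
    (hC : ∀ i x, ‖g i x‖ ≤ C) (hb : ∀ i, ContDiff ℝ ∞ (b i)) (hc : ∀ i, HasCompactSupport (b i))
    {δ : ℝ} (hδ0 : 0 ≤ δ) (hδ : ∀ i x, ‖b i x‖ ≤ δ) (hsmall : Fintype.card ι * (C * δ) ≤ 1 / 2)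
    (k : ℕ) {w K : 𝓢'(E, ℂ)} (hw : MemSobolev 0 2 w) (hK : MemSobolev k 2 K)
    (h : w = K + ∑ i, fourierMultiplierCLM ℂ (g i) (smulLeftCLM ℂ (b i) w)) :
    MemSobolev k 2 w := by
  induction k generalizing w K with
  | zero => simpa using hw
  | succ k ih =>
    have hKk : MemSobolev k 2 K := hK.mono (by push_cast; linarith)
    have hwk : MemSobolev k 2 w := ih hw hKk h
    have hw1 : MemSobolev 1 2 w := memSobolev_one_of_eq_add hg hC0 hC hb hc hδ0 hδ hsmall hw
      (hK.mono (by push_cast; linarith [(Nat.cast_nonneg k : (0:ℝ) ≤ k)])) h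
    rw [Nat.cast_succ]
    refine memSobolev_add_one (stdOrthonormalBasis ℝ E) hwk fun j => ?_
    set e := stdOrthonormalBasis ℝ E j
    refine ih (K := ∂_{e} K + ∑ i, fourierMultiplierCLM ℂ (g i)
      (smulLeftCLM ℂ (fun x => fderiv ℝ (b i) x e) w)) (by simpa using hw1.lineDerivOp (m := e))
      ?_ ?_
    · refine MemSobolev.add (by simpa using hK.lineDerivOp (m := e)) (memSobolev_sum _ fun i _ => ?_)
      refine MemSobolev.fourierMultiplierCLM_of_bounded ?_ (hg i) ⟨C, hC i⟩
      exact memSobolev_smulLeftCLM ((hb i).fderiv_right le_rfl |>.clm_apply contDiff_const)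
        ((hc i).fderiv_apply ℝ _) k hwk
    · conv_lhs => rw [h]
      rw [lineDerivOp_add, add_assoc]
      congr 1
      rw [← lineDerivOpCLM_apply (R := ℂ), map_sum, ← Finset.sum_add_distrib]
      refine Finset.sum_congr rfl fun i _ => ?_
      rw [lineDerivOpCLM_apply, lineDerivOp_fourierMultiplierCLM (hg i),
        lineDerivOp_smulLeftCLM ((hc i).hasTemperateGrowth (hb i)) _
        (hasTemperateGrowth_fderiv_apply (hb i) (hc i) _), map_add, add_comm]

end Perturbation

end

/-! ### Sobolev embedding, and the symbol of an elliptic operator -/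

section
open TemperedDistribution FourierTransform LineDeriv Filter
open scoped SchwartzMap ENNReal Real Topology

section Embedding

variable {E : Type*} [NormedAddCommGroup E] [InnerProductSpace ℝ E] [FiniteDimensional ℝ E]
  [MeasurableSpace E] [BorelSpace E]

/-- Sobolev embedding: an `L²` function that belongs to all the spaces `H^k` agrees almost
everywhere with a `C²` function. Indeed `(1 + |ξ|²) ŵ` is integrable, because it is the Fourier
transform of an element of `H^k` with `k` large. -/
theorem exists_contDiff_two_ae_eq (w : Lp ℂ 2 (volume : Measure E))
    (hw : ∀ k : ℕ, MemSobolev k 2 (w : 𝓢'(E, ℂ))) :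
    ∃ V : E → ℂ, ContDiff ℝ 2 V ∧ w =ᵐ[volume] V := by
  let p : ℝ → E → ℂ := fun s x => (((1 + ‖x‖ ^ 2) ^ (s / 2) : ℝ) : ℂ)
  have hp : ∀ s, (p s).HasTemperateGrowth := fun s => by simp only [p]; fun_prop
  have hW : MemSobolev ((Module.finrank ℝ E + 1 : ℕ) : ℝ) 2
      (besselPotential E ℂ 2 (w : 𝓢'(E, ℂ))) := by
    rw [memSobolev_besselPotential_iff]
    exact_mod_cast hw (2 + (Module.finrank ℝ E + 1))
  obtain ⟨u, hu⟩ := hW.fourier_memL1 (by push_cast; linarith [(Nat.cast_nonneg (Module.finrank ℝ E) : (0:ℝ) ≤ _)])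
  have hF : 𝓕 (w : 𝓢'(E, ℂ)) = smulLeftCLM ℂ (p (-2)) (u : 𝓢'(E, ℂ)) := by
    rw [← hu, fourier_besselPotential_eq_smulLeftCLM_fourier_apply,
      smulLeftCLM_smulLeftCLM_apply (hp 2) (hp (-2))]
    have : p 2 * p (-2) = fun _ => 1 := by
      ext x
      simp only [p, Pi.mul_apply]
      rw [← Complex.ofReal_mul, ← Real.rpow_add (by positivity)]
      norm_num
    change _ = smulLeftCLM ℂ (p 2 * p (-2)) _
    rw [this]
    simp
  -- the Fourier transform of `w`, reflected
  let U : E → ℂ := fun x => p (-2) (-x) * u (-x)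
  have hui : Integrable (u : E → ℂ) := L1.integrable_coeFn u
  have hp2 : ∀ x, ‖p (-2) x‖ = (1 + ‖x‖ ^ 2)⁻¹ := fun x => by
    simp only [p, Complex.norm_real, Real.norm_eq_abs]
    rw [abs_of_nonneg (by positivity), show (-2 / 2 : ℝ) = -1 by norm_num, Real.rpow_neg_one]
  have hUm : AEStronglyMeasurable (fun x => p (-2) x * u x) volume :=
    (hp _).1.continuous.aestronglyMeasurable.mul hui.1
  have hU : ∀ n : ℕ, n ≤ 2 → Integrable (fun v => ‖v‖ ^ n * ‖U v‖) := fun n hn => by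
    have h1 : Integrable (fun v => ‖v‖ ^ n * ‖p (-2) v * u v‖) := by
      refine hui.norm.mono ((continuous_norm.pow n).aestronglyMeasurable.mul hUm.norm)
        (.of_forall fun x => ?_)
      rw [norm_mul, norm_norm, norm_norm, norm_mul, hp2, norm_pow, norm_norm, ← mul_assoc]
      refine mul_le_of_le_one_left (norm_nonneg _) ?_
      rw [← div_eq_mul_inv, div_le_one (by positivity)]
      interval_cases n
      · simp
      · nlinarith [sq_nonneg (‖x‖ - 1)]
      · simp
    have := h1.comp_neg
    simpa [U] using this
  have hUi : Integrable U := by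
    have h0 := hU 0 (by norm_num)
    simp only [pow_zero, one_mul] at h0
    refine (integrable_norm_iff ?_).1 h0
    exact hUm.comp_quasiMeasurePreserving
      (Measure.measurePreserving_neg (volume : Measure E)).quasiMeasurePreserving
  have hV : ContDiff ℝ 2 (𝓕 U) := Real.contDiff_fourier (N := 2) fun n hn => hU n (by exact_mod_cast hn)
  refine ⟨𝓕 U, hV, ?_⟩
  refine ae_eq_of_integral_contDiff_smul_eq ((Lp.memLp w).locallyIntegrable (by norm_num))
    hV.continuous.locallyIntegrable fun g hg hgc => ?_
  have hg₁ : HasCompactSupport (Complex.ofRealCLM ∘ g) := hgc.comp_left rfl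
  have hg₂ : ContDiff ℝ ∞ (Complex.ofRealCLM ∘ g) := by fun_prop
  set φ : 𝓢(E, ℂ) := hg₁.toSchwartzMap hg₂
  have h1 : ∫ x, g x • w x = (w : 𝓢'(E, ℂ)) φ := by
    rw [Lp.toTemperedDistribution_apply]
    refine integral_congr_ae (.of_forall fun x => ?_)
    simp [φ]
  have h2 : (w : 𝓢'(E, ℂ)) φ = ∫ x, (𝓕⁻ φ) x • (p (-2) x * u x) := by
    rw [show (w : 𝓢'(E, ℂ)) φ = 𝓕 (w : 𝓢'(E, ℂ)) (𝓕⁻ φ) by simp, hF, smulLeftCLM_apply_apply,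
      Lp.toTemperedDistribution_apply]
    refine integral_congr_ae (.of_forall fun x => ?_)
    simp only [SchwartzMap.smulLeftCLM_apply_apply (hp _), smul_eq_mul]
    ring
  have h3 : ∫ x, (𝓕⁻ φ) x • (p (-2) x * u x) = ∫ x, (𝓕 (φ : E → ℂ)) x • U x := by
    rw [← integral_neg_eq_self]
    refine integral_congr_ae (.of_forall fun x => ?_)
    simp only [U]
    rw [SchwartzMap.fourierInv_coe, Real.fourierInv_eq_fourier_neg, neg_neg]
  have h4 : ∫ x, (𝓕 (φ : E → ℂ)) x • U x = ∫ x, φ x • 𝓕 U x := by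
    have := VectorFourier.integral_fourierIntegral_smul_eq_flip (e := Real.fourierChar)
      (L := innerₗ E) (μ := (volume : Measure E)) (ν := volume) Real.continuous_fourierChar
      (by simpa using continuous_inner) φ.integrable hUi
    rw [flip_innerₗ] at this
    exact this
  rw [h1, h2, h3, h4]
  refine integral_congr_ae (.of_forall fun x => ?_)
  simp [φ]

/-- A tempered distribution that vanishes on the real-valued Schwartz functions is zero. -/
theorem temperedDistribution_eq_of_forall_real {E : Type*} [NormedAddCommGroup E]
    [NormedSpace ℝ E] {T₁ T₂ : 𝓢'(E, ℂ)}
    (h : ∀ φ : 𝓢(E, ℝ), T₁ (φ.postcompCLM Complex.ofRealCLM) = T₂ (φ.postcompCLM Complex.ofRealCLM)) :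
    T₁ = T₂ := by
  ext φ
  have : φ = (φ.postcompCLM Complex.reCLM).postcompCLM Complex.ofRealCLM +
      Complex.I • (φ.postcompCLM Complex.imCLM).postcompCLM Complex.ofRealCLM := by
    ext x
    simp [mul_comm Complex.I]
  rw [this]
  simp only [map_add, map_smul, h]

end Embedding

section Symbol

open scoped MatrixOrder Matrix.Norms.L2Operator in
/-- The quadratic form of a positive definite matrix is the square of the norm of an injective
linear map. -/
theorem exists_injective_norm_sq_eq {m : ℕ} {a : Matrix (Fin m) (Fin m) ℝ} (ha : a.PosDef) :
    ∃ L : EuclideanSpace ℝ (Fin m) →L[ℝ] EuclideanSpace ℝ (Fin m), Function.Injective L ∧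
      ∀ ξ, ‖L ξ‖ ^ 2 = (2 * π) ^ 2 * ∑ i, ∑ j, a i j * (ξ i * ξ j) := by
  obtain ⟨b, hb⟩ := CStarAlgebra.nonneg_iff_eq_star_mul_self.1 ha.posSemidef.nonneg
  have h1 : ∀ ξ : EuclideanSpace ℝ (Fin m), ‖Matrix.toEuclideanCLM (𝕜 := ℝ) b ξ‖ ^ 2 =
      ∑ i, ∑ j, a i j * (ξ i * ξ j) := fun ξ => by
    rw [← real_inner_self_eq_norm_sq, hb]
    simp only [PiLp.inner_apply, Matrix.ofLp_toEuclideanCLM, Matrix.mulVec, dotProduct,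
      Matrix.mul_apply, Matrix.star_apply, star_trivial, RCLike.inner_apply, conj_trivial,
      Finset.sum_mul, Finset.mul_sum]
    rw [Finset.sum_comm]
    refine Finset.sum_congr rfl fun i _ => ?_
    rw [Finset.sum_comm]
    refine Finset.sum_congr rfl fun j _ => Finset.sum_congr rfl fun k _ => ?_
    ring
  have h2 : ∀ ξ : EuclideanSpace ℝ (Fin m),
      ‖((2 * π) • Matrix.toEuclideanCLM (𝕜 := ℝ) b : _ →L[ℝ] EuclideanSpace ℝ (Fin m)) ξ‖ ^ 2 =
      (2 * π) ^ 2 * ∑ i, ∑ j, a i j * (ξ i * ξ j) := fun ξ => by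
    rw [smul_apply, norm_smul, mul_pow, h1, Real.norm_eq_abs, sq_abs]
  refine ⟨_, ?_, h2⟩
  rw [injective_iff_map_eq_zero]
  intro ξ hξ
  by_contra hne
  have h3 := h2 ξ
  rw [hξ] at h3
  have h4 := ha.dotProduct_mulVec_pos (x := ξ.ofLp) (by simpa using hne)
  have h5 : star ξ.ofLp ⬝ᵥ a.mulVec ξ.ofLp = ∑ i, ∑ j, a i j * (ξ i * ξ j) := by
    simp only [dotProduct, Matrix.mulVec, Finset.mul_sum, Pi.star_apply, star_trivial]
    refine Finset.sum_congr rfl fun i _ => Finset.sum_congr rfl fun k _ => ?_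
    ring
  rw [h5] at h4
  have : 0 < (2 * π) ^ 2 * ∑ i, ∑ j, a i j * (ξ i * ξ j) := by positivity
  simp at h3
  linarith

end Symbol
end

/-! ### Partial derivatives, and second order operators on `ℝᵐ` -/

section
open TemperedDistribution FourierTransform LineDeriv Filter
open scoped SchwartzMap ENNReal Real Topology

variable {m : ℕ}

/-- The `i`-th partial derivative of a real function on `ℝᵐ`. -/
noncomputable def pd (i : Fin m) (φ : EuclideanSpace ℝ (Fin m) → ℝ)
    (x : EuclideanSpace ℝ (Fin m)) : ℝ :=
  fderiv ℝ φ x (EuclideanSpace.single i (1 : ℝ))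

theorem pd_mul {i : Fin m} {φ ψ : EuclideanSpace ℝ (Fin m) → ℝ} {x : EuclideanSpace ℝ (Fin m)}
    (hφ : DifferentiableAt ℝ φ x) (hψ : DifferentiableAt ℝ ψ x) :
    pd i (fun y => φ y * ψ y) x = φ x * pd i ψ x + pd i φ x * ψ x := by
  simp only [pd, fderiv_fun_mul hφ hψ]
  simp; ring

theorem pd_add {i : Fin m} {φ ψ : EuclideanSpace ℝ (Fin m) → ℝ} {x : EuclideanSpace ℝ (Fin m)}
    (hφ : DifferentiableAt ℝ φ x) (hψ : DifferentiableAt ℝ ψ x) :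
    pd i (fun y => φ y + ψ y) x = pd i φ x + pd i ψ x := by
  simp only [pd, fderiv_fun_add hφ hψ]
  simp

theorem ContDiff.pd {n k : ℕ∞} {φ : EuclideanSpace ℝ (Fin m) → ℝ} (hφ : ContDiff ℝ n φ)
    (i : Fin m) (hk : k + 1 ≤ n) : ContDiff ℝ k (pd i φ) :=
  (hφ.fderiv_right (by exact_mod_cast hk)).clm_apply contDiff_const

theorem ContDiffOn.pd {n k : ℕ∞} {φ : EuclideanSpace ℝ (Fin m) → ℝ}
    {Ω : Set (EuclideanSpace ℝ (Fin m))} (hφ : ContDiffOn ℝ n φ Ω) (hΩ : IsOpen Ω)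
    (i : Fin m) (hk : k + 1 ≤ n) : ContDiffOn ℝ k (pd i φ) Ω :=
  (hφ.fderiv_of_isOpen hΩ (by exact_mod_cast hk)).clm_apply contDiffOn_const

theorem tsupport_pd_subset (i : Fin m) (φ : EuclideanSpace ℝ (Fin m) → ℝ) :
    tsupport (pd i φ) ⊆ tsupport φ :=
  tsupport_fderiv_apply_subset ℝ _

theorem HasCompactSupport.pd {φ : EuclideanSpace ℝ (Fin m) → ℝ} (hφ : HasCompactSupport φ)
    (i : Fin m) : HasCompactSupport (pd i φ) :=
  hφ.fderiv_apply ℝ _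

/-- The product of a function supported in an open set and a function that is smooth on this set
is smooth. -/
theorem contDiff_mul_of_tsupport_subset {E : Type*} [NormedAddCommGroup E] [NormedSpace ℝ E]
    {Ω : Set E} (hΩ : IsOpen Ω) {n : ℕ∞} {χ a : E → ℝ} (hχ : ContDiff ℝ n χ)
    (ha : ContDiffOn ℝ n a Ω) (hs : tsupport χ ⊆ Ω) : ContDiff ℝ n (fun x => χ x * a x) := by
  rw [contDiff_iff_contDiffAt]
  intro x
  by_cases hx : x ∈ tsupport χ
  · exact hχ.contDiffAt.mul (ha.contDiffAt (hΩ.mem_nhds (hs hx)))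
  · have : (fun x => χ x * a x) =ᶠ[𝓝 x] fun _ => 0 := by
      filter_upwards [(isClosed_tsupport χ).isOpen_compl.mem_nhds hx] with y hy
      rw [image_eq_zero_of_notMem_tsupport hy, zero_mul]
    exact contDiffAt_const.congr_of_eventuallyEq this

/-- The tempered distribution `φ ↦ ∫ φ f` given by a real function `f ∈ L²`. -/
noncomputable def realDistribution (f : EuclideanSpace ℝ (Fin m) → ℝ) (hf : MemLp f 2 volume) :
    𝓢'(EuclideanSpace ℝ (Fin m), ℂ) :=
  ((MemLp.ofReal (K := ℂ) hf).toLp : Lp ℂ 2 (volume : Measure (EuclideanSpace ℝ (Fin m))))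

theorem realDistribution_apply {f : EuclideanSpace ℝ (Fin m) → ℝ} (hf : MemLp f 2 volume)
    (φ : 𝓢(EuclideanSpace ℝ (Fin m), ℝ)) :
    realDistribution f hf (φ.postcompCLM Complex.ofRealCLM) = ((∫ x, φ x * f x : ℝ) : ℂ) := by
  rw [realDistribution, Lp.toTemperedDistribution_apply, ← integral_complex_ofReal]
  refine integral_congr_ae ?_
  filter_upwards [(MemLp.ofReal (K := ℂ) hf).coeFn_toLp] with x hx
  rw [hx]
  simp

theorem lineDerivOp_postcompCLM (φ : 𝓢(EuclideanSpace ℝ (Fin m), ℝ)) (i : Fin m) :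
    ∂_{EuclideanSpace.single i (1 : ℝ)} (φ.postcompCLM Complex.ofRealCLM) =
      (∂_{EuclideanSpace.single i (1 : ℝ)} φ).postcompCLM Complex.ofRealCLM := by
  ext x
  rw [SchwartzMap.postcompCLM_apply, SchwartzMap.lineDerivOp_apply_eq_fderiv,
    SchwartzMap.lineDerivOp_apply_eq_fderiv]
  have : ⇑(φ.postcompCLM Complex.ofRealCLM) = Complex.ofRealCLM ∘ φ := rfl
  rw [this, (Complex.ofRealCLM.hasFDerivAt.comp x φ.differentiableAt.hasFDerivAt).fderiv]
  rfl

theorem smulLeftCLM_postcompCLM {b : EuclideanSpace ℝ (Fin m) → ℝ} (hb : b.HasTemperateGrowth)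
    (φ : 𝓢(EuclideanSpace ℝ (Fin m), ℝ)) :
    SchwartzMap.smulLeftCLM ℂ (fun x => (b x : ℂ)) (φ.postcompCLM Complex.ofRealCLM) =
      (SchwartzMap.smulLeftCLM ℝ b φ).postcompCLM Complex.ofRealCLM := by
  ext x
  rw [SchwartzMap.postcompCLM_apply, SchwartzMap.smulLeftCLM_apply_apply (by fun_prop),
    SchwartzMap.smulLeftCLM_apply_apply hb]
  simp

theorem integrable_schwartz_mul {f : EuclideanSpace ℝ (Fin m) → ℝ} (hf : MemLp f 2 volume)
    (φ : 𝓢(EuclideanSpace ℝ (Fin m), ℝ)) : Integrable (fun x => φ x * f x) :=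
  (φ.memLp 2 volume).integrable_mul hf

/-- The Leibniz rule for a second order operator `L = ∑ aᵢⱼ ∂ᵢ∂ⱼ + ∑ bⱼ ∂ⱼ + c`: the commutator of
`L` with multiplication by `χ` is of first order. -/
theorem operator_mul_eq (a : Fin m → Fin m → ℝ) (b : Fin m → ℝ) (c : ℝ)
    {χ φ : EuclideanSpace ℝ (Fin m) → ℝ} (hχ : ContDiff ℝ ∞ χ) (hφ : ContDiff ℝ ∞ φ)
    (x : EuclideanSpace ℝ (Fin m)) :
    (∑ i, ∑ j, a i j * pd i (pd j fun y => χ y * φ y) x) + (∑ j, b j * pd j (fun y => χ y * φ y) x)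
        + c * (χ x * φ x) =
      χ x * (∑ i, ∑ j, a i j * pd i (pd j φ) x) +
      (∑ j, (χ x * b j + ∑ i, (a i j + a j i) * pd i χ x) * pd j φ x) +
      ((∑ i, ∑ j, a i j * pd i (pd j χ) x) + (∑ j, b j * pd j χ x) + c * χ x) * φ x := by
  have hd : ∀ {ψ : EuclideanSpace ℝ (Fin m) → ℝ}, ContDiff ℝ ∞ ψ → ∀ y, DifferentiableAt ℝ ψ y :=
    fun h y => h.differentiable (by simp) y
  have h1 : ∀ j, (pd j fun y => χ y * φ y) = fun y => χ y * pd j φ y + pd j χ y * φ y := fun j => by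
    ext y
    rw [pd_mul (hd hχ y) (hd hφ y)]
  have h2 : ∀ i j, pd i (pd j fun y => χ y * φ y) x =
      χ x * pd i (pd j φ) x + pd i χ x * pd j φ x + (pd j χ x * pd i φ x + pd i (pd j χ) x * φ x) := by
    intro i j
    have hφj := hφ.pd j (k := ⊤) le_rfl
    have hχj := hχ.pd j (k := ⊤) le_rfl
    rw [h1, pd_add (φ := fun y => χ y * pd j φ y) (ψ := fun y => pd j χ y * φ y)
      ((hd hχ x).mul (hd hφj x)) ((hd hχj x).mul (hd hφ x)), pd_mul (hd hχ x) (hd hφj x),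
      pd_mul (hd hχj x) (hd hφ x)]
  have h3 : ∑ i, ∑ j, a i j * pd i (pd j fun y => χ y * φ y) x =
      χ x * (∑ i, ∑ j, a i j * pd i (pd j φ) x) +
      (∑ j, (∑ i, (a i j + a j i) * pd i χ x) * pd j φ x) +
      (∑ i, ∑ j, a i j * pd i (pd j χ) x) * φ x := by
    have e1 : ∑ j, (∑ i, (a i j + a j i) * pd i χ x) * pd j φ x =
        ∑ i, ∑ j, a i j * (pd i χ x * pd j φ x) + ∑ i, ∑ j, a i j * (pd j χ x * pd i φ x) := by
      have : ∑ i, ∑ j, a i j * (pd i χ x * pd j φ x) = ∑ j, ∑ i, a i j * (pd i χ x * pd j φ x) :=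
        Finset.sum_comm
      rw [this, ← Finset.sum_add_distrib]
      refine Finset.sum_congr rfl fun j _ => ?_
      rw [Finset.sum_mul, ← Finset.sum_add_distrib]
      exact Finset.sum_congr rfl fun i _ => by ring
    rw [e1]
    simp only [h2, Finset.mul_sum, Finset.sum_mul, ← Finset.sum_add_distrib]
    exact Finset.sum_congr rfl fun i _ => Finset.sum_congr rfl fun j _ => by ring
  have h4 : ∑ j, b j * pd j (fun y => χ y * φ y) x =
      (∑ j, χ x * b j * pd j φ x) + (∑ j, b j * pd j χ x) * φ x := by
    simp only [h1, Finset.sum_mul, ← Finset.sum_add_distrib]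
    exact Finset.sum_congr rfl fun j _ => by ring
  rw [h3, h4]
  simp only [add_mul, Finset.sum_add_distrib]
  ring
end

/-! ### Inverting an elliptic operator with constant coefficients -/

section
open TemperedDistribution FourierTransform LineDeriv Filter
open scoped SchwartzMap ENNReal Real Topology

variable {m : ℕ}

theorem fourierMultiplierCLM_sub_apply {E : Type*} [NormedAddCommGroup E] [InnerProductSpace ℝ E]
    [FiniteDimensional ℝ E] [MeasurableSpace E] [BorelSpace E] {g₁ g₂ : E → ℂ}
    (h₁ : g₁.HasTemperateGrowth) (h₂ : g₂.HasTemperateGrowth) (f : 𝓢'(E, ℂ)) :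
    fourierMultiplierCLM ℂ (g₁ - g₂) f =
      fourierMultiplierCLM ℂ g₁ f - fourierMultiplierCLM ℂ g₂ f := by
  simp only [fourierMultiplierCLM_apply, smulLeftCLM_sub h₁ h₂, sub_apply]
  exact map_sub (fourierInvCLM ℂ 𝓢'(E, ℂ)) _ _

/-- A second derivative is the Fourier multiplier with symbol `-4π² ξᵢ ξⱼ`. -/
theorem lineDerivOp_lineDerivOp_eq (i j : Fin m) (T : 𝓢'(EuclideanSpace ℝ (Fin m), ℂ)) :
    ∂_{EuclideanSpace.single i (1 : ℝ)} (∂_{EuclideanSpace.single j (1 : ℝ)} T) =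
      fourierMultiplierCLM ℂ (fun ξ => ((-(2 * π) ^ 2 * (ξ i * ξ j) : ℝ) : ℂ)) T := by
  have h := fourierMultiplierCLM_smul (F := ℂ) (E := EuclideanSpace ℝ (Fin m))
    (g := fun ξ => ((inner ℝ ξ (EuclideanSpace.single j (1:ℝ)) : ℝ) : ℂ) *
      ((inner ℝ ξ (EuclideanSpace.single i (1:ℝ)) : ℝ) : ℂ)) (by fun_prop)
      ((2 * π * Complex.I) * (2 * π * Complex.I))
  have h' := DFunLike.congr_fun h T
  rw [lineDeriv_eq_fourierMultiplierCLM, lineDeriv_eq_fourierMultiplierCLM,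
    ContinuousLinearMap.map_smul, fourierMultiplierCLM_fourierMultiplierCLM_apply (by fun_prop)
    (by fun_prop), smul_smul]
  rw [smul_apply] at h'
  refine h'.symm.trans ?_
  congr 2
  ext ξ
  simp only [Pi.smul_apply, smul_eq_mul, EuclideanSpace.inner_single_right]
  simp
  ring_nf
  simp

/-- The inverse of `1 - A`, for a second order operator `A = ∑ a⁰ᵢⱼ ∂ᵢ∂ⱼ` with constant coefficients
that is elliptic, is a Fourier multiplier `q(D)`. It gains two derivatives, and `q(D) ∂ᵢ∂ⱼ` is
bounded. -/
theorem exists_parametrix {a : Matrix (Fin m) (Fin m) ℝ} (ha : a.PosDef) :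
    ∃ (q : EuclideanSpace ℝ (Fin m) → ℂ) (g : Fin m × Fin m → EuclideanSpace ℝ (Fin m) → ℂ) (C : ℝ),
      0 < C ∧ (∀ i, (g i).HasTemperateGrowth) ∧ (∀ i x, ‖g i x‖ ≤ C) ∧
      (∀ T : 𝓢'(EuclideanSpace ℝ (Fin m), ℂ), fourierMultiplierCLM ℂ q (T - ∑ p : Fin m × Fin m,
        (a p.1 p.2 : ℂ) • ∂_{EuclideanSpace.single p.2 (1 : ℝ)}
          (∂_{EuclideanSpace.single p.1 (1 : ℝ)} T)) = T) ∧
      (∀ (T : 𝓢'(EuclideanSpace ℝ (Fin m), ℂ)) (p : Fin m × Fin m), fourierMultiplierCLM ℂ q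
        (∂_{EuclideanSpace.single p.2 (1 : ℝ)} (∂_{EuclideanSpace.single p.1 (1 : ℝ)} T)) =
          fourierMultiplierCLM ℂ (g p) T) ∧
      ∀ (s : ℝ) (T : 𝓢'(EuclideanSpace ℝ (Fin m), ℂ)), MemSobolev s 2 T →
        MemSobolev (s + 2) 2 (fourierMultiplierCLM ℂ q T) := by
  obtain ⟨L, hLinj, hL⟩ := exists_injective_norm_sq_eq ha
  obtain ⟨K, hK0, hK⟩ := LinearMap.exists_antilipschitzWith (L : EuclideanSpace ℝ (Fin m) →ₗ[ℝ]
    EuclideanSpace ℝ (Fin m)) (LinearMap.ker_eq_bot.2 hLinj)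
  have hKL : ∀ ξ, ‖ξ‖ ≤ K * ‖L ξ‖ := fun ξ => by
    simpa using hK.le_mul_dist ξ 0
  -- `1 + |L ξ|² = 1 + 4π² ∑ a⁰ᵢⱼ ξᵢ ξⱼ` is the symbol of `1 - A`
  let r : EuclideanSpace ℝ (Fin m) → ℝ := fun ξ => (1 + ‖L ξ‖ ^ 2) ^ (-1 : ℝ)
  have hr : r.HasTemperateGrowth :=
    (Function.hasTemperateGrowth_one_add_norm_sq_rpow _ (-1)).comp L.hasTemperateGrowth
  have hr' : ∀ ξ, r ξ = (1 + ‖L ξ‖ ^ 2)⁻¹ := fun ξ => Real.rpow_neg_one _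
  have hpos : ∀ ξ, 0 < 1 + ‖L ξ‖ ^ 2 := fun ξ => by positivity
  let q : EuclideanSpace ℝ (Fin m) → ℂ := fun ξ => (r ξ : ℂ)
  have hq : q.HasTemperateGrowth := by simp only [q]; fun_prop
  let d : Fin m × Fin m → EuclideanSpace ℝ (Fin m) → ℂ :=
    fun p ξ => ((-(2 * π) ^ 2 * (ξ p.2 * ξ p.1) : ℝ) : ℂ)
  have hcoord : ∀ i, (fun ξ : EuclideanSpace ℝ (Fin m) => ξ i).HasTemperateGrowth := fun i =>
    (EuclideanSpace.proj (𝕜 := ℝ) i).hasTemperateGrowth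
  have hd : ∀ p, (d p).HasTemperateGrowth := fun p => by
    have h1 := hcoord p.1
    have h2 := hcoord p.2
    simp only [d]
    fun_prop
  have hcoordle : ∀ (ξ : EuclideanSpace ℝ (Fin m)) i, |ξ i| ≤ ‖ξ‖ := fun ξ i =>
    PiLp.norm_apply_le ξ i
  have hsq : ∀ ξ, ‖ξ‖ ^ 2 ≤ K ^ 2 * ‖L ξ‖ ^ 2 := fun ξ => by
    rw [← mul_pow]; exact pow_le_pow_left₀ (norm_nonneg _) (hKL ξ) 2
  refine ⟨q, fun p => d p * q, (2 * π) ^ 2 * K ^ 2, by positivity, fun p => (hd p).mul hq,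
    fun p ξ => ?_, fun T => ?_, fun T p => ?_, fun s T hT => ?_⟩
  · simp only [Pi.mul_apply, norm_mul, d, q, Complex.norm_real, Real.norm_eq_abs, hr' ξ, abs_mul,
      abs_neg, abs_pow, abs_inv, abs_of_pos (hpos ξ)]
    rw [← div_eq_mul_inv, div_le_iff₀ (hpos ξ)]
    have h1 : |ξ p.2| * |ξ p.1| ≤ ‖ξ‖ ^ 2 := by
      rw [sq]
      exact mul_le_mul (hcoordle _ _) (hcoordle _ _) (abs_nonneg _) (norm_nonneg _)
    have h2 : (abs (2:ℝ) * abs π) ^ 2 = (2 * π) ^ 2 := by rw [← abs_mul, sq_abs]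
    rw [h2, mul_assoc]
    refine mul_le_mul_of_nonneg_left ?_ (by positivity)
    have := hsq ξ
    nlinarith [sq_nonneg (K : ℝ)]
  · simp_rw [lineDerivOp_lineDerivOp_eq]
    have h1 : ∑ p : Fin m × Fin m, (a p.1 p.2 : ℂ) • fourierMultiplierCLM ℂ (d p) T =
        fourierMultiplierCLM ℂ (fun ξ => ∑ p : Fin m × Fin m, ((a p.1 p.2 : ℂ) • d p) ξ) T := by
      have hs : ∀ p ∈ Finset.univ, ((a p.1 p.2 : ℂ) • d p).HasTemperateGrowth := fun p _ => by
        have := hd p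
        exact Function.HasTemperateGrowth.mul (.const _) this
      have h2 := fourierMultiplierCLM_sum ℂ hs
      have h3 := DFunLike.congr_fun h2 T
      refine Eq.trans ?_ h3.symm
      rw [sum_apply]
      refine Finset.sum_congr rfl fun p _ => ?_
      rw [fourierMultiplierCLM_smul (hd p)]
      rfl
    change fourierMultiplierCLM ℂ q (T - ∑ p : Fin m × Fin m, (a p.1 p.2 : ℂ) •
      fourierMultiplierCLM ℂ (d p) T) = T
    have hst : (fun ξ => ∑ p : Fin m × Fin m, ((a p.1 p.2 : ℂ) • d p) ξ).HasTemperateGrowth := by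
      refine Function.HasTemperateGrowth.sum fun p _ => ?_
      exact Function.HasTemperateGrowth.mul (.const _) (hd p)
    have hone : T = fourierMultiplierCLM ℂ (fun _ => (1 : ℂ)) T := by simp
    rw [h1]
    nth_rewrite 1 [hone]
    rw [← fourierMultiplierCLM_sub_apply (.const _) hst,
      fourierMultiplierCLM_fourierMultiplierCLM_apply ((Function.HasTemperateGrowth.const _).sub hst)
      hq]
    nth_rewrite 2 [hone]
    congr 2
    ext ξ
    have h4 := hL ξ
    simp only [Pi.mul_apply, Pi.sub_apply, Pi.smul_apply, d, q, smul_eq_mul]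
    norm_cast
    rw [hr', ← div_eq_mul_inv, div_eq_one_iff_eq (hpos ξ).ne', h4, Fintype.sum_prod_type,
      sub_eq_add_neg, ← Finset.sum_neg_distrib, Finset.mul_sum]
    congr 1
    refine Finset.sum_congr rfl fun i _ => ?_
    rw [← Finset.sum_neg_distrib, Finset.mul_sum]
    refine Finset.sum_congr rfl fun j _ => by ring
  · rw [lineDerivOp_lineDerivOp_eq, fourierMultiplierCLM_fourierMultiplierCLM_apply (hd p) hq]
  · let n : EuclideanSpace ℝ (Fin m) → ℂ := fun ξ => ((1 + ‖ξ‖ ^ 2 : ℝ) : ℂ) * q ξ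
    have hn : n.HasTemperateGrowth := by simp only [n]; fun_prop
    have h1 : fourierMultiplierCLM ℂ q T =
        besselPotential _ ℂ (-2) (fourierMultiplierCLM ℂ n T) := by
      rw [besselPotential, fourierMultiplierCLM_fourierMultiplierCLM_apply hn (by fun_prop)]
      congr 2
      ext ξ
      simp only [Pi.mul_apply, n, q]
      have : (0:ℝ) < 1 + ‖ξ‖ ^ 2 := by positivity
      rw [show (-2 / 2 : ℝ) = -1 by norm_num, Real.rpow_neg_one, ← Complex.ofReal_mul,
        ← Complex.ofReal_mul]
      congr 1
      field_simp
    rw [h1, memSobolev_besselPotential_iff]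
    refine MemSobolev.fourierMultiplierCLM_of_bounded (by simpa using hT) hn ⟨1 + K ^ 2, fun ξ => ?_⟩
    simp only [n, q, norm_mul, Complex.norm_real, Real.norm_eq_abs, hr', abs_inv,
      abs_of_pos (hpos ξ)]
    rw [abs_of_pos (by positivity), ← div_eq_mul_inv, div_le_iff₀ (hpos ξ)]
    have := hsq ξ
    nlinarith [sq_nonneg (K : ℝ), sq_nonneg ‖L ξ‖]
end

/-! ### Interior regularity of very weak solutions on `ℝᵐ` -/

section
open TemperedDistribution FourierTransform LineDeriv Filter
open scoped SchwartzMap ENNReal Real Topology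

variable {m : ℕ}

/-- The localized equation. If `v` is a weak solution of `∑ ∂ᵢ∂ⱼ(aᵢⱼ v) - ∑ ∂ⱼ(bⱼ v) + c v = 0` in `Ω`
and `χ` is a cutoff function, then `χ v` satisfies a second order equation on the whole space whose
right-hand side consists of first derivatives of products of `v` with cutoff functions. -/
theorem localized_equation {Ω : Set (EuclideanSpace ℝ (Fin m))}
    {a : Fin m → Fin m → EuclideanSpace ℝ (Fin m) → ℝ} {b : Fin m → EuclideanSpace ℝ (Fin m) → ℝ}
    {c v : EuclideanSpace ℝ (Fin m) → ℝ}
    (hweak : ∀ φ : EuclideanSpace ℝ (Fin m) → ℝ, ContDiff ℝ ∞ φ → HasCompactSupport φ →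
      tsupport φ ⊆ Ω → ∫ x, v x * ((∑ i, ∑ j, a i j x * pd i (pd j φ) x) +
        (∑ j, b j x * pd j φ x) + c x * φ x) = 0)
    {a₀ : Fin m → Fin m → ℝ} {β : Fin m → Fin m → EuclideanSpace ℝ (Fin m) → ℝ}
    (hβ : ∀ i j, ContDiff ℝ ∞ (β i j)) (hβc : ∀ i j, HasCompactSupport (β i j))
    {χ : EuclideanSpace ℝ (Fin m) → ℝ} (hχ : ContDiff ℝ ∞ χ) (hχc : HasCompactSupport χ)
    (hχs : tsupport χ ⊆ Ω) (hχβ : ∀ x ∈ tsupport χ, ∀ i j, a i j x = a₀ i j + β i j x)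
    (hv : MemLp (fun x => χ x * v x) 2 volume)
    (hv₁ : ∀ j, MemLp (fun x => (χ x * b j x + ∑ i, (a i j x + a j i x) * pd i χ x) * v x) 2 volume)
    (hv₀ : MemLp (fun x => ((∑ i, ∑ j, a i j x * pd i (pd j χ) x) + (∑ j, b j x * pd j χ x) +
      c x * χ x) * v x) 2 volume) :
    (∑ p : Fin m × Fin m, (a₀ p.1 p.2 : ℂ) • ∂_{EuclideanSpace.single p.2 (1 : ℝ)}
      (∂_{EuclideanSpace.single p.1 (1 : ℝ)} (realDistribution _ hv))) +
    (∑ p : Fin m × Fin m, ∂_{EuclideanSpace.single p.2 (1 : ℝ)}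
      (∂_{EuclideanSpace.single p.1 (1 : ℝ)}
        (smulLeftCLM ℂ (fun x => (β p.1 p.2 x : ℂ)) (realDistribution _ hv)))) =
    (∑ j, ∂_{EuclideanSpace.single j (1 : ℝ)} (realDistribution _ (hv₁ j))) -
      realDistribution _ hv₀ := by
  refine temperedDistribution_eq_of_forall_real fun φ => ?_
  have hβt : ∀ i j, (β i j).HasTemperateGrowth := fun i j => (hβc i j).hasTemperateGrowth (hβ i j)
  simp only [add_apply, sub_apply, sum_apply, smul_apply, lineDerivOp_apply_apply,
    smulLeftCLM_apply_apply, map_neg, lineDerivOp_postcompCLM, neg_neg,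
    smulLeftCLM_postcompCLM (hβt _ _), realDistribution_apply]
  simp only [smul_eq_mul, ← Complex.ofReal_neg, ← Complex.ofReal_mul, ← Complex.ofReal_sum,
    ← Complex.ofReal_add, ← Complex.ofReal_sub]
  congr 1
  have hI := fun (f : EuclideanSpace ℝ (Fin m) → ℝ) (hf : MemLp f 2 volume) φ =>
    integrable_schwartz_mul hf φ
  have hIn := fun j φ => (hI _ (hv₁ j) φ).fun_neg
  simp only [← integral_neg, ← integral_const_mul]
  rw [← integral_finsetSum _ fun p _ => (hI _ hv _).const_mul _,
    ← integral_finsetSum _ fun p _ => hI _ hv _,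
    ← integral_finsetSum _ fun j _ => hIn j _,
    ← integral_add (integrable_finsetSum _ fun p _ => (hI _ hv _).const_mul _)
      (integrable_finsetSum _ fun p _ => hI _ hv _),
    ← integral_sub (integrable_finsetSum _ fun j _ => hIn j _) (hI _ hv₀ _),
    ← sub_eq_zero, ← integral_sub]
  rotate_left
  · exact (integrable_finsetSum _ fun p _ => (hI _ hv _).const_mul _).add
      (integrable_finsetSum _ fun p _ => hI _ hv _)
  · exact (integrable_finsetSum _ fun j _ => hIn j _).sub (hI _ hv₀ _)
  have hφ : ContDiff ℝ ∞ φ := φ.smooth ⊤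
  have h0 := hweak (fun x => χ x * φ x) (hχ.mul hφ) hχc.mul_right
    ((tsupport_mul_subset_left).trans hχs)
  rw [← h0]
  refine integral_congr_ae (.of_forall fun x => ?_)
  simp only
  rw [operator_mul_eq (fun i j => a i j x) (fun j => b j x) (c x) hχ hφ x]
  have hpd : ∀ i, ((∂_{EuclideanSpace.single i (1 : ℝ)} φ : 𝓢(_, ℝ)) : _ → ℝ) = pd i φ := fun i => by
    ext y; rw [SchwartzMap.lineDerivOp_apply_eq_fderiv]; rfl
  have hpd2 : ∀ i j x, (∂_{EuclideanSpace.single j (1 : ℝ)} (∂_{EuclideanSpace.single i (1 : ℝ)} φ) :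
      𝓢(_, ℝ)) x = pd j (pd i φ) x := fun i j x => by
    rw [SchwartzMap.lineDerivOp_apply_eq_fderiv, hpd]; rfl
  simp only [SchwartzMap.smulLeftCLM_apply_apply (hβt _ _), hpd2, hpd, smul_eq_mul]
  have key : (∑ p : Fin m × Fin m, a₀ p.1 p.2 * (pd p.1 (pd p.2 φ) x * (χ x * v x))) +
      (∑ p : Fin m × Fin m, β p.1 p.2 x * pd p.1 (pd p.2 φ) x * (χ x * v x)) =
      v x * (χ x * ∑ i, ∑ j, a i j x * pd i (pd j φ) x) := by
    by_cases hx : x ∈ tsupport χ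
    · rw [← Finset.sum_add_distrib, Fintype.sum_prod_type, Finset.mul_sum, Finset.mul_sum]
      refine Finset.sum_congr rfl fun i _ => ?_
      rw [Finset.mul_sum, Finset.mul_sum]
      refine Finset.sum_congr rfl fun j _ => ?_
      rw [hχβ x hx]
      ring
    · simp [image_eq_zero_of_notMem_tsupport hx]
  have hs : ∑ j, pd j φ x * ((χ x * b j x + ∑ i, (a i j x + a j i x) * pd i χ x) * v x) =
      v x * ∑ j, (χ x * b j x + ∑ i, (a i j x + a j i x) * pd i χ x) * pd j φ x := by
    rw [Finset.mul_sum]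
    exact Finset.sum_congr rfl fun j _ => by ring
  rw [key, Finset.sum_neg_distrib, hs]
  ring

/-- Interior regularity in the scale of Sobolev spaces, near a point where the operator is
elliptic: on a small ball the coefficients of second order are close to constants, and the
localized equation is a small perturbation of an equation with constant coefficients. -/
theorem exists_ball_memSobolev {Ω : Set (EuclideanSpace ℝ (Fin m))} (hΩ : IsOpen Ω)
    {a : Fin m → Fin m → EuclideanSpace ℝ (Fin m) → ℝ} {b : Fin m → EuclideanSpace ℝ (Fin m) → ℝ}
    {c v : EuclideanSpace ℝ (Fin m) → ℝ} (ha : ∀ i j, ContDiffOn ℝ ∞ (a i j) Ω)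
    (hb : ∀ j, ContDiffOn ℝ ∞ (b j) Ω) (hc : ContDiffOn ℝ ∞ c Ω)
    {x₀ : EuclideanSpace ℝ (Fin m)} (hx₀ : x₀ ∈ Ω)
    (hell : (Matrix.of fun i j => a i j x₀).PosDef)
    (hv : ∀ χ : EuclideanSpace ℝ (Fin m) → ℝ, ContDiff ℝ ∞ χ → HasCompactSupport χ →
      tsupport χ ⊆ Ω → MemLp (fun x => χ x * v x) 2 volume)
    (hweak : ∀ φ : EuclideanSpace ℝ (Fin m) → ℝ, ContDiff ℝ ∞ φ → HasCompactSupport φ →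
      tsupport φ ⊆ Ω → ∫ x, v x * ((∑ i, ∑ j, a i j x * pd i (pd j φ) x) +
        (∑ j, b j x * pd j φ x) + c x * φ x) = 0) :
    ∃ r > 0, Metric.ball x₀ r ⊆ Ω ∧ ∀ (k : ℕ) (χ : EuclideanSpace ℝ (Fin m) → ℝ),
      ContDiff ℝ ∞ χ → HasCompactSupport χ → tsupport χ ⊆ Metric.ball x₀ r →
        ∀ h : MemLp (fun x => χ x * v x) 2 volume, MemSobolev k 2 (realDistribution _ h) := by
  obtain ⟨q, g, C, hC, hg, hgC, hq1, hq2, hq3⟩ := exists_parametrix hell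
  set N : ℝ := (Fintype.card (Fin m × Fin m) : ℝ)
  have hN0 : 0 ≤ N := Nat.cast_nonneg _
  -- with coefficients of this size the perturbation has norm at most `1/2` on `L²`
  set δ : ℝ := 1 / (2 * (N + 1) * C) with hδ
  have hδ0 : 0 < δ := by positivity
  have hsmall : N * (C * δ) ≤ 1 / 2 := by
    rw [hδ, show N * (C * (1 / (2 * (N + 1) * C))) = N / (2 * (N + 1)) by field_simp,
      div_le_div_iff₀ (by positivity) (by norm_num)]
    linarith
  obtain ⟨R, hR, hRsub⟩ : ∃ R > 0, Metric.closedBall x₀ R ⊆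
      {x | x ∈ Ω ∧ ∀ i j, |a i j x - a i j x₀| ≤ δ} := by
    rw [← (Metric.nhds_basis_closedBall (x := x₀)).mem_iff]
    refine Filter.inter_mem (hΩ.mem_nhds hx₀) ?_
    have : ∀ᶠ x in 𝓝 x₀, ∀ i j, |a i j x - a i j x₀| ≤ δ := by
      refine eventually_all.2 fun i => eventually_all.2 fun j => ?_
      have hcont : ContinuousAt (a i j) x₀ := (ha i j).continuousOn.continuousAt (hΩ.mem_nhds hx₀)
      filter_upwards [Metric.tendsto_nhds.1 hcont δ hδ0] with x hx
      exact hx.le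
    exact this
  -- the variable part of the coefficients, cut off outside the ball where it is at most `δ`
  let η : ContDiffBump x₀ := ⟨R / 2, R, by positivity, by linarith⟩
  let β : Fin m → Fin m → EuclideanSpace ℝ (Fin m) → ℝ := fun i j x => η x * (a i j x - a i j x₀)
  have hηs : tsupport η ⊆ Ω := by
    rw [η.tsupport_eq]; exact fun x hx => (hRsub hx).1
  have hβ : ∀ i j, ContDiff ℝ ∞ (β i j) := fun i j =>
    contDiff_mul_of_tsupport_subset hΩ (n := ⊤) η.contDiff ((ha i j).sub contDiffOn_const) hηs
  have hβc : ∀ i j, HasCompactSupport (β i j) := fun i j => η.hasCompactSupport.mul_right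
  have hβδ : ∀ i j x, |β i j x| ≤ δ := fun i j x => by
    by_cases hx : x ∈ Metric.closedBall x₀ R
    · simp only [β, abs_mul, abs_of_nonneg η.nonneg]
      exact (mul_le_of_le_one_left (abs_nonneg _) η.le_one).trans ((hRsub hx).2 i j)
    · have : η x = 0 := image_eq_zero_of_notMem_tsupport (by rwa [η.tsupport_eq])
      simp [β, this, hδ0.le]
  have hball : Metric.ball x₀ (R / 2) ⊆ Ω := fun x hx => (hRsub (Metric.closedBall_subset_closedBall
    (by linarith) (Metric.ball_subset_closedBall hx))).1
  refine ⟨R / 2, by positivity, hball, fun k => ?_⟩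
  have hzero : ∀ (f : EuclideanSpace ℝ (Fin m) → ℝ) (hf : MemLp f 2 volume),
      MemSobolev 0 2 (realDistribution f hf) := fun f hf => memSobolev_zero_iff.2 ⟨_, rfl⟩
  induction k with
  | zero => intro χ _ _ _ h; simpa using hzero _ h
  | succ k ih =>
    intro χ hχ hχc hχs h
    have hχΩ := hχs.trans hball
    have hout : ∀ x ∉ tsupport χ, χ x = 0 ∧ ∀ i, pd i χ x = 0 := fun x hx =>
      ⟨image_eq_zero_of_notMem_tsupport hx, fun i =>
        image_eq_zero_of_notMem_tsupport fun h => hx (tsupport_pd_subset i χ h)⟩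
    have hχi : ∀ i, ContDiff ℝ ∞ (pd i χ) := fun i => hχ.pd (k := ⊤) i le_rfl
    have hχij : ∀ i j, ContDiff ℝ ∞ (pd i (pd j χ)) := fun i j => (hχi j).pd (k := ⊤) i le_rfl
    have hχis : ∀ i, tsupport (pd i χ) ⊆ Ω := fun i => (tsupport_pd_subset i χ).trans hχΩ
    have hχijs : ∀ i j, tsupport (pd i (pd j χ)) ⊆ Ω := fun i j =>
      (tsupport_pd_subset i _).trans (hχis j)
    let ψ : Fin m → EuclideanSpace ℝ (Fin m) → ℝ := fun j x =>
      χ x * b j x + ∑ i, (a i j x + a j i x) * pd i χ x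
    let ψ₀ : EuclideanSpace ℝ (Fin m) → ℝ := fun x =>
      (∑ i, ∑ j, a i j x * pd i (pd j χ) x) + (∑ j, b j x * pd j χ x) + c x * χ x
    have hψ : ∀ j, ContDiff ℝ ∞ (ψ j) := fun j => by
      refine (contDiff_mul_of_tsupport_subset hΩ (n := ⊤) hχ (hb j) hχΩ).add
        (ContDiff.sum fun i _ => ?_)
      simp only [mul_comm _ (pd i χ _)]
      exact contDiff_mul_of_tsupport_subset hΩ (n := ⊤) (hχi i) ((ha i j).add (ha j i)) (hχis i)
    have hψ₀ : ContDiff ℝ ∞ ψ₀ := by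
      refine ((ContDiff.sum fun i _ => ContDiff.sum fun j _ => ?_).add
        (ContDiff.sum fun j _ => ?_)).add ?_
      · simp only [mul_comm _ (pd i (pd j χ) _)]
        exact contDiff_mul_of_tsupport_subset hΩ (n := ⊤) (hχij i j) (ha i j) (hχijs i j)
      · simp only [mul_comm _ (pd j χ _)]
        exact contDiff_mul_of_tsupport_subset hΩ (n := ⊤) (hχi j) (hb j) (hχis j)
      · simp only [mul_comm _ (χ _)]
        exact contDiff_mul_of_tsupport_subset hΩ (n := ⊤) hχ hc hχΩ
    have hψs : ∀ j, tsupport (ψ j) ⊆ tsupport χ := fun j =>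
      closure_minimal (fun x hx => by
        by_contra hx'
        exact hx (by simp [ψ, hout x hx'])) (isClosed_tsupport χ)
    have hψ₀s : tsupport ψ₀ ⊆ tsupport χ :=
      closure_minimal (fun x hx => by
        by_contra hx'
        have : ∀ i j, pd i (pd j χ) x = 0 := fun i j =>
          image_eq_zero_of_notMem_tsupport fun h =>
            hx' (tsupport_pd_subset j χ (tsupport_pd_subset i _ h))
        exact hx (by simp [ψ₀, hout x hx', this])) (isClosed_tsupport χ)
    have hψc : ∀ j, HasCompactSupport (ψ j) := fun j =>
      hχc.of_isClosed_subset (isClosed_tsupport _) (hψs j)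
    have hψ₀c : HasCompactSupport ψ₀ := hχc.of_isClosed_subset (isClosed_tsupport _) hψ₀s
    have hv₁ := fun j => hv (ψ j) (hψ j) (hψc j) ((hψs j).trans hχΩ)
    have hv₀ := hv ψ₀ hψ₀ hψ₀c (hψ₀s.trans hχΩ)
    have heq := localized_equation hweak (a₀ := fun i j => a i j x₀) hβ hβc hχ hχc hχΩ
      (fun x hx i j => by
        have : η x = 1 := η.one_of_mem_closedBall (Metric.ball_subset_closedBall (hχs hx))
        simp [β, this]) h hv₁ hv₀
    set W := realDistribution _ h
    set H := (∑ j, ∂_{EuclideanSpace.single j (1 : ℝ)} (realDistribution _ (hv₁ j))) -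
      realDistribution _ hv₀ with hH
    have hWk : MemSobolev k 2 W := ih χ hχ hχc hχs h
    -- `H` contains first derivatives of `ψⱼ v ∈ H^k`; the parametrix regains two derivatives
    have hHk : MemSobolev (k - 1) 2 H := by
      refine (memSobolev_sum _ fun j _ => ?_).sub ?_
      · exact (ih (ψ j) (hψ j) (hψc j) ((hψs j).trans hχs) (hv₁ j)).lineDerivOp
      · exact (ih ψ₀ hψ₀ hψ₀c (hψ₀s.trans hχs) hv₀).mono (by linarith)
    refine memSobolev_of_eq_add (g := g) (b := fun p x => (β p.1 p.2 x : ℂ)) hg hC.le hgC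
      (fun p => ?_) (fun p => ?_) hδ0.le (fun p x => ?_) hsmall (k + 1)
      (K := fourierMultiplierCLM ℂ q (W - H)) (hzero _ h) ?_ ?_
    · exact Complex.ofRealCLM.contDiff.comp (hβ p.1 p.2)
    · exact (hβc p.1 p.2).comp_left (g := Complex.ofReal) rfl
    · simpa using hβδ p.1 p.2 x
    · have := hq3 (k - 1) _ ((hWk.mono (by linarith : (k:ℝ) - 1 ≤ k)).sub hHk)
      convert this using 1
      push_cast; ring
    · have h1 := hq1 W
      have h2 : W - ∑ p : Fin m × Fin m, ((Matrix.of fun i j => a i j x₀) p.1 p.2 : ℂ) •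
          ∂_{EuclideanSpace.single p.2 (1 : ℝ)} (∂_{EuclideanSpace.single p.1 (1 : ℝ)} W) =
          (W - H) + ∑ p : Fin m × Fin m, ∂_{EuclideanSpace.single p.2 (1 : ℝ)}
            (∂_{EuclideanSpace.single p.1 (1 : ℝ)}
              (smulLeftCLM ℂ (fun x => (β p.1 p.2 x : ℂ)) W)) := by
        rw [← heq]
        simp only [Matrix.of_apply]
        abel
      rw [h2, map_add, map_sum] at h1
      simp only [hq2] at h1
      exact h1.symm

/-- Interior regularity: a very weak solution `v ∈ L²_loc` of a second order linear equation with
smooth coefficients agrees almost everywhere, near a point where the operator is elliptic, with a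
`C²` function. -/
theorem exists_contDiff_two_of_weak {Ω : Set (EuclideanSpace ℝ (Fin m))} (hΩ : IsOpen Ω)
    {a : Fin m → Fin m → EuclideanSpace ℝ (Fin m) → ℝ} {b : Fin m → EuclideanSpace ℝ (Fin m) → ℝ}
    {c v : EuclideanSpace ℝ (Fin m) → ℝ} (ha : ∀ i j, ContDiffOn ℝ ∞ (a i j) Ω)
    (hb : ∀ j, ContDiffOn ℝ ∞ (b j) Ω) (hc : ContDiffOn ℝ ∞ c Ω)
    {x₀ : EuclideanSpace ℝ (Fin m)} (hx₀ : x₀ ∈ Ω)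
    (hell : (Matrix.of fun i j => a i j x₀).PosDef)
    (hv : ∀ χ : EuclideanSpace ℝ (Fin m) → ℝ, ContDiff ℝ ∞ χ → HasCompactSupport χ →
      tsupport χ ⊆ Ω → MemLp (fun x => χ x * v x) 2 volume)
    (hweak : ∀ φ : EuclideanSpace ℝ (Fin m) → ℝ, ContDiff ℝ ∞ φ → HasCompactSupport φ →
      tsupport φ ⊆ Ω → ∫ x, v x * ((∑ i, ∑ j, a i j x * pd i (pd j φ) x) +
        (∑ j, b j x * pd j φ x) + c x * φ x) = 0) :
    ∃ r > 0, Metric.ball x₀ r ⊆ Ω ∧ ∃ V : EuclideanSpace ℝ (Fin m) → ℝ, ContDiff ℝ 2 V ∧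
      ∀ᵐ x, x ∈ Metric.ball x₀ r → v x = V x := by
  obtain ⟨r, hr, hrΩ, hS⟩ := exists_ball_memSobolev hΩ ha hb hc hx₀ hell hv hweak
  let χ : ContDiffBump x₀ := ⟨r / 4, r / 2, by positivity, by linarith⟩
  have hχs : tsupport χ ⊆ Metric.ball x₀ r := by
    rw [χ.tsupport_eq]
    exact Metric.closedBall_subset_ball (by simp only [χ]; linarith)
  have hw := hv χ χ.contDiff χ.hasCompactSupport (hχs.trans hrΩ)
  obtain ⟨V, hV, hVae⟩ := exists_contDiff_two_ae_eq ((MemLp.ofReal (K := ℂ) hw).toLp)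
    fun k => hS k χ χ.contDiff χ.hasCompactSupport hχs hw
  refine ⟨r / 4, by positivity, (Metric.ball_subset_ball (by linarith)).trans hrΩ,
    fun x => (V x).re, Complex.reCLM.contDiff.comp hV, ?_⟩
  filter_upwards [hVae, (MemLp.ofReal (K := ℂ) hw).coeFn_toLp] with x h1 h2 hx
  rw [← h1, h2]
  have : χ x = 1 := χ.one_of_mem_closedBall (Metric.ball_subset_closedBall hx)
  simp [this]

end

/-! ### The metric and the weighted Laplacian in coordinates -/

namespace WeightedManifold
section ChartGeometry
set_option linter.unusedSectionVars false

theorem contDiffOn_comp_extChartAt_symm {m : ℕ} {M : Type*} [MetricSpace M]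
    [ChartedSpace (EuclideanSpace ℝ (Fin m)) M] [IsManifold (𝓡 m) ∞ M] {p : M} {n : WithTop ℕ∞} (hn : n ≤ ∞) {u : M → ℝ}
    (hu : ContMDiffOn (𝓡 m) 𝓘(ℝ, ℝ) n u (extChartAt (𝓡 m) p).source) :
    ContDiffOn ℝ n (u ∘ (extChartAt (𝓡 m) p).symm) (extChartAt (𝓡 m) p).target := by
  rw [← contMDiffOn_iff_contDiffOn]
  exact hu.comp ((contMDiffOn_extChartAt_symm p).of_le hn)
    (fun y hy => (extChartAt (𝓡 m) p).map_target hy)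

variable {m : ℕ} {M : Type*} [MetricSpace M] [ChartedSpace (EuclideanSpace ℝ (Fin m)) M]
  [IsManifold (𝓡 m) ∞ M] [RiemannianBundle (fun x : M => TangentSpace (𝓡 m) x)]

theorem inner_grad (u : M → ℝ) (x : M) (v : TangentSpace (𝓡 m) x) :
    inner ℝ (grad u x) v = mfderiv (𝓡 m) 𝓘(ℝ, ℝ) u x v := by
  have : FiniteDimensional ℝ (TangentSpace (𝓡 m) x) :=
    inferInstanceAs (FiniteDimensional ℝ (EuclideanSpace ℝ (Fin m)))
  have : CompleteSpace (TangentSpace (𝓡 m) x) := FiniteDimensional.complete ℝ _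
  exact InnerProductSpace.toDual_symm_apply

theorem mem_baseSet_of_mem_source {p q : M} (hq : q ∈ (extChartAt (𝓡 m) p).source) :
    q ∈ (trivializationAt (EuclideanSpace ℝ (Fin m)) (TangentSpace (𝓡 m)) p).baseSet := by
  simpa using hq

/-- The coordinate field `∂ᵢ` differentiates a function as the `i`-th partial derivative does. -/
theorem mfderiv_coordVec {p q : M} (hq : q ∈ (extChartAt (𝓡 m) p).source) {u : M → ℝ}
    (hu : MDifferentiableAt (𝓡 m) 𝓘(ℝ, ℝ) u q) (i : Fin m) :
    mfderiv (𝓡 m) 𝓘(ℝ, ℝ) u q (coordVec p q i) =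
      pd i (u ∘ (extChartAt (𝓡 m) p).symm) (extChartAt (𝓡 m) p q) := by
  have : IsManifold (𝓡 m) 1 M := IsManifold.of_le (n := ∞) (by exact_mod_cast le_top)
  have hq' : q ∈ (chartAt (EuclideanSpace ℝ (Fin m)) p).source := by simpa using hq
  have h1 : coordVec p q i = (mfderivWithin 𝓘(ℝ, EuclideanSpace ℝ (Fin m)) (𝓡 m)
      (extChartAt (𝓡 m) p).symm (Set.range (𝓡 m)) (extChartAt (𝓡 m) p q))
      (EuclideanSpace.single i (1:ℝ)) := by
    have := TangentBundle.symmL_trivializationAt (I := 𝓡 m) (𝕜 := ℝ) hq'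
    rw [← this]
    exact (Trivialization.symmL_apply _ (mem_baseSet_of_mem_source hq) _).symm
  have h2 : MDifferentiableWithinAt 𝓘(ℝ, EuclideanSpace ℝ (Fin m)) (𝓡 m)
      (extChartAt (𝓡 m) p).symm (Set.range (𝓡 m)) (extChartAt (𝓡 m) p q) :=
    mdifferentiableWithinAt_extChartAt_symm ((extChartAt (𝓡 m) p).map_source hq)
  have h3 := mfderiv_comp_mfderivWithin_of_eq (I' := 𝓡 m) (I'' := 𝓘(ℝ, ℝ)) (x := extChartAt (𝓡 m) p q) (y := q) (g := u) hu h2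
    (by simp [UniqueMDiffWithinAt]) ((extChartAt (𝓡 m) p).left_inv hq)
  rw [ModelWithCorners.range_eq_univ, mfderivWithin_univ, mfderivWithin_univ] at h3
  rw [h1, pd, ← mfderiv_eq_fderiv, h3, ModelWithCorners.range_eq_univ, mfderivWithin_univ]
  rfl

theorem eq_sum_coordVec (p : M) {q : M} (hq : q ∈ (extChartAt (𝓡 m) p).source)
    (X : ∀ x : M, TangentSpace (𝓡 m) x) :
    X q = ∑ i, coordField p X q i • coordVec p q i := by
  set e := trivializationAt (EuclideanSpace ℝ (Fin m)) (TangentSpace (𝓡 m)) p with he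
  have hb := mem_baseSet_of_mem_source hq
  have h1 : ∀ i, coordVec p q i = (e.linearEquivAt ℝ q hb).symm (EuclideanSpace.single i (1:ℝ)) :=
    fun i => rfl
  have h2 : coordField p X q = e.linearEquivAt ℝ q hb (X q) := rfl
  apply (e.linearEquivAt ℝ q hb).injective
  simp only [map_sum, map_smul, h1, LinearEquiv.apply_symm_apply, ← h2]
  ext j
  simp [Finset.sum_apply, Pi.single_apply]

theorem coordField_eq_of_eq_sum (p : M) {q : M} (hq : q ∈ (extChartAt (𝓡 m) p).source)
    (X : ∀ x : M, TangentSpace (𝓡 m) x) (c : Fin m → ℝ) (hX : X q = ∑ i, c i • coordVec p q i)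
    (i : Fin m) : coordField p X q i = c i := by
  set e := trivializationAt (EuclideanSpace ℝ (Fin m)) (TangentSpace (𝓡 m)) p with he
  have hb := mem_baseSet_of_mem_source hq
  have h1 : ∀ i, coordVec p q i = (e.linearEquivAt ℝ q hb).symm (EuclideanSpace.single i (1:ℝ)) :=
    fun i => rfl
  have h2 : coordField p X q = e.linearEquivAt ℝ q hb (X q) := rfl
  rw [h2, hX]
  simp only [map_sum, map_smul, h1, LinearEquiv.apply_symm_apply]
  simp [Finset.sum_apply, Pi.single_apply]

variable (m) in
/-- The matrix `gᵢⱼ = ⟨∂ᵢ, ∂ⱼ⟩` of the metric, as a function on the image of the chart at `p`. -/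
noncomputable def gram (p : M) (y : EuclideanSpace ℝ (Fin m)) : Matrix (Fin m) (Fin m) ℝ :=
  Matrix.of fun i j =>
    inner ℝ (coordVec p ((extChartAt (𝓡 m) p).symm y) i : TangentSpace (𝓡 m) _)
      (coordVec p ((extChartAt (𝓡 m) p).symm y) j)

theorem contDiffOn_gram [IsContMDiffRiemannianBundle (𝓡 m) ∞ (EuclideanSpace ℝ (Fin m))
      (fun x : M => TangentSpace (𝓡 m) x)] (p : M) (i j : Fin m) :
    ContDiffOn ℝ ∞ (fun y => gram m p y i j) (extChartAt (𝓡 m) p).target := by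
  have h : ∀ i, ContMDiffOn (𝓡 m) ((𝓡 m).prod 𝓘(ℝ, EuclideanSpace ℝ (Fin m))) ∞
      (fun q => (⟨q, coordVec p q i⟩ : TotalSpace (EuclideanSpace ℝ (Fin m)) (TangentSpace (𝓡 m))))
      (extChartAt (𝓡 m) p).source := by
    intro i
    have := (trivializationAt (EuclideanSpace ℝ (Fin m)) (TangentSpace (𝓡 m)) p).contMDiffOn_localFrame_baseSet (I := 𝓡 m) ∞
      (EuclideanSpace.basisFun (Fin m) ℝ).toBasis i
    refine ContMDiffOn.congr (this.mono fun q hq => mem_baseSet_of_mem_source hq) ?_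
    intro q hq
    have hb := mem_baseSet_of_mem_source hq
    rw [Trivialization.localFrame_apply_of_mem_baseSet _ _ hb]
    simp [Trivialization.basisAt, coordVec]
  have h2 := (h i).inner_bundle (h j)
  exact contDiffOn_comp_extChartAt_symm le_rfl h2

theorem gram_posDef (p : M) {y : EuclideanSpace ℝ (Fin m)} (hy : y ∈ (extChartAt (𝓡 m) p).target) :
    (gram m p y).PosDef := by
  have hq := (extChartAt (𝓡 m) p).map_target hy
  have hb := mem_baseSet_of_mem_source hq
  have h1 : LinearIndependent ℝ (fun i : Fin m =>
      (coordVec p ((extChartAt (𝓡 m) p).symm y) i : TangentSpace (𝓡 m) _)) := by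
    have := ((EuclideanSpace.basisFun (Fin m) ℝ).toBasis.linearIndependent).map'
      ((trivializationAt (EuclideanSpace ℝ (Fin m)) (TangentSpace (𝓡 m)) p).linearEquivAt ℝ _ hb).symm.toLinearMap (LinearEquiv.ker _)
    have h0 : (fun i : Fin m => (coordVec p ((extChartAt (𝓡 m) p).symm y) i : TangentSpace (𝓡 m) _)) =
        ((trivializationAt (EuclideanSpace ℝ (Fin m)) (TangentSpace (𝓡 m)) p).linearEquivAt ℝ _ hb).symm.toLinearMap ∘
          (EuclideanSpace.basisFun (Fin m) ℝ).toBasis := by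
      funext i
      rw [Function.comp_apply, OrthonormalBasis.coe_toBasis, EuclideanSpace.basisFun_apply]
      rfl
    rw [h0]
    exact this
  exact Matrix.posDef_gram_of_linearIndependent (𝕜 := ℝ) (E := TangentSpace (𝓡 m) ((extChartAt (𝓡 m) p).symm y)) h1

/-- `(∇u)ⁱ = ∑ⱼ gⁱʲ ∂ⱼu` in a chart. -/
theorem coordField_grad {p : M} {y : EuclideanSpace ℝ (Fin m)}
    (hy : y ∈ (extChartAt (𝓡 m) p).target) {u : M → ℝ}
    (hu : MDifferentiableAt (𝓡 m) 𝓘(ℝ, ℝ) u ((extChartAt (𝓡 m) p).symm y)) (i : Fin m) :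
    coordField p (grad u) ((extChartAt (𝓡 m) p).symm y) i =
      ∑ j, (gram m p y)⁻¹ i j * pd j (u ∘ (extChartAt (𝓡 m) p).symm) y := by
  have hq := (extChartAt (𝓡 m) p).map_target hy
  set q := (extChartAt (𝓡 m) p).symm y with hqdef
  have hyq : extChartAt (𝓡 m) p q = y := (extChartAt (𝓡 m) p).right_inv hy
  have h1 : ∀ j, pd j (u ∘ (extChartAt (𝓡 m) p).symm) y =
      ∑ k, gram m p y j k * coordField p (grad u) q k := by
    intro j
    rw [← hyq, ← mfderiv_coordVec hq hu j, hyq, ← inner_grad]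
    conv_lhs => rw [eq_sum_coordVec p hq (grad u)]
    rw [sum_inner]
    refine Finset.sum_congr rfl fun k _ => ?_
    rw [real_inner_smul_left, mul_comm, real_inner_comm]
    rfl
  have hinv : IsUnit (gram m p y).det := (gram_posDef p hy).det_pos.ne'.isUnit
  have h2 : (gram m p y)⁻¹.mulVec (fun j => pd j (u ∘ (extChartAt (𝓡 m) p).symm) y) =
      fun k => coordField p (grad u) q k := by
    have : (fun j => pd j (u ∘ (extChartAt (𝓡 m) p).symm) y) =
      (gram m p y).mulVec (fun k => coordField p (grad u) q k) := by
      ext j; rw [h1 j]; rfl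
    rw [this, Matrix.mulVec_mulVec, Matrix.nonsing_inv_mul _ hinv, Matrix.one_mulVec]
  exact (congrFun h2 i).symm

/-- `dφ(X) = ∑ᵢ Xⁱ ∂ᵢφ` in a chart. -/
theorem inner_field_grad {p : M} {y : EuclideanSpace ℝ (Fin m)}
    (hy : y ∈ (extChartAt (𝓡 m) p).target) {φ : M → ℝ}
    (hφ : MDifferentiableAt (𝓡 m) 𝓘(ℝ, ℝ) φ ((extChartAt (𝓡 m) p).symm y))
    (X : ∀ x : M, TangentSpace (𝓡 m) x) :
    inner ℝ (X ((extChartAt (𝓡 m) p).symm y)) (grad φ ((extChartAt (𝓡 m) p).symm y)) =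
      ∑ i, coordField p X ((extChartAt (𝓡 m) p).symm y) i *
        pd i (φ ∘ (extChartAt (𝓡 m) p).symm) y := by
  have hq := (extChartAt (𝓡 m) p).map_target hy
  set q := (extChartAt (𝓡 m) p).symm y with hqdef
  have hyq : extChartAt (𝓡 m) p q = y := (extChartAt (𝓡 m) p).right_inv hy
  conv_lhs => rw [eq_sum_coordVec p hq X]
  rw [sum_inner]
  refine Finset.sum_congr rfl fun k _ => ?_
  rw [real_inner_smul_left, real_inner_comm, inner_grad, mfderiv_coordVec hq hφ, hyq]

theorem inner_grad_grad {p : M} {y : EuclideanSpace ℝ (Fin m)}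
    (hy : y ∈ (extChartAt (𝓡 m) p).target) {u φ : M → ℝ}
    (hu : MDifferentiableAt (𝓡 m) 𝓘(ℝ, ℝ) u ((extChartAt (𝓡 m) p).symm y))
    (hφ : MDifferentiableAt (𝓡 m) 𝓘(ℝ, ℝ) φ ((extChartAt (𝓡 m) p).symm y)) :
    inner ℝ (grad u ((extChartAt (𝓡 m) p).symm y) : TangentSpace (𝓡 m) _)
        (grad φ ((extChartAt (𝓡 m) p).symm y)) =
      ∑ i, (∑ j, (gram m p y)⁻¹ i j * pd j (u ∘ (extChartAt (𝓡 m) p).symm) y) *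
        pd i (φ ∘ (extChartAt (𝓡 m) p).symm) y := by
  rw [inner_field_grad hy hφ]
  exact Finset.sum_congr rfl fun i _ => by rw [coordField_grad hy hu]

/-- The density `e^{-f} √(det g)` of `e^{-f} dvol` with respect to Lebesgue measure in the chart at `p`. -/
noncomputable def dens (f : M → ℝ) (p : M) (y : EuclideanSpace ℝ (Fin m)) : ℝ :=
  Real.exp (-f ((extChartAt (𝓡 m) p).symm y)) * volDensity m p ((extChartAt (𝓡 m) p).symm y)

/-- The coefficients `e^{-f} √(det g) gⁱʲ` of the weighted Laplacian in divergence form. -/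
noncomputable def coef (f : M → ℝ) (p : M) (i j : Fin m) (y : EuclideanSpace ℝ (Fin m)) : ℝ :=
  dens f p y * (gram m p y)⁻¹ i j

/-- The expression `L U = (e^{-f} √(det g))⁻¹ ∑ᵢ ∂ᵢ (∑ⱼ e^{-f} √(det g) gⁱʲ ∂ⱼ U)` of the weighted
Laplacian in the chart at `p`. -/
noncomputable def chartLap (f : M → ℝ) (p : M) (U : EuclideanSpace ℝ (Fin m) → ℝ)
    (y : EuclideanSpace ℝ (Fin m)) : ℝ :=
  (dens f p y)⁻¹ * ∑ i, pd i (fun z => ∑ j, coef f p i j z * pd j U z) y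

theorem volDensity_eq (p : M) (y : EuclideanSpace ℝ (Fin m)) :
    volDensity m p ((extChartAt (𝓡 m) p).symm y) = √ (gram m p y).det := rfl

theorem dens_pos (f : M → ℝ) {p : M} {y : EuclideanSpace ℝ (Fin m)}
    (hy : y ∈ (extChartAt (𝓡 m) p).target) : 0 < dens f p y :=
  mul_pos (Real.exp_pos _) (by rw [volDensity_eq]; exact Real.sqrt_pos.2 (gram_posDef p hy).det_pos)

theorem coef_posDef (f : M → ℝ) {p : M} {y : EuclideanSpace ℝ (Fin m)}
    (hy : y ∈ (extChartAt (𝓡 m) p).target) : (Matrix.of fun i j => coef f p i j y).PosDef := by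
  have := (gram_posDef p hy).inv.smul (dens_pos f hy)
  exact this

theorem fLaplacian_eq_chartLap (f : M → ℝ) {u : M → ℝ}
    (hu : ContMDiff (𝓡 m) 𝓘(ℝ, ℝ) 2 u) (x : M) :
    fLaplacian m f u x = chartLap f x (u ∘ (extChartAt (𝓡 m) x).symm) (extChartAt (𝓡 m) x x) := by
  have hx : extChartAt (𝓡 m) x x ∈ (extChartAt (𝓡 m) x).target := mem_extChartAt_target x
  have hxx : (extChartAt (𝓡 m) x).symm (extChartAt (𝓡 m) x x) = x := extChartAt_to_inv x
  have hd : Real.exp (f x) * (volDensity m x x)⁻¹ = (dens f x (extChartAt (𝓡 m) x x))⁻¹ := by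
    rw [dens, hxx, mul_inv, Real.exp_neg, inv_inv]
  rw [fLaplacian, fDivergence, divergence, ← mul_assoc, hd, chartLap]
  congr 1
  refine Finset.sum_congr rfl fun i _ => ?_
  rw [pd]
  congr 1
  apply Filter.EventuallyEq.fderiv_eq
  filter_upwards [(isOpen_extChartAt_target x).mem_nhds hx] with y hy
  have h1 : coordField x (fun q => Real.exp (-f q) • grad u q) ((extChartAt (𝓡 m) x).symm y) i =
      Real.exp (-f ((extChartAt (𝓡 m) x).symm y)) *
        coordField x (grad u) ((extChartAt (𝓡 m) x).symm y) i := by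
    have hq := (extChartAt (𝓡 m) x).map_target hy
    refine coordField_eq_of_eq_sum x hq _ (fun i => Real.exp (-f ((extChartAt (𝓡 m) x).symm y)) *
        coordField x (grad u) ((extChartAt (𝓡 m) x).symm y) i) ?_ i
    dsimp only
    conv_lhs => rw [eq_sum_coordVec x hq (grad u)]
    rw [Finset.smul_sum]
    exact Finset.sum_congr rfl fun k _ => smul_smul _ _ _
  rw [h1, coordField_grad hy (hu.mdifferentiable (by norm_num) _), Finset.mul_sum, Finset.mul_sum]
  refine Finset.sum_congr rfl fun j _ => ?_
  rw [coef, dens]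
  ring

theorem contDiffOn_dens [IsContMDiffRiemannianBundle (𝓡 m) ∞ (EuclideanSpace ℝ (Fin m))
      (fun x : M => TangentSpace (𝓡 m) x)] {f : M → ℝ} (hf : ContMDiff (𝓡 m) 𝓘(ℝ, ℝ) ∞ f) (p : M) :
    ContDiffOn ℝ ∞ (dens f p) (extChartAt (𝓡 m) p).target := by
  refine ContDiffOn.mul ?_ ?_
  · exact Real.contDiff_exp.comp_contDiffOn (contDiffOn_comp_extChartAt_symm le_rfl hf.contMDiffOn).neg
  · have : ContDiffOn ℝ ∞ (fun y => (gram m p y).det) (extChartAt (𝓡 m) p).target := by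
      simp only [Matrix.det_apply]
      refine ContDiffOn.sum fun σ _ => ContDiffOn.const_smul _ ?_
      exact contDiffOn_prod fun i _ => contDiffOn_gram p _ _
    exact this.sqrt fun y hy => (gram_posDef p hy).det_pos.ne'

theorem contDiffOn_coef [IsContMDiffRiemannianBundle (𝓡 m) ∞ (EuclideanSpace ℝ (Fin m))
      (fun x : M => TangentSpace (𝓡 m) x)] {f : M → ℝ} (hf : ContMDiff (𝓡 m) 𝓘(ℝ, ℝ) ∞ f) (p : M)
    (i j : Fin m) :
    ContDiffOn ℝ ∞ (coef f p i j) (extChartAt (𝓡 m) p).target := by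
  refine (contDiffOn_dens hf p).mul ?_
  have h1 : ∀ A : Matrix (Fin m) (Fin m) ℝ, A⁻¹ i j = A.det⁻¹ * A.adjugate i j := fun A => by
    rw [Matrix.inv_def, Ring.inverse_eq_inv']; rfl
  simp only [h1]
  have hdet : ∀ B : EuclideanSpace ℝ (Fin m) → Matrix (Fin m) (Fin m) ℝ,
      (∀ i j, ContDiffOn ℝ ∞ (fun y => B y i j) (extChartAt (𝓡 m) p).target) →
      ContDiffOn ℝ ∞ (fun y => (B y).det) (extChartAt (𝓡 m) p).target := by
    intro B hB
    simp only [Matrix.det_apply]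
    refine ContDiffOn.sum fun σ _ => ContDiffOn.const_smul _ ?_
    exact contDiffOn_prod fun i _ => hB _ _
  refine ((hdet _ (contDiffOn_gram p)).inv fun y hy => (gram_posDef p hy).det_pos.ne').mul ?_
  simp only [Matrix.adjugate_apply]
  refine hdet _ fun k l => ?_
  by_cases hk : k = j
  · subst hk
    simp only [Matrix.updateRow_self]
    exact contDiffOn_const
  · simp only [Matrix.updateRow_ne hk]
    exact contDiffOn_gram p k l

end ChartGeometry
end WeightedManifold

/-! ### The weighted volume in coordinates -/

namespace WeightedManifold
section VolumeMeasure
set_option linter.unusedSectionVars false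

variable {m : ℕ} {M : Type*} [MetricSpace M] [ChartedSpace (EuclideanSpace ℝ (Fin m)) M]
  [IsManifold (𝓡 m) ∞ M] [RiemannianBundle (fun x : M => TangentSpace (𝓡 m) x)]
  [IsContMDiffRiemannianBundle (𝓡 m) ∞ (EuclideanSpace ℝ (Fin m))
      (fun x : M => TangentSpace (𝓡 m) x)]

theorem measurableSet_target (p : M) : MeasurableSet (extChartAt (𝓡 m) p).target :=
  (isOpen_extChartAt_target p).measurableSet

theorem differentiableAt_transition {p q a : M} (hp : a ∈ (extChartAt (𝓡 m) p).source)
    (hq : a ∈ (extChartAt (𝓡 m) q).source) :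
    DifferentiableAt ℝ (extChartAt (𝓡 m) q ∘ (extChartAt (𝓡 m) p).symm) (extChartAt (𝓡 m) p a) := by
  have : IsManifold (𝓡 m) 1 M := IsManifold.of_le (n := ∞) (by exact_mod_cast le_top)
  have hD : MDifferentiableAt (𝓡 m) 𝓘(ℝ, EuclideanSpace ℝ (Fin m)) (extChartAt (𝓡 m) q) a :=
    mdifferentiableAt_extChartAt (by simpa using hq)
  rw [← mdifferentiableAt_iff_differentiableAt]
  have h2 := mdifferentiableWithinAt_extChartAt_symm (I := 𝓡 m)
    ((extChartAt (𝓡 m) p).map_source hp)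
  rw [ModelWithCorners.range_eq_univ, mdifferentiableWithinAt_univ] at h2
  exact MDifferentiableAt.comp_of_eq (I' := 𝓡 m) _ (y := a) hD h2
    ((extChartAt (𝓡 m) p).left_inv hp)

/-- The coordinate fields of two charts are related by the Jacobian matrix of the transition map. -/
theorem coordVec_eq_sum {p q a : M} (hp : a ∈ (extChartAt (𝓡 m) p).source)
    (hq : a ∈ (extChartAt (𝓡 m) q).source) (i : Fin m) :
    coordVec p a i = ∑ k, (fderiv ℝ (extChartAt (𝓡 m) q ∘ (extChartAt (𝓡 m) p).symm)
      (extChartAt (𝓡 m) p a) (EuclideanSpace.single i 1)) k • coordVec q a k := by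
  have : IsManifold (𝓡 m) 1 M := IsManifold.of_le (n := ∞) (by exact_mod_cast le_top)
  have hD : MDifferentiableAt (𝓡 m) 𝓘(ℝ, EuclideanSpace ℝ (Fin m)) (extChartAt (𝓡 m) q) a :=
    mdifferentiableAt_extChartAt (by simpa using hq)
  have hu : ∀ k : Fin m, MDifferentiableAt (𝓡 m) 𝓘(ℝ, ℝ) (fun x => extChartAt (𝓡 m) q x k) a := by
    intro k
    exact (((EuclideanSpace.proj k : EuclideanSpace ℝ (Fin m) →L[ℝ] ℝ).differentiableAt).mdifferentiableAt).comp a hD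
  have hT := differentiableAt_transition hp hq
  rw [eq_sum_coordVec q hq (fun x => coordVec p x i)]
  refine Finset.sum_congr rfl fun k _ => ?_
  congr 1
  have h1 := mfderiv_coordVec hp (hu k) i
  rw [eq_sum_coordVec q hq (fun x => coordVec p x i), map_sum] at h1
  simp only [map_smul] at h1
  have h2 : ∀ j, mfderiv (𝓡 m) 𝓘(ℝ, ℝ) (fun x => extChartAt (𝓡 m) q x k) a (coordVec q a j) =
      if k = j then (1:ℝ) else 0 := by
    intro j
    rw [mfderiv_coordVec hq (hu k) j, pd]
    have : ((fun x => extChartAt (𝓡 m) q x k) ∘ (extChartAt (𝓡 m) q).symm) =ᶠ[nhds (extChartAt (𝓡 m) q a)]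
        (EuclideanSpace.proj k : EuclideanSpace ℝ (Fin m) →L[ℝ] ℝ) := by
      filter_upwards [(isOpen_extChartAt_target q).mem_nhds ((extChartAt (𝓡 m) q).map_source hq)] with z hz
      simp only [Function.comp_apply, (extChartAt (𝓡 m) q).right_inv hz]
      rfl
    rw [this.fderiv_eq, ContinuousLinearMap.fderiv]
    simp
    rfl
  simp only [h2] at h1
  have h3 : pd i ((fun x => extChartAt (𝓡 m) q x k) ∘ (extChartAt (𝓡 m) p).symm) (extChartAt (𝓡 m) p a) =
      (fderiv ℝ (extChartAt (𝓡 m) q ∘ (extChartAt (𝓡 m) p).symm)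
      (extChartAt (𝓡 m) p a) (EuclideanSpace.single i 1)) k := by
    rw [pd]
    have : ((fun x => extChartAt (𝓡 m) q x k) ∘ (extChartAt (𝓡 m) p).symm) =
      (EuclideanSpace.proj k : EuclideanSpace ℝ (Fin m) →L[ℝ] ℝ) ∘ (extChartAt (𝓡 m) q ∘ (extChartAt (𝓡 m) p).symm) := rfl
    rw [this, fderiv_comp _ (ContinuousLinearMap.differentiableAt _) hT, ContinuousLinearMap.fderiv]
    rfl
  rw [h3] at h1
  have h4 : ∑ j, coordField q (fun x => coordVec p x i) a j * (if k = j then (1:ℝ) else 0) = _ := h1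
  rw [← h4]
  simp

/-- `√(det g)` is a density: it changes by the Jacobian determinant of the transition map. -/
theorem volDensity_change {p q a : M} (hp : a ∈ (extChartAt (𝓡 m) p).source)
    (hq : a ∈ (extChartAt (𝓡 m) q).source) :
    volDensity m p a = |(fderiv ℝ (extChartAt (𝓡 m) q ∘ (extChartAt (𝓡 m) p).symm)
      (extChartAt (𝓡 m) p a)).det| * volDensity m q a := by
  set T := fderiv ℝ (extChartAt (𝓡 m) q ∘ (extChartAt (𝓡 m) p).symm) (extChartAt (𝓡 m) p a)
  set J : Matrix (Fin m) (Fin m) ℝ := Matrix.of fun k i => (T (EuclideanSpace.single i 1)) k with hJ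
  have hdet : T.det = J.det := by
    rw [ContinuousLinearMap.det, ← LinearMap.det_toMatrix (EuclideanSpace.basisFun (Fin m) ℝ).toBasis]
    congr 1
  have hG : (Matrix.of fun i j : Fin m =>
      inner ℝ (coordVec p a i : TangentSpace (𝓡 m) a) (coordVec p a j)) =
      J.transpose * (Matrix.of fun i j : Fin m =>
      inner ℝ (coordVec q a i : TangentSpace (𝓡 m) a) (coordVec q a j)) * J := by
    ext i j
    rw [Matrix.of_apply, coordVec_eq_sum hp hq i, coordVec_eq_sum hp hq j, sum_inner, Matrix.mul_assoc]
    rw [Matrix.mul_apply]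
    refine Finset.sum_congr rfl fun k _ => ?_
    rw [real_inner_smul_left, inner_sum, Matrix.mul_apply]
    congr 1
    refine Finset.sum_congr rfl fun l _ => ?_
    rw [real_inner_smul_right, mul_comm]
    rfl
  rw [volDensity, volDensity, hG, Matrix.det_mul, Matrix.det_mul, Matrix.det_transpose, hdet,
    show ∀ D : ℝ, J.det * D * J.det = J.det ^ 2 * D from fun D => by ring,
    Real.sqrt_mul (sq_nonneg _), Real.sqrt_sq_eq_abs]

theorem continuousOn_volDensity (p : M) :
    ContinuousOn (fun y => volDensity m p ((extChartAt (𝓡 m) p).symm y)) (extChartAt (𝓡 m) p).target := by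
  have := (contDiffOn_dens (m := m) (f := fun _ : M => (0:ℝ)) contMDiff_const p).continuousOn
  refine this.congr fun y hy => ?_
  simp [dens]

variable [MeasurableSpace M] [BorelSpace M]

theorem aemeasurable_symm (p : M) : AEMeasurable (extChartAt (𝓡 m) p).symm
    ((volume : Measure (EuclideanSpace ℝ (Fin m))).restrict (extChartAt (𝓡 m) p).target) :=
  (continuousOn_extChartAt_symm p).aemeasurable (measurableSet_target p)

theorem chartVolume_apply (p : M) {S : Set M} (hS : MeasurableSet S) :
    chartVolume m p S = ∫⁻ y in (extChartAt (𝓡 m) p).target ∩ (extChartAt (𝓡 m) p).symm ⁻¹' S,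
      ENNReal.ofReal (volDensity m p ((extChartAt (𝓡 m) p).symm y)) := by
  have h1 : AEMeasurable (extChartAt (𝓡 m) p).symm
    (((volume : Measure (EuclideanSpace ℝ (Fin m))).restrict (extChartAt (𝓡 m) p).target).withDensity
    fun y => ENNReal.ofReal (volDensity m p ((extChartAt (𝓡 m) p).symm y))) :=
    (aemeasurable_symm p).mono_ac (withDensity_absolutelyContinuous _ _)
  have h2 : NullMeasurableSet ((extChartAt (𝓡 m) p).symm ⁻¹' S)
    ((volume : Measure (EuclideanSpace ℝ (Fin m))).restrict (extChartAt (𝓡 m) p).target) :=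
    (aemeasurable_symm p).nullMeasurable hS
  rw [chartVolume, Measure.map_apply_of_aemeasurable h1 hS, withDensity_apply₀ _ h2,
    Measure.restrict_restrict₀ h2, Set.inter_comm]

/-- The volume measures of two chart domains agree on the overlap, by the change of variables
formula. -/
theorem chartVolume_overlap (p q : M) {S : Set M} (hS : MeasurableSet S)
    (hp : S ⊆ (extChartAt (𝓡 m) p).source) (hq : S ⊆ (extChartAt (𝓡 m) q).source) :
    chartVolume m p S = chartVolume m q S := by
  have hms : ∀ p : M, MeasurableSet ((extChartAt (𝓡 m) p).target ∩ (extChartAt (𝓡 m) p).symm ⁻¹' S) := by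
    intro p
    have h := (continuousOn_iff_continuous_domRestrict.1
      (continuousOn_extChartAt_symm (I := 𝓡 m) p)).measurable hS
    have h2 := (measurableSet_target p).subtype_image h
    convert h2 using 1
    ext y
    simp only [Set.mem_inter_iff, Set.mem_preimage, Set.mem_image, Set.domRestrict_apply, Subtype.exists, exists_and_left, exists_prop]
    exact ⟨fun h => ⟨y, h.2, h.1, rfl⟩, fun ⟨a, h1, h2, h3⟩ => h3 ▸ ⟨h2, h1⟩⟩
  rw [chartVolume_apply p hS, chartVolume_apply q hS]
  set τ := extChartAt (𝓡 m) q ∘ (extChartAt (𝓡 m) p).symm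
  have him : (extChartAt (𝓡 m) q).target ∩ (extChartAt (𝓡 m) q).symm ⁻¹' S =
      τ '' ((extChartAt (𝓡 m) p).target ∩ (extChartAt (𝓡 m) p).symm ⁻¹' S) := by
    ext z
    constructor
    · rintro ⟨hz, hzS⟩
      refine ⟨extChartAt (𝓡 m) p ((extChartAt (𝓡 m) q).symm z), ⟨(extChartAt (𝓡 m) p).map_source (hp hzS), ?_⟩, ?_⟩
      · simpa only [Set.mem_preimage, (extChartAt (𝓡 m) p).left_inv (hp hzS)] using hzS
      · simp only [τ, Function.comp_apply, (extChartAt (𝓡 m) p).left_inv (hp hzS), (extChartAt (𝓡 m) q).right_inv hz]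
    · rintro ⟨y, ⟨hy, hyS⟩, rfl⟩
      refine ⟨(extChartAt (𝓡 m) q).map_source (hq hyS), ?_⟩
      simpa only [τ, Function.comp_apply, Set.mem_preimage, (extChartAt (𝓡 m) q).left_inv (hq hyS)] using hyS
  have hinj : Set.InjOn τ ((extChartAt (𝓡 m) p).target ∩ (extChartAt (𝓡 m) p).symm ⁻¹' S) := by
    rintro y ⟨hy, hyS⟩ z ⟨hz, hzS⟩ h
    have := (extChartAt (𝓡 m) q).injOn (hq hyS) (hq hzS) h
    exact (extChartAt (𝓡 m) p).symm.injOn hy hz this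
  have hder : ∀ y ∈ (extChartAt (𝓡 m) p).target ∩ (extChartAt (𝓡 m) p).symm ⁻¹' S,
      HasFDerivWithinAt τ (fderiv ℝ τ y) ((extChartAt (𝓡 m) p).target ∩ (extChartAt (𝓡 m) p).symm ⁻¹' S) y := by
    rintro y ⟨hy, hyS⟩
    have := differentiableAt_transition (hp hyS) (hq hyS)
    rw [(extChartAt (𝓡 m) p).right_inv hy] at this
    exact this.hasFDerivAt.hasFDerivWithinAt
  rw [him, lintegral_image_eq_lintegral_abs_det_fderiv_mul volume (hms p) hder hinj]
  refine setLIntegral_congr_fun (hms p) fun y hy => ?_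
  have h := volDensity_change (hp hy.2) (hq hy.2)
  rw [h, ENNReal.ofReal_mul (abs_nonneg _), (extChartAt (𝓡 m) p).right_inv hy.1]
  simp only [τ, Function.comp_apply, (extChartAt (𝓡 m) q).left_inv (hq hy.2)]

theorem chartVolume_inter_source (p : M) {S : Set M} (hS : MeasurableSet S) :
    chartVolume m p (S ∩ (extChartAt (𝓡 m) p).source) = chartVolume m p S := by
  rw [chartVolume_apply p hS, chartVolume_apply p (hS.inter (isOpen_extChartAt_source p).measurableSet)]
  congr 2
  ext y
  constructor
  · exact fun h => ⟨h.1, h.2.1⟩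
  · exact fun h => ⟨h.1, h.2, (extChartAt (𝓡 m) p).map_target h.1⟩

/-- The volume measure restricts to the chart measure on each chart domain. -/
theorem riemannianVolume_apply (p : M) {S : Set M} (hS : MeasurableSet S)
    (hp : S ⊆ (extChartAt (𝓡 m) p).source) :
    riemannianVolume m M S = chartVolume m p S := by
  have hO : MeasurableSet (extChartAt (𝓡 m) p).source := (isOpen_extChartAt_source p).measurableSet
  refine le_antisymm ?_ (Measure.le_iff'.1 (le_iSup (fun q : M => chartVolume m q) p) S)
  -- an upper bound, among the measures, for all the `chartVolume q`
  have hle : riemannianVolume m M ≤ chartVolume m p +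
      (riemannianVolume m M).restrict (extChartAt (𝓡 m) p).sourceᶜ := by
    refine iSup_le fun q => Measure.le_iff.2 fun B hB => ?_
    rw [Measure.add_apply, Measure.restrict_apply hB, ← measure_inter_add_sdiff B hO]
    refine add_le_add ?_ ?_
    · have hO' : MeasurableSet (extChartAt (𝓡 m) q).source := (isOpen_extChartAt_source q).measurableSet
      rw [← chartVolume_inter_source q (hB.inter hO), ← chartVolume_overlap p q ((hB.inter hO).inter hO')
        (fun x hx => hx.1.2) (fun x hx => hx.2)]
      exact measure_mono fun x hx => hx.1.1
    · exact Measure.le_iff'.1 (le_iSup (fun q : M => chartVolume m q) q) _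
  refine (Measure.le_iff'.1 hle S).trans ?_
  rw [Measure.add_apply, Measure.restrict_apply hS]
  have : S ∩ (extChartAt (𝓡 m) p).sourceᶜ = ∅ := by
    ext x; simp only [Set.mem_inter_iff, Set.mem_compl_iff, Set.mem_empty_iff_false, iff_false]
    exact fun h => h.2 (hp h.1)
  rw [this, measure_empty, add_zero]

variable (m) in
/-- The measure `e^{-f} √(det g) dy` on the image of the chart at `p`. -/
noncomputable def chartMeasure (f : M → ℝ) (p : M) : Measure (EuclideanSpace ℝ (Fin m)) :=
  ((volume : Measure (EuclideanSpace ℝ (Fin m))).restrict (extChartAt (𝓡 m) p).target).withDensity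
    fun y => ENNReal.ofReal (dens f p y)

theorem aemeasurable_symm_chartMeasure (f : M → ℝ) (p : M) :
    AEMeasurable (extChartAt (𝓡 m) p).symm (chartMeasure m f p) :=
  (aemeasurable_symm p).mono_ac (withDensity_absolutelyContinuous _ _)

theorem riemannianVolume_restrict (p : M) :
    (riemannianVolume m M).restrict (extChartAt (𝓡 m) p).source = chartVolume m p := by
  ext S hS
  rw [Measure.restrict_apply hS, riemannianVolume_apply p
    (hS.inter (isOpen_extChartAt_source p).measurableSet) Set.inter_subset_right,
    chartVolume_inter_source p hS]

/-- In the chart at `p`, the measure `e^{-f} dvol` is `e^{-f} √(det g) dy`. -/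
theorem weightedVolume_restrict {f : M → ℝ} (hf : Continuous f) (p : M) :
    (weightedVolume m f).restrict (extChartAt (𝓡 m) p).source =
      (chartMeasure m f p).map (extChartAt (𝓡 m) p).symm := by
  have hO : MeasurableSet (extChartAt (𝓡 m) p).source := (isOpen_extChartAt_source p).measurableSet
  rw [weightedVolume, restrict_withDensity hO, riemannianVolume_restrict, chartVolume]
  have h1 : AEMeasurable (fun y => ENNReal.ofReal (volDensity m p ((extChartAt (𝓡 m) p).symm y)))
    ((volume : Measure (EuclideanSpace ℝ (Fin m))).restrict (extChartAt (𝓡 m) p).target) :=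
    ((continuousOn_volDensity p).aemeasurable (measurableSet_target p)).ennreal_ofReal
  have h2 : AEMeasurable (extChartAt (𝓡 m) p).symm
    (((volume : Measure (EuclideanSpace ℝ (Fin m))).restrict (extChartAt (𝓡 m) p).target).withDensity
    fun y => ENNReal.ofReal (volDensity m p ((extChartAt (𝓡 m) p).symm y))) :=
    (aemeasurable_symm p).mono_ac (withDensity_absolutelyContinuous _ _)
  have h3 : Measurable fun x => ENNReal.ofReal (Real.exp (-f x)) := by fun_prop
  have h4 : AEMeasurable (fun y => ENNReal.ofReal (Real.exp (-f ((extChartAt (𝓡 m) p).symm y))))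
    ((volume : Measure (EuclideanSpace ℝ (Fin m))).restrict (extChartAt (𝓡 m) p).target) :=
    h3.comp_aemeasurable (aemeasurable_symm p)
  ext S hS
  rw [Measure.map_apply_of_aemeasurable (aemeasurable_symm_chartMeasure f p) hS,
    withDensity_apply _ hS, Measure.restrict_map_of_aemeasurable h2 hS,
    lintegral_map' h3.aemeasurable h2.restrict, chartMeasure, withDensity_apply₀ _
      ((aemeasurable_symm p).nullMeasurable hS), restrict_withDensity',
    lintegral_withDensity_eq_lintegral_mul₀ h1.restrict h4.restrict]
  refine lintegral_congr fun y => ?_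
  rw [Pi.mul_apply, dens, ENNReal.ofReal_mul (Real.exp_pos _).le, mul_comm]

theorem chartMeasure_toReal_smul {f : M → ℝ} (p : M) (h : EuclideanSpace ℝ (Fin m) → ℝ) :
    (ContDiffOn ℝ ∞ (dens f p) (extChartAt (𝓡 m) p).target) →
    ∫ y, h y ∂(chartMeasure m f p) = ∫ y in (extChartAt (𝓡 m) p).target, dens f p y * h y := by
  intro hd
  rw [chartMeasure, integral_withDensity_eq_integral_toReal_smul₀
    ((hd.continuousOn.aemeasurable (measurableSet_target p)).ennreal_ofReal) (by simp)]
  refine setIntegral_congr_fun (measurableSet_target p) fun y hy => ?_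
  simp only [ENNReal.toReal_ofReal (dens_pos f hy).le, smul_eq_mul]

theorem setIntegral_source {f : M → ℝ} (hf : ContMDiff (𝓡 m) 𝓘(ℝ, ℝ) ∞ f) (p : M) {h : M → ℝ}
    (hh : AEStronglyMeasurable h ((weightedVolume m f).restrict (extChartAt (𝓡 m) p).source)) :
    ∫ x in (extChartAt (𝓡 m) p).source, h x ∂(weightedVolume m f) =
      ∫ y in (extChartAt (𝓡 m) p).target, dens f p y * h ((extChartAt (𝓡 m) p).symm y) := by
  rw [weightedVolume_restrict hf.continuous] at hh ⊢
  rw [integral_map (aemeasurable_symm_chartMeasure f p) hh,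
    chartMeasure_toReal_smul p _ (contDiffOn_dens hf p)]

theorem weightedVolume_apply {f : M → ℝ} (hf : Continuous f) (p : M) {S : Set M}
    (hS : MeasurableSet S) (hp : S ⊆ (extChartAt (𝓡 m) p).source) :
    weightedVolume m f S = ∫⁻ y in (extChartAt (𝓡 m) p).target ∩ (extChartAt (𝓡 m) p).symm ⁻¹' S,
      ENNReal.ofReal (dens f p y) := by
  rw [← Measure.restrict_eq_self _ hp, weightedVolume_restrict hf,
    Measure.map_apply_of_aemeasurable (aemeasurable_symm_chartMeasure f p) hS, chartMeasure,
    withDensity_apply₀ _ ((aemeasurable_symm p).nullMeasurable hS), Measure.restrict_restrict₀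
    ((aemeasurable_symm p).nullMeasurable hS), Set.inter_comm]

theorem isLocallyFiniteMeasure_weightedVolume {f : M → ℝ} (hf : ContMDiff (𝓡 m) 𝓘(ℝ, ℝ) ∞ f) :
    IsLocallyFiniteMeasure (weightedVolume m f) := by
  refine ⟨fun x => ?_⟩
  have hx : extChartAt (𝓡 m) x x ∈ (extChartAt (𝓡 m) x).target := mem_extChartAt_target x
  obtain ⟨r, hr, hsub⟩ := Metric.nhds_basis_closedBall.mem_iff.1
    ((isOpen_extChartAt_target x).mem_nhds hx)
  have hK : IsCompact (Metric.closedBall (extChartAt (𝓡 m) x x) r) := isCompact_closedBall _ _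
  obtain ⟨C, hC⟩ := hK.bddAbove_image ((contDiffOn_dens hf x).continuousOn.mono hsub)
  set U := (extChartAt (𝓡 m) x).source ∩ extChartAt (𝓡 m) x ⁻¹' Metric.ball (extChartAt (𝓡 m) x x) r with hU
  have hUo : IsOpen U := (continuousOn_extChartAt x).isOpen_inter_preimage (isOpen_extChartAt_source x) Metric.isOpen_ball
  refine ⟨U, hUo.mem_nhds ⟨mem_extChartAt_source x, Metric.mem_ball_self hr⟩, ?_⟩
  rw [weightedVolume_apply hf.continuous x hUo.measurableSet Set.inter_subset_left]
  have hsubK : (extChartAt (𝓡 m) x).target ∩ (extChartAt (𝓡 m) x).symm ⁻¹' U ⊆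
      Metric.closedBall (extChartAt (𝓡 m) x x) r := by
    rintro y ⟨hy, hyU⟩
    have := hyU.2
    rw [Set.mem_preimage, (extChartAt (𝓡 m) x).right_inv hy] at this
    exact Metric.ball_subset_closedBall this
  refine (lintegral_mono_set hsubK).trans_lt ?_
  refine (setLIntegral_mono' (g := fun _ => ENNReal.ofReal C) hK.measurableSet fun y hy => ENNReal.ofReal_le_ofReal (hC ⟨y, hy, rfl⟩)).trans_lt ?_
  rw [setLIntegral_const]
  exact ENNReal.mul_lt_top ENNReal.ofReal_lt_top hK.measure_lt_top

theorem isOpenPosMeasure_weightedVolume {f : M → ℝ} (hf : ContMDiff (𝓡 m) 𝓘(ℝ, ℝ) ∞ f) :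
    (weightedVolume m f).IsOpenPosMeasure := by
  refine ⟨fun U hU ⟨x, hxU⟩ h0 => ?_⟩
  set V := U ∩ (extChartAt (𝓡 m) x).source
  have hV : IsOpen V := hU.inter (isOpen_extChartAt_source x)
  have hV0 : weightedVolume m f V = 0 := measure_mono_null Set.inter_subset_left h0
  rw [weightedVolume_apply hf.continuous x hV.measurableSet Set.inter_subset_right] at hV0
  have hW : IsOpen ((extChartAt (𝓡 m) x).target ∩ (extChartAt (𝓡 m) x).symm ⁻¹' V) :=
    (continuousOn_extChartAt_symm x).isOpen_inter_preimage (isOpen_extChartAt_target x) hV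
  have hd : AEMeasurable (fun y => ENNReal.ofReal (dens f x y))
      ((volume : Measure (EuclideanSpace ℝ (Fin m))).restrict
        ((extChartAt (𝓡 m) x).target ∩ (extChartAt (𝓡 m) x).symm ⁻¹' V)) :=
    (((contDiffOn_dens hf x).continuousOn.mono Set.inter_subset_left).aemeasurable
      hW.measurableSet).ennreal_ofReal
  rw [lintegral_eq_zero_iff' hd, Filter.EventuallyEq, ae_restrict_iff' hW.measurableSet] at hV0
  have h1 : (volume : Measure (EuclideanSpace ℝ (Fin m))) ((extChartAt (𝓡 m) x).target ∩ (extChartAt (𝓡 m) x).symm ⁻¹' V) = 0 := by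
    rw [measure_eq_zero_iff_ae_notMem]
    filter_upwards [hV0] with y hy hyW
    have := hy hyW
    simp only [Pi.zero_apply, ENNReal.ofReal_eq_zero] at this
    exact absurd (dens_pos f hyW.1) (not_lt.2 this)
  replace h1 := (hW.measure_eq_zero_iff (volume : Measure (EuclideanSpace ℝ (Fin m)))).1 h1
  have h2 : extChartAt (𝓡 m) x x ∈ (extChartAt (𝓡 m) x).target ∩ (extChartAt (𝓡 m) x).symm ⁻¹' V := by
    refine ⟨mem_extChartAt_target x, ?_⟩
    rw [Set.mem_preimage, extChartAt_to_inv]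
    exact ⟨hxU, mem_extChartAt_source x⟩
  rw [h1] at h2
  exact h2

end VolumeMeasure
end WeightedManifold

/-! ### Transfer of functions between a chart and the manifold -/

namespace WeightedManifold
section ChartTransfer
set_option linter.unusedSectionVars false
open scoped Topology

theorem integrable_mul_of_tsupport_subset {m : ℕ} {Ω : Set (EuclideanSpace ℝ (Fin m))}
    (hΩ : IsOpen Ω) {ψ F : EuclideanSpace ℝ (Fin m) → ℝ} (hψ : Continuous ψ)
    (hc : HasCompactSupport ψ) (hs : tsupport ψ ⊆ Ω) (hF : ContinuousOn F Ω) :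
    Integrable (fun x => ψ x * F x) volume := by
  have := contDiff_mul_of_tsupport_subset (n := 0) hΩ (contDiff_zero.2 hψ) (contDiffOn_zero.2 hF) hs
  exact this.continuous.integrable_of_hasCompactSupport hc.mul_right

/-- Integration by parts on an open set, against a compactly supported function. -/
theorem integral_mul_pd_eq_neg {m : ℕ} {Ω : Set (EuclideanSpace ℝ (Fin m))}
    (hΩ : IsOpen Ω) {ψ F : EuclideanSpace ℝ (Fin m) → ℝ} (hψ : ContDiff ℝ 1 ψ)
    (hc : HasCompactSupport ψ) (hs : tsupport ψ ⊆ Ω) (hF : ContDiffOn ℝ 1 F Ω) (i : Fin m) :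
    ∫ x, ψ x * pd i F x = -∫ x, pd i ψ x * F x := by
  have hψ' : Continuous (pd i ψ) := (ContDiff.pd (k := 0) (n := 1) hψ i (by simp)).continuous
  have hF' : ContinuousOn (pd i F) Ω := (ContDiffOn.pd (k := 0) (n := 1) hF hΩ i (by simp)).continuousOn
  refine integral_mul_fderiv_eq_neg_fderiv_mul_of_integrable ?_ ?_ ?_ ?_ ?_
  · exact integrable_mul_of_tsupport_subset hΩ hψ' (hc.pd i) ((tsupport_pd_subset i ψ).trans hs) hF.continuousOn
  · exact integrable_mul_of_tsupport_subset hΩ hψ.continuous hc hs hF'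
  · exact integrable_mul_of_tsupport_subset hΩ hψ.continuous hc hs hF.continuousOn
  · exact fun x _ => hψ.differentiable (by norm_num) x
  · exact fun x hx => (hF.differentiableOn (by norm_num)).differentiableAt (hΩ.mem_nhds (hs hx))

variable {m : ℕ} {M : Type*} [MetricSpace M] [ChartedSpace (EuclideanSpace ℝ (Fin m)) M]
  [IsManifold (𝓡 m) ∞ M]

variable (m) in
open scoped Classical in
/-- The function on `M` that is `χ` in the chart at `p`, extended by zero. -/
noncomputable def pull (p : M) (χ : EuclideanSpace ℝ (Fin m) → ℝ) (x : M) : ℝ :=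
  if x ∈ (extChartAt (𝓡 m) p).source then χ (extChartAt (𝓡 m) p x) else 0

variable (m) in
open scoped Classical in
/-- The expression of a function on `M` in the chart at `p`, extended by zero. -/
noncomputable def push (p : M) (ψ : M → ℝ) (y : EuclideanSpace ℝ (Fin m)) : ℝ :=
  if y ∈ (extChartAt (𝓡 m) p).target then ψ ((extChartAt (𝓡 m) p).symm y) else 0

theorem pull_symm {p : M} (χ : EuclideanSpace ℝ (Fin m) → ℝ) {y : EuclideanSpace ℝ (Fin m)}
    (hy : y ∈ (extChartAt (𝓡 m) p).target) : pull m p χ ((extChartAt (𝓡 m) p).symm y) = χ y := by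
  rw [pull, if_pos ((extChartAt (𝓡 m) p).map_target hy), (extChartAt (𝓡 m) p).right_inv hy]

theorem push_of_mem {p : M} (ψ : M → ℝ) {y : EuclideanSpace ℝ (Fin m)}
    (hy : y ∈ (extChartAt (𝓡 m) p).target) : push m p ψ y = ψ ((extChartAt (𝓡 m) p).symm y) :=
  if_pos hy

theorem tsupport_pull_subset {p : M} {χ : EuclideanSpace ℝ (Fin m) → ℝ}
    (hc : HasCompactSupport χ) (hs : tsupport χ ⊆ (extChartAt (𝓡 m) p).target) :
    IsCompact ((extChartAt (𝓡 m) p).symm '' tsupport χ) ∧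
      tsupport (pull m p χ) ⊆ (extChartAt (𝓡 m) p).symm '' tsupport χ := by
  have hK : IsCompact ((extChartAt (𝓡 m) p).symm '' tsupport χ) :=
    hc.isCompact.image_of_continuousOn ((continuousOn_extChartAt_symm p).mono hs)
  refine ⟨hK, closure_minimal ?_ hK.isClosed⟩
  intro x hx
  rw [Function.mem_support, pull] at hx
  split_ifs at hx with h
  · exact ⟨_, subset_tsupport _ hx, (extChartAt (𝓡 m) p).left_inv h⟩
  · exact absurd rfl hx

theorem hasCompactSupport_pull {p : M} {χ : EuclideanSpace ℝ (Fin m) → ℝ}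
    (hc : HasCompactSupport χ) (hs : tsupport χ ⊆ (extChartAt (𝓡 m) p).target) :
    HasCompactSupport (pull m p χ) :=
  (tsupport_pull_subset hc hs).1.of_isClosed_subset (isClosed_tsupport _) (tsupport_pull_subset hc hs).2

theorem tsupport_pull_subset_source {p : M} {χ : EuclideanSpace ℝ (Fin m) → ℝ}
    (hc : HasCompactSupport χ) (hs : tsupport χ ⊆ (extChartAt (𝓡 m) p).target) :
    tsupport (pull m p χ) ⊆ (extChartAt (𝓡 m) p).source := by
  refine (tsupport_pull_subset hc hs).2.trans ?_
  rintro _ ⟨y, hy, rfl⟩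
  exact (extChartAt (𝓡 m) p).map_target (hs hy)

theorem contMDiff_pull {p : M} {n : WithTop ℕ∞} (hn : n ≤ ∞) {χ : EuclideanSpace ℝ (Fin m) → ℝ}
    (hχ : ContDiff ℝ n χ)
    (hc : HasCompactSupport χ) (hs : tsupport χ ⊆ (extChartAt (𝓡 m) p).target) :
    ContMDiff (𝓡 m) 𝓘(ℝ, ℝ) n (pull m p χ) := by
  intro x
  by_cases hx : x ∈ (extChartAt (𝓡 m) p).source
  · have h1 : ContMDiffAt (𝓡 m) 𝓘(ℝ, ℝ) n (χ ∘ extChartAt (𝓡 m) p) x :=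
      (hχ.contMDiff.contMDiffAt).comp x ((contMDiffAt_extChartAt' (by simpa using hx)).of_le hn)
    refine h1.congr_of_eventuallyEq ?_
    filter_upwards [(isOpen_extChartAt_source p).mem_nhds hx] with z hz
    exact if_pos hz
  · have : pull m p χ =ᶠ[𝓝 x] fun _ => 0 := by
      have hx' : x ∉ tsupport (pull m p χ) := fun h => hx (tsupport_pull_subset_source hc hs h)
      filter_upwards [(isClosed_tsupport (pull m p χ)).isOpen_compl.mem_nhds hx'] with y hy
      exact image_eq_zero_of_notMem_tsupport hy
    exact contMDiffAt_const.congr_of_eventuallyEq this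

theorem tsupport_push_subset {p : M} {ψ : M → ℝ}
    (hc : HasCompactSupport ψ) (hs : tsupport ψ ⊆ (extChartAt (𝓡 m) p).source) :
    IsCompact (extChartAt (𝓡 m) p '' tsupport ψ) ∧
      tsupport (push m p ψ) ⊆ extChartAt (𝓡 m) p '' tsupport ψ := by
  have hK : IsCompact (extChartAt (𝓡 m) p '' tsupport ψ) :=
    hc.isCompact.image_of_continuousOn ((continuousOn_extChartAt p).mono hs)
  refine ⟨hK, closure_minimal ?_ hK.isClosed⟩
  intro x hx
  rw [Function.mem_support, push] at hx
  split_ifs at hx with h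
  · exact ⟨_, subset_tsupport _ hx, (extChartAt (𝓡 m) p).right_inv h⟩
  · exact absurd rfl hx

theorem hasCompactSupport_push {p : M} {ψ : M → ℝ}
    (hc : HasCompactSupport ψ) (hs : tsupport ψ ⊆ (extChartAt (𝓡 m) p).source) :
    HasCompactSupport (push m p ψ) :=
  (tsupport_push_subset hc hs).1.of_isClosed_subset (isClosed_tsupport _) (tsupport_push_subset hc hs).2

theorem tsupport_push_subset_target {p : M} {ψ : M → ℝ}
    (hc : HasCompactSupport ψ) (hs : tsupport ψ ⊆ (extChartAt (𝓡 m) p).source) :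
    tsupport (push m p ψ) ⊆ (extChartAt (𝓡 m) p).target := by
  refine (tsupport_push_subset hc hs).2.trans ?_
  rintro _ ⟨y, hy, rfl⟩
  exact (extChartAt (𝓡 m) p).map_source (hs hy)

theorem contDiff_push {p : M} {n : WithTop ℕ∞} (hn : n ≤ ∞) {ψ : M → ℝ}
    (hψ : ContMDiff (𝓡 m) 𝓘(ℝ, ℝ) n ψ)
    (hc : HasCompactSupport ψ) (hs : tsupport ψ ⊆ (extChartAt (𝓡 m) p).source) :
    ContDiff ℝ n (push m p ψ) := by
  rw [contDiff_iff_contDiffAt]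
  intro y
  by_cases hy : y ∈ (extChartAt (𝓡 m) p).target
  · have h1 := (contDiffOn_comp_extChartAt_symm (p := p) hn hψ.contMDiffOn).contDiffAt
      ((isOpen_extChartAt_target p).mem_nhds hy)
    refine h1.congr_of_eventuallyEq ?_
    filter_upwards [(isOpen_extChartAt_target p).mem_nhds hy] with z hz
    exact if_pos hz
  · have : push m p ψ =ᶠ[𝓝 y] fun _ => 0 := by
      have hy' : y ∉ tsupport (push m p ψ) := fun h => hy (tsupport_push_subset_target hc hs h)
      filter_upwards [(isClosed_tsupport (push m p ψ)).isOpen_compl.mem_nhds hy'] with y hy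
      exact image_eq_zero_of_notMem_tsupport hy
    exact contDiffAt_const.congr_of_eventuallyEq this

theorem pd_push {p : M} (ψ : M → ℝ) {y : EuclideanSpace ℝ (Fin m)}
    (hy : y ∈ (extChartAt (𝓡 m) p).target) (i : Fin m) :
    pd i (push m p ψ) y = pd i (ψ ∘ (extChartAt (𝓡 m) p).symm) y := by
  rw [pd, pd]
  congr 1
  apply Filter.EventuallyEq.fderiv_eq
  filter_upwards [(isOpen_extChartAt_target p).mem_nhds hy] with z hz
  exact if_pos hz

end ChartTransfer

/-! ### Green's formula in a chart -/

section ChartIntegrationByParts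
set_option linter.unusedSectionVars false
open scoped Topology

variable {m : ℕ} {M : Type*} [MetricSpace M] [ChartedSpace (EuclideanSpace ℝ (Fin m)) M]
  [IsManifold (𝓡 m) ∞ M] [RiemannianBundle (fun x : M => TangentSpace (𝓡 m) x)]

theorem grad_eq_zero_of_notMem_tsupport {ψ : M → ℝ} {x : M} (hx : x ∉ tsupport ψ) :
    (grad ψ x : TangentSpace (𝓡 m) x) = 0 := by
  refine ext_inner_right ℝ fun v => ?_
  have h : ψ =ᶠ[𝓝 x] fun _ => 0 := by
    filter_upwards [(isClosed_tsupport ψ).isOpen_compl.mem_nhds hx] with y hy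
    exact image_eq_zero_of_notMem_tsupport hy
  rw [inner_grad, h.mfderiv_eq, mfderiv_const, inner_zero_left]
  rfl

variable [IsContMDiffRiemannianBundle (𝓡 m) ∞ (EuclideanSpace ℝ (Fin m))
      (fun x : M => TangentSpace (𝓡 m) x)]

theorem continuousOn_gram_inv (p : M) (i j : Fin m) :
    ContinuousOn (fun y => (gram m p y)⁻¹ i j) (extChartAt (𝓡 m) p).target := by
  have h1 := (contDiffOn_coef (m := m) (f := fun _ : M => (0:ℝ)) contMDiff_const p i j).continuousOn
  have h2 := (contDiffOn_dens (m := m) (f := fun _ : M => (0:ℝ)) contMDiff_const p).continuousOn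
  refine (h1.div h2 fun y hy => (dens_pos _ hy).ne').congr fun y hy => ?_
  simp only [Pi.div_apply, coef]
  rw [mul_div_cancel_left₀ _ (dens_pos _ hy).ne']

theorem continuous_inner_grad {u w : M → ℝ} (hu : ContMDiff (𝓡 m) 𝓘(ℝ, ℝ) 1 u)
    (hw : ContMDiff (𝓡 m) 𝓘(ℝ, ℝ) 1 w) :
    Continuous fun x => inner ℝ (grad u x : TangentSpace (𝓡 m) x) (grad w x) := by
  rw [continuous_iff_continuousAt]
  intro p
  have hpd : ∀ {v : M → ℝ} (_ : ContMDiff (𝓡 m) 𝓘(ℝ, ℝ) 1 v) (i : Fin m),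
      ContinuousOn (pd i (v ∘ (extChartAt (𝓡 m) p).symm)) (extChartAt (𝓡 m) p).target := by
    intro v hv i
    exact (ContDiffOn.pd (k := 0) (n := 1) (contDiffOn_comp_extChartAt_symm (by exact_mod_cast le_top) hv.contMDiffOn)
      (isOpen_extChartAt_target p) i (by simp)).continuousOn
  have h : ContinuousOn (fun y => ∑ i, (∑ j, (gram m p y)⁻¹ i j * pd j (u ∘ (extChartAt (𝓡 m) p).symm) y) *
        pd i (w ∘ (extChartAt (𝓡 m) p).symm) y) (extChartAt (𝓡 m) p).target :=
    continuousOn_finsetSum _ fun i _ => (continuousOn_finsetSum _ fun j _ =>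
      (continuousOn_gram_inv p i j).mul (hpd hu j)).mul (hpd hw i)
  have h' := h.comp (continuousOn_extChartAt p) (fun x hx => (extChartAt (𝓡 m) p).map_source hx)
  refine (h'.continuousAt ((isOpen_extChartAt_source p).mem_nhds (mem_extChartAt_source p))).congr ?_
  filter_upwards [(isOpen_extChartAt_source p).mem_nhds (mem_extChartAt_source (I := 𝓡 m) p)] with x hx
  have := inner_grad_grad ((extChartAt (𝓡 m) p).map_source hx) (hu.mdifferentiable (by norm_num) _)
    (hw.mdifferentiable (by norm_num) _)
  rw [(extChartAt (𝓡 m) p).left_inv hx] at this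
  rw [this]
  rfl

/-- The components `e^{-f} √(det g) (∇u)ⁱ` of the weighted gradient are of class `C¹`. -/
theorem contDiffOn_flux {f u : M → ℝ} (hf : ContMDiff (𝓡 m) 𝓘(ℝ, ℝ) ∞ f)
    (hu : ContMDiff (𝓡 m) 𝓘(ℝ, ℝ) 2 u) (p : M) (i : Fin m) :
    ContDiffOn ℝ 1 (fun z => ∑ j, coef f p i j z * pd j (u ∘ (extChartAt (𝓡 m) p).symm) z)
      (extChartAt (𝓡 m) p).target := by
  refine ContDiffOn.sum fun j _ => ContDiffOn.mul ?_ ?_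
  · exact (contDiffOn_coef hf p i j).of_le (by exact_mod_cast le_top)
  · exact ContDiffOn.pd (k := 1) (n := 2) (contDiffOn_comp_extChartAt_symm (by exact_mod_cast le_top) hu.contMDiffOn)
      (isOpen_extChartAt_target p) j (by norm_num)

theorem continuousOn_chartLap {f u : M → ℝ} (hf : ContMDiff (𝓡 m) 𝓘(ℝ, ℝ) ∞ f)
    (hu : ContMDiff (𝓡 m) 𝓘(ℝ, ℝ) 2 u) (p : M) :
    ContinuousOn (fun x => chartLap f p (u ∘ (extChartAt (𝓡 m) p).symm) (extChartAt (𝓡 m) p x))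
      (extChartAt (𝓡 m) p).source := by
  have h : ContinuousOn (chartLap f p (u ∘ (extChartAt (𝓡 m) p).symm)) (extChartAt (𝓡 m) p).target := by
    refine ((contDiffOn_dens hf p).continuousOn.inv₀ fun y hy => (dens_pos f hy).ne').mul ?_
    exact continuousOn_finsetSum _ fun i _ => (ContDiffOn.pd (k := 0) (n := 1) (contDiffOn_flux hf hu p i)
      (isOpen_extChartAt_target p) i (by simp)).continuousOn
  exact h.comp (continuousOn_extChartAt p) (fun x hx => (extChartAt (𝓡 m) p).map_source hx)

variable [MeasurableSpace M] [BorelSpace M]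

/-- Green's formula for a test function supported in a chart domain. -/
theorem integral_mul_chartLap {f u ψ : M → ℝ} (hf : ContMDiff (𝓡 m) 𝓘(ℝ, ℝ) ∞ f)
    (hu : ContMDiff (𝓡 m) 𝓘(ℝ, ℝ) 2 u) (hψ : ContMDiff (𝓡 m) 𝓘(ℝ, ℝ) 1 ψ) (p : M)
    (hc : HasCompactSupport ψ) (hs : tsupport ψ ⊆ (extChartAt (𝓡 m) p).source) :
    ∫ x, ψ x * chartLap f p (u ∘ (extChartAt (𝓡 m) p).symm) (extChartAt (𝓡 m) p x)
        ∂(weightedVolume m f) =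
      -∫ x, inner ℝ (grad u x : TangentSpace (𝓡 m) x) (grad ψ x) ∂(weightedVolume m f) := by
  have hO := isOpen_extChartAt_source (I := 𝓡 m) p
  have hT := isOpen_extChartAt_target (I := 𝓡 m) p
  have hu1 : ContMDiff (𝓡 m) 𝓘(ℝ, ℝ) 1 u := hu.of_le (by norm_num)
  set F : Fin m → EuclideanSpace ℝ (Fin m) → ℝ := fun i z =>
    ∑ j, coef f p i j z * pd j (u ∘ (extChartAt (𝓡 m) p).symm) z with hFdef
  have hF : ∀ i, ContDiffOn ℝ 1 (F i) (extChartAt (𝓡 m) p).target := fun i => contDiffOn_flux hf hu p i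
  have hpψ := contDiff_push (p := p) (n := 1) (by exact_mod_cast le_top) hψ hc hs
  have hpc := hasCompactSupport_push hc hs
  have hps := tsupport_push_subset_target hc hs
  have hset1 : ∫ y in (extChartAt (𝓡 m) p).target, ∑ i, push m p ψ y * pd i (F i) y =
      ∫ y, ∑ i, push m p ψ y * pd i (F i) y := by
    refine setIntegral_eq_integral_of_forall_compl_eq_zero fun y hy => ?_
    exact Finset.sum_eq_zero fun i _ => by rw [push, if_neg hy, zero_mul]
  have hset2 : ∫ y in (extChartAt (𝓡 m) p).target, ∑ i, pd i (push m p ψ) y * F i y =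
      ∫ y, ∑ i, pd i (push m p ψ) y * F i y := by
    refine setIntegral_eq_integral_of_forall_compl_eq_zero fun y hy => ?_
    refine Finset.sum_eq_zero fun i _ => ?_
    rw [image_eq_zero_of_notMem_tsupport (fun h => hy (hps (tsupport_pd_subset i _ h))), zero_mul]
  have e1 : ∫ x, ψ x * chartLap f p (u ∘ (extChartAt (𝓡 m) p).symm) (extChartAt (𝓡 m) p x)
        ∂(weightedVolume m f) = ∫ y, ∑ i, push m p ψ y * pd i (F i) y := by
    rw [← setIntegral_eq_integral_of_forall_compl_eq_zero (s := (extChartAt (𝓡 m) p).source),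
      setIntegral_source hf p, ← hset1]
    · refine setIntegral_congr_fun hT.measurableSet fun y hy => ?_
      simp only [push_of_mem ψ hy, (extChartAt (𝓡 m) p).right_inv hy, chartLap]
      rw [← Finset.mul_sum]
      have := (dens_pos f hy).ne'
      field_simp
      rfl
    · exact (hψ.continuous.continuousOn.mul (continuousOn_chartLap hf hu p)).aestronglyMeasurable hO.measurableSet
    · intro x hx
      rw [image_eq_zero_of_notMem_tsupport (fun h => hx (hs h)), zero_mul]
  have e2 : ∫ x, inner ℝ (grad u x : TangentSpace (𝓡 m) x) (grad ψ x) ∂(weightedVolume m f) =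
      ∫ y, ∑ i, pd i (push m p ψ) y * F i y := by
    rw [← setIntegral_eq_integral_of_forall_compl_eq_zero (s := (extChartAt (𝓡 m) p).source),
      setIntegral_source hf p, ← hset2]
    · refine setIntegral_congr_fun hT.measurableSet fun y hy => ?_
      simp only [pd_push ψ hy]
      rw [inner_grad_grad hy (hu1.mdifferentiable (by norm_num) _)
        (hψ.mdifferentiable (by norm_num) _), Finset.mul_sum]
      refine Finset.sum_congr rfl fun i _ => ?_
      rw [mul_comm (pd i _ y), ← mul_assoc, Finset.mul_sum]
      simp only [hFdef, coef, mul_assoc]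
    · exact (continuous_inner_grad hu1 hψ).aestronglyMeasurable
    · intro x hx
      rw [grad_eq_zero_of_notMem_tsupport (fun h => hx (hs h)), inner_zero_right]
  rw [e1, e2, integral_finsetSum, integral_finsetSum, ← Finset.sum_neg_distrib]
  · exact Finset.sum_congr rfl fun i _ => integral_mul_pd_eq_neg hT hpψ hpc hps (hF i) i
  · intro i _
    exact integrable_mul_of_tsupport_subset hT (ContDiff.pd (k := 0) (n := 1) hpψ i (by simp)).continuous
      (hpc.pd i) ((tsupport_pd_subset i _).trans hps) (hF i).continuousOn
  · intro i _
    exact integrable_mul_of_tsupport_subset hT hpψ.continuous hpc hps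
      (ContDiffOn.pd (k := 0) (n := 1) (hF i) hT i (by simp)).continuousOn

end ChartIntegrationByParts
end WeightedManifold

/-! ### Calculus of the gradient -/

namespace WeightedManifold
section GradientCalculus
set_option linter.unusedSectionVars false
open scoped Topology

variable {m : ℕ} {M : Type*} [MetricSpace M] [ChartedSpace (EuclideanSpace ℝ (Fin m)) M]
  [IsManifold (𝓡 m) ∞ M] [RiemannianBundle (fun x : M => TangentSpace (𝓡 m) x)]

theorem grad_eq_of_hasMFDerivAt {u : M → ℝ} {x : M} {u' : TangentSpace (𝓡 m) x →L[ℝ] ℝ}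
    (h : HasMFDerivAt (𝓡 m) 𝓘(ℝ, ℝ) u x u') {g : TangentSpace (𝓡 m) x}
    (hg : ∀ v, inner ℝ g v = u' v) : grad u x = g := by
  refine ext_inner_right ℝ fun v => ?_
  rw [inner_grad, h.mfderiv, hg]
  rfl

theorem grad_congr {u w : M → ℝ} {x : M} (h : u =ᶠ[𝓝 x] w) :
    (grad u x : TangentSpace (𝓡 m) x) = grad w x := by
  refine ext_inner_right ℝ fun v => ?_
  rw [inner_grad, inner_grad, h.mfderiv_eq]
  rfl

theorem grad_const (c : ℝ) (x : M) : (grad (fun _ : M => c) x : TangentSpace (𝓡 m) x) = 0 := by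
  refine ext_inner_right ℝ fun v => ?_
  rw [inner_grad, mfderiv_const, inner_zero_left]
  rfl

theorem grad_add {u w : M → ℝ} {x : M} (hu : MDifferentiableAt (𝓡 m) 𝓘(ℝ, ℝ) u x)
    (hw : MDifferentiableAt (𝓡 m) 𝓘(ℝ, ℝ) w x) :
    (grad (fun y => u y + w y) x : TangentSpace (𝓡 m) x) = grad u x + grad w x := by
  refine grad_eq_of_hasMFDerivAt (hu.hasMFDerivAt.add hw.hasMFDerivAt) fun v => ?_
  rw [inner_add_left, inner_grad, inner_grad]
  rfl

theorem grad_const_mul {u : M → ℝ} {x : M} (c : ℝ) (hu : MDifferentiableAt (𝓡 m) 𝓘(ℝ, ℝ) u x) :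
    (grad (fun y => c * u y) x : TangentSpace (𝓡 m) x) = c • grad u x := by
  refine grad_eq_of_hasMFDerivAt (hu.hasMFDerivAt.const_smul c) fun v => ?_
  rw [real_inner_smul_left, inner_grad]
  rfl

theorem grad_mul {u w : M → ℝ} {x : M} (hu : MDifferentiableAt (𝓡 m) 𝓘(ℝ, ℝ) u x)
    (hw : MDifferentiableAt (𝓡 m) 𝓘(ℝ, ℝ) w x) :
    (grad (fun y => u y * w y) x : TangentSpace (𝓡 m) x) = u x • grad w x + w x • grad u x := by
  refine grad_eq_of_hasMFDerivAt (hu.hasMFDerivAt.mul hw.hasMFDerivAt) fun v => ?_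
  rw [inner_add_left, real_inner_smul_left, real_inner_smul_left, inner_grad, inner_grad]
  rfl

theorem grad_comp {u : M → ℝ} {x : M} {h : ℝ → ℝ} {c : ℝ} (hh : HasDerivAt h c (u x))
    (hu : MDifferentiableAt (𝓡 m) 𝓘(ℝ, ℝ) u x) :
    (grad (fun y => h (u y)) x : TangentSpace (𝓡 m) x) = c • grad u x := by
  refine grad_eq_of_hasMFDerivAt (hh.hasFDerivAt.hasMFDerivAt.comp x hu.hasMFDerivAt) fun v => ?_
  rw [real_inner_smul_left, inner_grad]
  exact mul_comm c _

end GradientCalculus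

/-! ### Green's formula -/

section Green
set_option linter.unusedSectionVars false
open scoped Topology

variable {m : ℕ} {M : Type*} [MetricSpace M] [SecondCountableTopology M]
  [MeasurableSpace M] [BorelSpace M]
  [ChartedSpace (EuclideanSpace ℝ (Fin m)) M]
  [IsManifold (𝓡 m) ∞ M] [RiemannianBundle (fun x : M => TangentSpace (𝓡 m) x)]
  [IsContMDiffRiemannianBundle (𝓡 m) ∞ (EuclideanSpace ℝ (Fin m))
      (fun x : M => TangentSpace (𝓡 m) x)]

/-- The expressions of the weighted Laplacian in the various charts define the same function. By
Green's formula in each chart, they have the same integrals against test functions supported in the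
overlap, so that no computation with transition maps is needed. -/
theorem chartLap_eq_fLaplacian {f u : M → ℝ} (hf : ContMDiff (𝓡 m) 𝓘(ℝ, ℝ) ∞ f)
    (hu : ContMDiff (𝓡 m) 𝓘(ℝ, ℝ) 2 u) {p x : M} (hx : x ∈ (extChartAt (𝓡 m) p).source) :
    chartLap f p (u ∘ (extChartAt (𝓡 m) p).symm) (extChartAt (𝓡 m) p x) = fLaplacian m f u x := by
  have := isLocallyFiniteMeasure_weightedVolume hf
  have := isOpenPosMeasure_weightedVolume hf
  have := ChartedSpace.locallyCompactSpace (EuclideanSpace ℝ (Fin m)) M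
  rw [fLaplacian_eq_chartLap f hu x]
  set W := (extChartAt (𝓡 m) p).source ∩ (extChartAt (𝓡 m) x).source
  have hW : IsOpen W := (isOpen_extChartAt_source p).inter (isOpen_extChartAt_source x)
  have hc1 := (continuousOn_chartLap hf hu p).mono (Set.inter_subset_left : W ⊆ _)
  have hc2 := (continuousOn_chartLap hf hu x).mono (Set.inter_subset_right : W ⊆ _)
  have hz := hW.ae_eq_zero_of_integral_contMDiff_smul_eq_zero (𝓡 m) (μ := weightedVolume m f)
    ((hc1.sub hc2).locallyIntegrableOn hW.measurableSet) (by
      intro g hg hgc hgs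
      have h1 := integral_mul_chartLap hf hu (hg.of_le (by exact_mod_cast le_top)) p hgc
        (hgs.trans Set.inter_subset_left)
      have h2 := integral_mul_chartLap hf hu (hg.of_le (by exact_mod_cast le_top)) x hgc
        (hgs.trans Set.inter_subset_right)
      have hint : ∀ {h : M → ℝ}, ContinuousOn h W →
          Integrable (fun x => g x * h x) (weightedVolume m f) := by
        intro h hh
        have hcont : Continuous fun x => g x * h x := by
          rw [continuous_iff_continuousAt]
          intro y
          by_cases hy : y ∈ tsupport g
          · exact hg.continuous.continuousAt.mul (hh.continuousAt (hW.mem_nhds (hgs hy)))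
          · have : (fun x => g x * h x) =ᶠ[𝓝 y] fun _ => 0 := by
              filter_upwards [(isClosed_tsupport g).isOpen_compl.mem_nhds hy] with z hz
              rw [image_eq_zero_of_notMem_tsupport hz, zero_mul]
            exact continuousAt_const.congr this.symm
        exact hcont.integrable_of_hasCompactSupport hgc.mul_right
      simp only [Pi.sub_apply, smul_eq_mul, mul_sub]
      rw [integral_sub (hint hc1) (hint hc2), h1, h2, sub_self])
  have heq := Measure.eqOn_open_of_ae_eq (μ := weightedVolume m f) (U := W)
    ((ae_restrict_iff' hW.measurableSet).2 (hz.mono fun y hy hyW => sub_eq_zero.1 (hy hyW))) hW hc1 hc2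
  exact heq ⟨hx, mem_extChartAt_source x⟩

theorem continuous_fLaplacian {f u : M → ℝ} (hf : ContMDiff (𝓡 m) 𝓘(ℝ, ℝ) ∞ f)
    (hu : ContMDiff (𝓡 m) 𝓘(ℝ, ℝ) 2 u) : Continuous (fLaplacian m f u) := by
  rw [continuous_iff_continuousAt]
  intro p
  have hO := (isOpen_extChartAt_source p).mem_nhds (mem_extChartAt_source (I := 𝓡 m) p)
  refine ((continuousOn_chartLap hf hu p).continuousAt hO).congr ?_
  filter_upwards [hO] with x hx
  exact chartLap_eq_fLaplacian hf hu hx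

theorem integrable_mul_fLaplacian {f u ψ : M → ℝ} (hf : ContMDiff (𝓡 m) 𝓘(ℝ, ℝ) ∞ f)
    (hu : ContMDiff (𝓡 m) 𝓘(ℝ, ℝ) 2 u) (hψ : Continuous ψ) (hc : HasCompactSupport ψ) :
    Integrable (fun x => ψ x * fLaplacian m f u x) (weightedVolume m f) := by
  have := isLocallyFiniteMeasure_weightedVolume hf
  exact (hψ.mul (continuous_fLaplacian hf hu)).integrable_of_hasCompactSupport hc.mul_right

theorem integrable_inner_grad {f u ψ : M → ℝ} (hf : ContMDiff (𝓡 m) 𝓘(ℝ, ℝ) ∞ f)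
    (hu : ContMDiff (𝓡 m) 𝓘(ℝ, ℝ) 1 u) (hψ : ContMDiff (𝓡 m) 𝓘(ℝ, ℝ) 1 ψ)
    (hc : HasCompactSupport ψ) :
    Integrable (fun x => inner ℝ (grad u x : TangentSpace (𝓡 m) x) (grad ψ x))
      (weightedVolume m f) := by
  have := isLocallyFiniteMeasure_weightedVolume hf
  refine (continuous_inner_grad hu hψ).integrable_of_hasCompactSupport ?_
  refine HasCompactSupport.intro hc fun x hx => ?_
  rw [grad_eq_zero_of_notMem_tsupport hx, inner_zero_right]

/-- Green's formula for a compactly supported test function. -/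
theorem integral_mul_fLaplacian {f u ψ : M → ℝ} (hf : ContMDiff (𝓡 m) 𝓘(ℝ, ℝ) ∞ f)
    (hu : ContMDiff (𝓡 m) 𝓘(ℝ, ℝ) 2 u) (hψ : ContMDiff (𝓡 m) 𝓘(ℝ, ℝ) 1 ψ)
    (hc : HasCompactSupport ψ) :
    ∫ x, ψ x * fLaplacian m f u x ∂(weightedVolume m f) =
      -∫ x, inner ℝ (grad u x : TangentSpace (𝓡 m) x) (grad ψ x) ∂(weightedVolume m f) := by
  have := isLocallyFiniteMeasure_weightedVolume hf
  have := ChartedSpace.locallyCompactSpace (EuclideanSpace ℝ (Fin m)) M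
  have hu1 : ContMDiff (𝓡 m) 𝓘(ℝ, ℝ) 1 u := hu.of_le (by norm_num)
  obtain ⟨η, hη⟩ := SmoothPartitionOfUnity.exists_isSubordinate_chartAt_source (I := 𝓡 m) M
  have hη1 : ∀ i, ContMDiff (𝓡 m) 𝓘(ℝ, ℝ) 1 (η i) := fun i =>
    (η i).contMDiff.of_le (by exact_mod_cast le_top)
  have hfin := η.locallyFinite.finite_nonempty_inter_compact hc.isCompact
  -- by a partition of unity, it is enough to consider functions supported in a chart domain;
  -- only finitely many members of the partition meet the support of `ψ`
  have hsum : ψ = fun x => ∑ i ∈ hfin.toFinset, η i x * ψ x := by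
    ext x
    by_cases hx : x ∈ tsupport ψ
    · rw [← Finset.sum_mul, η.sum_finsupport' x (Set.mem_univ x), one_mul]
      intro i hi
      rw [hfin.mem_toFinset]
      exact ⟨x, (η.mem_finsupport x).1 hi, hx⟩
    · simp [image_eq_zero_of_notMem_tsupport hx]
  have key : ∀ s : Finset M, ContMDiff (𝓡 m) 𝓘(ℝ, ℝ) 1 (fun x => ∑ i ∈ s, η i x * ψ x) ∧
      HasCompactSupport (fun x => ∑ i ∈ s, η i x * ψ x) ∧
      ∫ x, (∑ i ∈ s, η i x * ψ x) * fLaplacian m f u x ∂(weightedVolume m f) =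
      -∫ x, inner ℝ (grad u x : TangentSpace (𝓡 m) x) (grad (fun x => ∑ i ∈ s, η i x * ψ x) x) ∂(weightedVolume m f) := by
    intro s
    classical
    induction s using Finset.induction_on with
    | empty =>
      refine ⟨by simpa using contMDiff_const, by simpa using! (HasCompactSupport.zero : HasCompactSupport (0 : M → ℝ)), ?_⟩
      simp [grad_const]
    | insert i s his ih =>
      obtain ⟨ih1, ih2, ih3⟩ := ih
      have h1 : ContMDiff (𝓡 m) 𝓘(ℝ, ℝ) 1 (fun x => η i x * ψ x) := (hη1 i).mul hψ
      have h2 : HasCompactSupport (fun x => η i x * ψ x) := hc.mul_left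
      have hts : tsupport (fun x => η i x * ψ x) ⊆ (extChartAt (𝓡 m) i).source := by
        refine (tsupport_mul_subset_left).trans ?_
        simpa using hη i
      have h3 := integral_mul_chartLap hf hu h1 i h2 hts
      have h4 : ∫ x, η i x * ψ x * fLaplacian m f u x ∂(weightedVolume m f) =
          -∫ x, inner ℝ (grad u x : TangentSpace (𝓡 m) x) (grad (fun x => η i x * ψ x) x) ∂(weightedVolume m f) := by
        rw [← h3]
        refine integral_congr_ae (.of_forall fun x => ?_)
        by_cases hx : x ∈ tsupport (fun x => η i x * ψ x)
        · exact congrArg _ (chartLap_eq_fLaplacian hf hu (hts hx)).symm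
        · have h0 : η i x * ψ x = 0 :=
            image_eq_zero_of_notMem_tsupport (f := fun x => η i x * ψ x) hx
          simp only [h0, zero_mul]
      simp only [Finset.sum_insert his]
      refine ⟨h1.add ih1, h2.add ih2, ?_⟩
      have h5 : ∀ x, (grad (fun x => η i x * ψ x + ∑ i ∈ s, η i x * ψ x) x : TangentSpace (𝓡 m) x) =
          grad (fun x => η i x * ψ x) x + grad (fun x => ∑ i ∈ s, η i x * ψ x) x := fun x =>
        grad_add (h1.mdifferentiable (by norm_num) x) (ih1.mdifferentiable (by norm_num) x)
      simp only [h5, inner_add_right, add_mul]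
      rw [integral_add (integrable_mul_fLaplacian hf hu h1.continuous h2)
        (integrable_mul_fLaplacian hf hu ih1.continuous ih2),
        integral_add (integrable_inner_grad hf hu1 h1 h2) (integrable_inner_grad hf hu1 ih1 ih2),
        ih3, h4, neg_add]
  have := (key hfin.toFinset).2.2
  rw [← hsum] at this
  simp only [← congrFun hsum] at this
  exact this

theorem fLaplacian_eq_zero_of_notMem_tsupport {f u : M → ℝ}
    (hu : ContMDiff (𝓡 m) 𝓘(ℝ, ℝ) 2 u) {x : M} (hx : x ∉ tsupport u) :
    fLaplacian m f u x = 0 := by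
  rw [fLaplacian_eq_chartLap f hu, chartLap]
  set O := (extChartAt (𝓡 m) x).target ∩ (extChartAt (𝓡 m) x).symm ⁻¹' (tsupport u)ᶜ
  have hO : IsOpen O := (continuousOn_extChartAt_symm x).isOpen_inter_preimage
    (isOpen_extChartAt_target x) (isClosed_tsupport u).isOpen_compl
  have hxO : extChartAt (𝓡 m) x x ∈ O := by
    refine ⟨mem_extChartAt_target x, ?_⟩
    rw [Set.mem_preimage, extChartAt_to_inv]
    exact hx
  have h1 : ∀ y ∈ O, ∀ j, pd j (u ∘ (extChartAt (𝓡 m) x).symm) y = 0 := by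
    intro y hy j
    have : (u ∘ (extChartAt (𝓡 m) x).symm) =ᶠ[𝓝 y] fun _ => (0:ℝ) := by
      filter_upwards [hO.mem_nhds hy] with z hz
      exact image_eq_zero_of_notMem_tsupport (f := u) hz.2
    rw [pd, this.fderiv_eq]
    simp
  have h2 : ∀ i, pd i (fun z => ∑ j, coef f x i j z * pd j (u ∘ (extChartAt (𝓡 m) x).symm) z)
      (extChartAt (𝓡 m) x x) = 0 := by
    intro i
    have : (fun z => ∑ j, coef f x i j z * pd j (u ∘ (extChartAt (𝓡 m) x).symm) z)
        =ᶠ[𝓝 (extChartAt (𝓡 m) x x)] fun _ => (0:ℝ) := by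
      filter_upwards [hO.mem_nhds hxO] with z hz
      exact Finset.sum_eq_zero fun j _ => by rw [h1 z hz j, mul_zero]
    rw [pd, this.fderiv_eq]
    simp
  rw [Finset.sum_eq_zero fun i _ => h2 i, mul_zero]

/-- A compact set is contained in the interior of the set where a suitable cutoff function is `1`. -/
theorem exists_cutoff {K : Set M} (hK : IsCompact K) : ∃ χ : M → ℝ,
    ContMDiff (𝓡 m) 𝓘(ℝ, ℝ) ∞ χ ∧ HasCompactSupport χ ∧ ∀ᶠ x in 𝓝ˢ K, χ x = 1 := by
  have := ChartedSpace.locallyCompactSpace (EuclideanSpace ℝ (Fin m)) M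
  obtain ⟨K', hK', hsub⟩ := exists_compact_superset hK
  obtain ⟨χ, h1, h2, -⟩ := exists_contMDiffMap_one_nhds_of_subset_interior (𝓡 m) (n := ⊤)
    hK.isClosed hsub
  exact ⟨χ, χ.contMDiff, HasCompactSupport.intro hK' h2, h1⟩

/-- Green's formula for a compactly supported `u` and a test function of arbitrary support. -/
theorem integral_mul_fLaplacian_of_hasCompactSupport {f u ψ : M → ℝ}
    (hf : ContMDiff (𝓡 m) 𝓘(ℝ, ℝ) ∞ f)
    (hu : ContMDiff (𝓡 m) 𝓘(ℝ, ℝ) 2 u) (hψ : ContMDiff (𝓡 m) 𝓘(ℝ, ℝ) 1 ψ)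
    (hc : HasCompactSupport u) :
    ∫ x, ψ x * fLaplacian m f u x ∂(weightedVolume m f) =
      -∫ x, inner ℝ (grad u x : TangentSpace (𝓡 m) x) (grad ψ x) ∂(weightedVolume m f) := by
  -- replacing `ψ` by `χ ψ` changes neither side when `χ = 1` near the support of `u`
  obtain ⟨χ, h1, h2, h3⟩ := exists_cutoff (m := m) hc.isCompact
  have h1' : ContMDiff (𝓡 m) 𝓘(ℝ, ℝ) 1 χ := h1.of_le (by exact_mod_cast le_top)
  have h4 := integral_mul_fLaplacian hf hu (h1'.mul hψ) (h2.mul_right (f' := ψ))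
  have e1 : ∀ x, χ x * ψ x * fLaplacian m f u x = ψ x * fLaplacian m f u x := by
    intro x
    by_cases hx : x ∈ tsupport u
    · rw [h3.self_of_nhdsSet x hx, one_mul]
    · rw [fLaplacian_eq_zero_of_notMem_tsupport hu hx, mul_zero, mul_zero]
  have e2 : ∀ x, inner ℝ (grad u x : TangentSpace (𝓡 m) x) (grad (χ * ψ) x) =
      inner ℝ (grad u x : TangentSpace (𝓡 m) x) (grad ψ x) := by
    intro x
    by_cases hx : x ∈ tsupport u
    · congr 1
      refine grad_congr ?_
      filter_upwards [Filter.Eventually.filter_mono (nhds_le_nhdsSet hx) h3] with y hy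
      rw [Pi.mul_apply, hy, one_mul]
    · rw [grad_eq_zero_of_notMem_tsupport hx, inner_zero_left, inner_zero_left]
  simp only [Pi.mul_apply, e1, e2] at h4
  exact h4

/-- `Δ_f (u²) = 2 u Δ_f u + 2 |∇u|²`. -/
theorem fLaplacian_sq {f u : M → ℝ} (hf : ContMDiff (𝓡 m) 𝓘(ℝ, ℝ) ∞ f)
    (hu : ContMDiff (𝓡 m) 𝓘(ℝ, ℝ) 2 u) (x : M) :
    fLaplacian m f (fun y => u y * u y) x = 2 * u x * fLaplacian m f u x +
      2 * inner ℝ (grad u x : TangentSpace (𝓡 m) x) (grad u x) := by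
  have hx : extChartAt (𝓡 m) x x ∈ (extChartAt (𝓡 m) x).target := mem_extChartAt_target x
  have hT := isOpen_extChartAt_target (I := 𝓡 m) x
  have hxx : (extChartAt (𝓡 m) x).symm (extChartAt (𝓡 m) x x) = x := extChartAt_to_inv x
  have hu1 := hu.mdifferentiable (by norm_num)
  rw [fLaplacian_eq_chartLap f (u := fun y => u y * u y) (hu.mul hu), fLaplacian_eq_chartLap f hu]
  set y₀ := extChartAt (𝓡 m) x x with hy₀
  set U := u ∘ (extChartAt (𝓡 m) x).symm with hU
  have hUd : ∀ y ∈ (extChartAt (𝓡 m) x).target, DifferentiableAt ℝ U y := fun y hy =>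
    ((contDiffOn_comp_extChartAt_symm (n := 2) (show ((2 : ℕ∞) : WithTop ℕ∞) ≤ ∞ by exact_mod_cast le_top)
      hu.contMDiffOn).differentiableOn (by norm_num)).differentiableAt (hT.mem_nhds hy)
  have h2 : ∀ i, pd i (fun z => ∑ j, coef f x i j z * pd j ((fun y => u y * u y) ∘ (extChartAt (𝓡 m) x).symm) z) y₀ =
      2 * (U y₀ * pd i (fun z => ∑ j, coef f x i j z * pd j U z) y₀ +
        pd i U y₀ * ∑ j, coef f x i j y₀ * pd j U y₀) := by
    intro i
    have hF : DifferentiableAt ℝ (fun z => ∑ j, coef f x i j z * pd j U z) y₀ :=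
      ((contDiffOn_flux hf hu x i).differentiableOn (by norm_num)).differentiableAt (hT.mem_nhds hx)
    have : (fun z => ∑ j, coef f x i j z * pd j ((fun y => u y * u y) ∘ (extChartAt (𝓡 m) x).symm) z)
        =ᶠ[𝓝 y₀] fun z => 2 * (U z * ∑ j, coef f x i j z * pd j U z) := by
      filter_upwards [hT.mem_nhds hx] with z hz
      rw [Finset.mul_sum, Finset.mul_sum]
      refine Finset.sum_congr rfl fun j _ => ?_
      have : pd j ((fun y => u y * u y) ∘ (extChartAt (𝓡 m) x).symm) z = U z * pd j U z + pd j U z * U z :=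
        pd_mul (hUd z hz) (hUd z hz)
      rw [this]
      ring
    rw [← pd_mul (hUd y₀ hx) hF, pd, this.fderiv_eq,
      fderiv_const_mul (a := fun z => U z * ∑ j, coef f x i j z * pd j U z) ((hUd y₀ hx).mul hF)]
    rfl
  have h3 : inner ℝ (grad u x : TangentSpace (𝓡 m) x) (grad u x) =
      (dens f x y₀)⁻¹ * ∑ i, pd i U y₀ * ∑ j, coef f x i j y₀ * pd j U y₀ := by
    have h := inner_grad_grad (p := x) (y := y₀) (u := u) (φ := u) hx (hu1 _) (hu1 _)
    rw [hxx] at h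
    rw [h, Finset.mul_sum]
    refine Finset.sum_congr rfl fun i _ => ?_
    rw [mul_left_comm, mul_comm]
    congr 1
    rw [Finset.mul_sum]
    refine Finset.sum_congr rfl fun j _ => ?_
    rw [coef, mul_assoc, inv_mul_cancel_left₀ (dens_pos f hx).ne']
  have hUx : u x = U y₀ := by rw [hU, Function.comp_apply, hxx]
  rw [h3, chartLap, chartLap, hUx]
  simp only [h2, ← Finset.mul_sum, Finset.sum_add_distrib]
  ring

theorem fLaplacian_const (f : M → ℝ) (c : ℝ) (x : M) : fLaplacian m f (fun _ => c) x = 0 := by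
  rw [fLaplacian_eq_chartLap f contMDiff_const, chartLap]
  have h1 : ∀ j, pd j ((fun _ => c) ∘ (extChartAt (𝓡 m) x).symm) = fun _ => 0 := fun j => by
    funext y
    change fderiv ℝ (fun _ => c) y _ = 0
    simp
  simp only [h1, mul_zero, Finset.sum_const_zero]
  rw [Finset.sum_eq_zero fun i _ => by simp [pd], mul_zero]

end Green
end WeightedManifold

/-! ### A smooth truncation -/

namespace WeightedManifold
section Truncation
open scoped Topology

/-- A smooth bounded truncation that does not increase distances, fixes `0` and does not increase
the distance to `1`. It is the primitive of a bump function that is `1` on `[-1, 1]` and supported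
in `[-2, 2]`. -/
theorem exists_truncation : ∃ T b : ℝ → ℝ, ContDiff ℝ ∞ T ∧ (∀ t, HasDerivAt T (b t) t) ∧
    (∀ t, |b t| ≤ 1) ∧ T 0 = 0 ∧ (∀ t, |1 - T t| ≤ |1 - t|) ∧ ∀ t, |T t| ≤ 4 := by
  let b : ContDiffBump (0 : ℝ) := ⟨1, 2, one_pos, by norm_num⟩
  have hbc : Continuous b := b.continuous
  have hb0 : ∀ t, 0 ≤ b t := fun t => b.nonneg
  have hb1 : ∀ t, |b t| ≤ 1 := fun t => by rw [abs_of_nonneg (hb0 t)]; exact b.le_one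
  have hd : ∀ t, HasDerivAt (fun t => ∫ s in (0:ℝ)..t, b s) (b t) t := fun t =>
    hbc.integral_hasStrictDerivAt 0 t |>.hasDerivAt
  have h1 : (∫ s in (0:ℝ)..1, b s) = 1 := by
    have : (∫ s in (0:ℝ)..1, b s) = ∫ s in (0:ℝ)..1, (1:ℝ) := by
      refine intervalIntegral.integral_congr fun s hs => ?_
      rw [Set.uIcc_of_le zero_le_one] at hs
      refine b.one_of_mem_closedBall ?_
      rw [mem_closedBall_zero_iff, Real.norm_eq_abs, abs_of_nonneg hs.1]
      exact hs.2
    rw [this]; simp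
  refine ⟨fun t => ∫ s in (0:ℝ)..t, b s, b, ?_, hd, hb1, by simp, fun t => ?_, fun t => ?_⟩
  · rw [contDiff_infty_iff_deriv]
    refine ⟨fun t => (hd t).differentiableAt, ?_⟩
    have : deriv (fun t => ∫ s in (0:ℝ)..t, b s) = b := funext fun t => (hd t).deriv
    rw [this]
    exact b.contDiff
  · have h2 : 1 - (∫ s in (0:ℝ)..t, b s) = ∫ s in t..1, b s := by
      have h3 := intervalIntegral.integral_interval_sub_left (hbc.intervalIntegrable 0 1)
        (hbc.intervalIntegrable 0 t) (μ := volume)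
      rwa [h1] at h3
    dsimp only
    rw [h2]
    have := intervalIntegral.norm_integral_le_of_norm_le_const (a := t) (b := 1) (f := b) (C := 1) fun x _ => hb1 x
    simpa using this
  · have hint : Integrable b := b.integrable
    have h2 := intervalIntegral.norm_integral_le_integral_norm_uIoc (f := b) (a := 0) (b := t) (μ := volume)
    have h3 : ∫ s in Set.uIoc 0 t, ‖b s‖ ≤ ∫ s, ‖b s‖ :=
      setIntegral_le_integral hint.norm (.of_forall fun _ => norm_nonneg _)
    have h4 : ∫ s, ‖b s‖ = ∫ s, b s := integral_congr_ae (.of_forall fun s => by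
      simp only [Real.norm_eq_abs, abs_of_nonneg (hb0 s)])
    have h5 := b.integral_le_measure_closedBall volume
    have h6 : volume.real (Metric.closedBall (0:ℝ) b.rOut) = 4 := by
      rw [measureReal_def, Real.volume_closedBall]
      norm_num [b]
    rw [← Real.norm_eq_abs]
    linarith

end Truncation

/-! ### A positive smooth integrable function -/

section Density
open scoped Topology

/-- A `σ`-compact manifold with a locally finite measure carries a positive smooth integrable
function. -/
theorem exists_contMDiff_pos_integrable {m : ℕ} {M : Type*} [MetricSpace M]
    [SecondCountableTopology M] [MeasurableSpace M] [BorelSpace M]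
    [ChartedSpace (EuclideanSpace ℝ (Fin m)) M] [IsManifold (𝓡 m) ∞ M] (μ : Measure M)
    [IsLocallyFiniteMeasure μ] :
    ∃ ρ : M → ℝ, ContMDiff (𝓡 m) 𝓘(ℝ, ℝ) ∞ ρ ∧ (∀ x, 0 < ρ x) ∧ Integrable ρ μ := by
  have := ChartedSpace.locallyCompactSpace (EuclideanSpace ℝ (Fin m)) M
  let K := CompactExhaustion.choice M
  have hKfin : ∀ n, μ (K n) < ⊤ := fun n => (K.isCompact n).measure_lt_top
  -- a function below `δ n` on the `n`-th shell of an exhaustion has integral at most `∑ 2⁻ⁿ`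
  let δ : ℕ → ℝ := fun n => (1/2) ^ n / (1 + (μ (K n)).toReal)
  have hδ0 : ∀ n, 0 < δ n := fun n => by positivity
  have hδa : Antitone δ := by
    intro a b hab
    have h1 : (μ (K a)).toReal ≤ (μ (K b)).toReal :=
      ENNReal.toReal_mono (hKfin b).ne (measure_mono (K.subset hab))
    have h2 : ((1:ℝ)/2) ^ b ≤ (1/2) ^ a := pow_le_pow_of_le_one (by norm_num) (by norm_num) hab
    exact div_le_div₀ (by positivity) h2 (by positivity) (by linarith)
  obtain ⟨ρ, hρ⟩ := exists_contMDiffMap_forall_mem_convex_of_local_const (𝓡 m) (n := ⊤) (F := ℝ)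
    (t := fun x => Set.Ioo 0 (δ (K.find x))) (fun x => convex_Ioo _ _) (fun x => by
      refine ⟨δ (K.find x + 1) / 2, ?_⟩
      have hx : x ∈ interior (K (K.find x + 1)) := K.subset_interior_succ _ (K.mem_find x)
      filter_upwards [isOpen_interior.mem_nhds hx] with y hy
      have h1 : K.find y ≤ K.find x + 1 := K.mem_iff_find_le.1 (interior_subset hy)
      have h2 := hδa h1
      have h3 := hδ0 (K.find x + 1)
      exact ⟨by linarith, by linarith⟩)
  refine ⟨ρ, ρ.contMDiff, fun x => (hρ x).1, ρ.contMDiff.continuous.aestronglyMeasurable, ?_⟩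
  have h1 : ∀ x, ‖ρ x‖ₑ ≤ ∑' n, (K n).indicator (fun _ => ENNReal.ofReal (δ n)) x := by
    intro x
    refine le_trans ?_ (ENNReal.le_tsum (K.find x))
    rw [Set.indicator_of_mem (K.mem_find x), ← ofReal_norm, Real.norm_eq_abs, abs_of_pos (hρ x).1]
    exact ENNReal.ofReal_le_ofReal (hρ x).2.le
  refine (lintegral_mono h1).trans_lt ?_
  rw [lintegral_tsum fun n => (measurable_const.indicator (K.isCompact n).measurableSet).aemeasurable]
  have h2 : ∀ n, ∫⁻ x, (K n).indicator (fun _ => ENNReal.ofReal (δ n)) x ∂μ ≤ ENNReal.ofReal ((1/2)^n) := by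
    intro n
    rw [lintegral_indicator_const (K.isCompact n).measurableSet, ← ENNReal.ofReal_toReal (hKfin n).ne,
      ← ENNReal.ofReal_mul (hδ0 n).le]
    refine ENNReal.ofReal_le_ofReal ?_
    have h0 : 0 ≤ (μ (K n)).toReal := ENNReal.toReal_nonneg
    simp only [δ]
    rw [div_mul_eq_mul_div, div_le_iff₀ (by positivity)]
    have : (0:ℝ) ≤ (1/2)^n := by positivity
    nlinarith
  refine (ENNReal.tsum_le_tsum h2).trans_lt ?_
  rw [← ENNReal.ofReal_tsum_of_nonneg (fun n => by positivity) (summable_geometric_of_lt_one (by norm_num) (by norm_num))]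
  exact ENNReal.ofReal_lt_top

end Density

/-! ### The energy functional -/

section Energy
set_option linter.unusedSectionVars false
open scoped Topology

variable {m : ℕ} {M : Type*} [MetricSpace M] [SecondCountableTopology M]
  [MeasurableSpace M] [BorelSpace M]
  [ChartedSpace (EuclideanSpace ℝ (Fin m)) M]
  [IsManifold (𝓡 m) ∞ M] [RiemannianBundle (fun x : M => TangentSpace (𝓡 m) x)]

variable (m) in
/-- `φ ∈ C_c^∞(M)`. -/
def IsTest (φ : M → ℝ) : Prop := ContMDiff (𝓡 m) 𝓘(ℝ, ℝ) ∞ φ ∧ HasCompactSupport φ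

variable (m) in
/-- The functional `φ ↦ ∫ |∇φ|² + ρ (1 - φ)²`. -/
noncomputable def energy (f ρ φ : M → ℝ) : ℝ :=
  ∫ x, (inner ℝ (grad φ x : TangentSpace (𝓡 m) x) (grad φ x) + ρ x * (1 - φ x) ^ 2)
    ∂(weightedVolume m f)

variable (m) in
/-- The quadratic form `φ ↦ ∫ |∇φ|² + ρ φ²`. -/
noncomputable def quad (f ρ φ : M → ℝ) : ℝ :=
  ∫ x, (inner ℝ (grad φ x : TangentSpace (𝓡 m) x) (grad φ x) + ρ x * φ x ^ 2)
    ∂(weightedVolume m f)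

variable (m) in
/-- Half the derivative of the energy at `φ` in the direction `ψ`. -/
noncomputable def euler (f ρ φ ψ : M → ℝ) : ℝ :=
  ∫ x, (inner ℝ (grad φ x : TangentSpace (𝓡 m) x) (grad ψ x) - ρ x * (1 - φ x) * ψ x)
    ∂(weightedVolume m f)

variable (m) in
/-- The infimum of the energy over `C_c^∞(M)`. For a positive integrable `ρ` it plays the role of
the capacity of `M`: it vanishes when there are cutoff functions that tend to `1` and have
arbitrarily small Dirichlet energy. -/
noncomputable def capacity (f ρ : M → ℝ) : ℝ := sInf (energy m f ρ '' {φ | IsTest m φ})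

theorem IsTest.zero : IsTest m (fun _ : M => 0) :=
  ⟨contMDiff_const, HasCompactSupport.zero⟩

theorem IsTest.add_mul {φ ψ : M → ℝ} (hφ : IsTest m φ) (hψ : IsTest m ψ) (t : ℝ) :
    IsTest m (fun x => φ x + t * ψ x) :=
  ⟨hφ.1.add (contMDiff_const.mul hψ.1), hφ.2.add hψ.2.mul_left⟩

theorem IsTest.sub {φ ψ : M → ℝ} (hψ : IsTest m ψ) (hφ : IsTest m φ) :
    IsTest m (fun x => ψ x - φ x) := by
  have := hψ.add_mul hφ (-1)
  convert this using 2
  ring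

theorem IsTest.contMDiff_one {φ : M → ℝ} (hφ : IsTest m φ) : ContMDiff (𝓡 m) 𝓘(ℝ, ℝ) 1 φ :=
  hφ.1.of_le (by exact_mod_cast le_top)

theorem IsTest.contMDiff_two {φ : M → ℝ} (hφ : IsTest m φ) : ContMDiff (𝓡 m) 𝓘(ℝ, ℝ) 2 φ :=
  hφ.1.of_le (show ((2 : ℕ∞) : WithTop ℕ∞) ≤ ∞ by exact_mod_cast le_top)

theorem IsTest.mdifferentiableAt {φ : M → ℝ} (hφ : IsTest m φ) (x : M) :
    MDifferentiableAt (𝓡 m) 𝓘(ℝ, ℝ) φ x :=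
  hφ.contMDiff_one.mdifferentiable (by norm_num) x

theorem energy_nonneg (f : M → ℝ) {ρ : M → ℝ} (hρ0 : ∀ x, 0 < ρ x) (φ : M → ℝ) : 0 ≤ energy m f ρ φ :=
  integral_nonneg fun x => add_nonneg real_inner_self_nonneg (mul_nonneg (hρ0 x).le (sq_nonneg _))

theorem quad_nonneg (f : M → ℝ) {ρ : M → ℝ} (hρ0 : ∀ x, 0 < ρ x) (φ : M → ℝ) : 0 ≤ quad m f ρ φ :=
  integral_nonneg fun x => add_nonneg real_inner_self_nonneg (mul_nonneg (hρ0 x).le (sq_nonneg _))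

theorem capacity_le_energy (f : M → ℝ) {ρ : M → ℝ} (hρ0 : ∀ x, 0 < ρ x) {φ : M → ℝ} (hφ : IsTest m φ) :
    capacity m f ρ ≤ energy m f ρ φ :=
  csInf_le ⟨0, by rintro _ ⟨φ, -, rfl⟩; exact energy_nonneg f hρ0 φ⟩ ⟨φ, hφ, rfl⟩

variable [IsContMDiffRiemannianBundle (𝓡 m) ∞ (EuclideanSpace ℝ (Fin m))
      (fun x : M => TangentSpace (𝓡 m) x)]

variable {f ρ : M → ℝ}

theorem integrable_energy (hf : ContMDiff (𝓡 m) 𝓘(ℝ, ℝ) ∞ f) (hρ : Continuous ρ)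
    (hρi : Integrable ρ (weightedVolume m f)) {φ : M → ℝ} (hφ : IsTest m φ) :
    Integrable (fun x => inner ℝ (grad φ x : TangentSpace (𝓡 m) x) (grad φ x) +
      ρ x * (1 - φ x) ^ 2) (weightedVolume m f) := by
  have := isLocallyFiniteMeasure_weightedVolume hf
  refine (integrable_inner_grad hf hφ.contMDiff_one hφ.contMDiff_one hφ.2).add ?_
  have h1 : Integrable (fun x => φ x * (ρ x * (φ x - 2))) (weightedVolume m f) :=
    (hφ.1.continuous.mul (hρ.mul (hφ.1.continuous.sub continuous_const))).integrable_of_hasCompactSupport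
      hφ.2.mul_right
  refine (hρi.add h1).congr (.of_forall fun x => ?_)
  simp only [Pi.add_apply]
  ring

theorem integrable_quad (hf : ContMDiff (𝓡 m) 𝓘(ℝ, ℝ) ∞ f) (hρ : Continuous ρ)
    {φ : M → ℝ} (hφ : IsTest m φ) :
    Integrable (fun x => inner ℝ (grad φ x : TangentSpace (𝓡 m) x) (grad φ x) +
      ρ x * φ x ^ 2) (weightedVolume m f) := by
  have := isLocallyFiniteMeasure_weightedVolume hf
  refine (integrable_inner_grad hf hφ.contMDiff_one hφ.contMDiff_one hφ.2).add ?_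
  have h1 : Integrable (fun x => φ x * (ρ x * φ x)) (weightedVolume m f) :=
    (hφ.1.continuous.mul (hρ.mul hφ.1.continuous)).integrable_of_hasCompactSupport
      hφ.2.mul_right
  refine h1.congr (.of_forall fun x => ?_)
  ring

theorem integrable_mul_test (hf : ContMDiff (𝓡 m) 𝓘(ℝ, ℝ) ∞ f) {g : M → ℝ} (hg : Continuous g)
    {ψ : M → ℝ} (hψ : IsTest m ψ) : Integrable (fun x => g x * ψ x) (weightedVolume m f) := by
  have := isLocallyFiniteMeasure_weightedVolume hf
  exact (hg.mul hψ.1.continuous).integrable_of_hasCompactSupport hψ.2.mul_left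

theorem integrable_euler (hf : ContMDiff (𝓡 m) 𝓘(ℝ, ℝ) ∞ f) (hρ : Continuous ρ)
    {φ ψ : M → ℝ} (hφ : IsTest m φ) (hψ : IsTest m ψ) :
    Integrable (fun x => inner ℝ (grad φ x : TangentSpace (𝓡 m) x) (grad ψ x) -
      ρ x * (1 - φ x) * ψ x) (weightedVolume m f) :=
  (integrable_inner_grad hf hφ.contMDiff_one hψ.contMDiff_one hψ.2).sub
    (integrable_mul_test hf (hρ.mul (continuous_const.sub hφ.1.continuous)) hψ)

/-- The Taylor expansion of the energy, which is a quadratic functional. -/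
theorem energy_add_mul (hf : ContMDiff (𝓡 m) 𝓘(ℝ, ℝ) ∞ f) (hρ : Continuous ρ)
    (hρi : Integrable ρ (weightedVolume m f)) {φ ψ : M → ℝ} (hφ : IsTest m φ) (hψ : IsTest m ψ)
    (t : ℝ) :
    energy m f ρ (fun x => φ x + t * ψ x) =
      energy m f ρ φ + 2 * t * euler m f ρ φ ψ + t ^ 2 * quad m f ρ ψ := by
  rw [energy, energy, euler, quad, ← integral_const_mul, ← integral_const_mul, ← integral_add,
    ← integral_add]
  · refine integral_congr_ae (.of_forall fun x => ?_)
    have h : (grad (fun x => φ x + t * ψ x) x : TangentSpace (𝓡 m) x) = grad φ x + t • grad ψ x := by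
      rw [grad_add (w := fun x => t * ψ x) (hφ.mdifferentiableAt x)
        ((contMDiff_const.mul hψ.contMDiff_one).mdifferentiable (by norm_num) x),
        grad_const_mul t (hψ.mdifferentiableAt x)]
    simp only [h, inner_add_left, inner_add_right, real_inner_smul_left, real_inner_smul_right]
    rw [real_inner_comm (grad φ x) (grad ψ x)]
    ring
  · exact (integrable_energy hf hρ hρi hφ).add ((integrable_euler hf hρ hφ hψ).const_mul _)
  · exact (integrable_quad hf hρ hψ).const_mul _
  · exact integrable_energy hf hρ hρi hφ
  · exact (integrable_euler hf hρ hφ hψ).const_mul _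

/-- Near-minimizers of the energy nearly satisfy its Euler-Lagrange equation. -/
theorem euler_sq_le (hf : ContMDiff (𝓡 m) 𝓘(ℝ, ℝ) ∞ f) (hρ : Continuous ρ) (hρ0 : ∀ x, 0 < ρ x)
    (hρi : Integrable ρ (weightedVolume m f)) {φ ψ : M → ℝ} (hφ : IsTest m φ) (hψ : IsTest m ψ) :
    euler m f ρ φ ψ ^ 2 ≤ (energy m f ρ φ - capacity m f ρ) * quad m f ρ ψ := by
  -- the energy of `φ + t ψ` is at least the infimum, for every `t`; take the discriminant in `t`
  have h : ∀ t : ℝ, 0 ≤ quad m f ρ ψ * (t * t) + (2 * euler m f ρ φ ψ) * t +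
      (energy m f ρ φ - capacity m f ρ) := by
    intro t
    have h1 := capacity_le_energy f hρ0 (hφ.add_mul hψ t)
    rw [energy_add_mul hf hρ hρi hφ hψ t] at h1
    nlinarith
  have := discrim_le_zero h
  rw [discrim] at this
  nlinarith

/-- Near-minimizers of the energy are close to each other. -/
theorem quad_sub_le (hf : ContMDiff (𝓡 m) 𝓘(ℝ, ℝ) ∞ f) (hρ : Continuous ρ) (hρ0 : ∀ x, 0 < ρ x)
    (hρi : Integrable ρ (weightedVolume m f)) {φ ψ : M → ℝ} (hφ : IsTest m φ) (hψ : IsTest m ψ) :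
    quad m f ρ (fun x => ψ x - φ x) ≤
      2 * (energy m f ρ ψ - capacity m f ρ) + 4 * (energy m f ρ φ - capacity m f ρ) := by
  have hd : IsTest m (fun x => ψ x - φ x) := hψ.sub hφ
  have h1 := energy_add_mul hf hρ hρi hφ hd 1
  have h2 : (fun x => φ x + 1 * (ψ x - φ x)) = ψ := by ext x; ring
  rw [h2] at h1
  have h3 := euler_sq_le hf hρ hρ0 hρi hφ hd
  have h4 := capacity_le_energy f hρ0 hφ
  have h5 := quad_nonneg (m := m) f hρ0 (fun x => ψ x - φ x)
  set Q := quad m f ρ (fun x => ψ x - φ x)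
  set e := euler m f ρ φ (fun x => ψ x - φ x)
  set a := energy m f ρ φ - capacity m f ρ
  have ha : 0 ≤ a := sub_nonneg.2 h4
  have h6 : -e ≤ a + Q / 4 := by
    refine abs_le_of_sq_le_sq' ?_ (by positivity) |>.2
    nlinarith [sq_nonneg (a - Q / 4)]
  have h7 : energy m f ρ φ = a + capacity m f ρ := by simp [a]
  linarith

/-- Testing the Euler-Lagrange functional with `φ` itself. -/
theorem energy_eq (hf : ContMDiff (𝓡 m) 𝓘(ℝ, ℝ) ∞ f) (hρ : Continuous ρ)
    (hρi : Integrable ρ (weightedVolume m f)) {φ : M → ℝ} (hφ : IsTest m φ) :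
    energy m f ρ φ = euler m f ρ φ φ + ∫ x, ρ x * (1 - φ x) ∂(weightedVolume m f) := by
  rw [energy, euler, ← integral_add (integrable_euler hf hρ hφ hφ)]
  · refine integral_congr_ae (.of_forall fun x => ?_)
    simp only
    ring
  · refine (hρi.sub (integrable_mul_test hf hρ hφ)).congr (.of_forall fun x => ?_)
    simp only [Pi.sub_apply]
    ring

end Energy
end WeightedManifold

/-! ### Bounded minimizing sequences -/

namespace WeightedManifold
section MinimizingSequence
set_option linter.unusedSectionVars false
open scoped Topology
open Filter

/-- Nonnegative functions with summable integrals have a common integrable bound. -/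
theorem exists_integrable_bound {α : Type*} [MeasurableSpace α] {μ : Measure α} {F : ℕ → α → ℝ}
    (hF : ∀ n, Integrable (F n) μ) (hF0 : ∀ n x, 0 ≤ F n x) {a : ℕ → ℝ} (ha : Summable a)
    (hFa : ∀ n, ∫ x, F n x ∂μ ≤ a n) :
    ∃ S : α → ℝ, Integrable S μ ∧ (∀ x, 0 ≤ S x) ∧ ∀ᵐ x ∂μ, ∀ n, F n x ≤ S x := by
  have ha0 : ∀ n, 0 ≤ a n := fun n => (integral_nonneg (hF0 n)).trans (hFa n)
  have hm : ∀ n, AEMeasurable (fun x => ENNReal.ofReal (F n x)) μ :=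
    fun n => (hF n).aestronglyMeasurable.aemeasurable.ennreal_ofReal
  have hfin : ∫⁻ x, ∑' n, ENNReal.ofReal (F n x) ∂μ < ⊤ := by
    rw [lintegral_tsum hm]
    refine (ENNReal.tsum_le_tsum (g := fun n => ENNReal.ofReal (a n)) fun n => ?_).trans_lt ?_
    · rw [← ofReal_integral_eq_lintegral_ofReal (hF n) (.of_forall (hF0 n))]
      exact ENNReal.ofReal_le_ofReal (hFa n)
    · rw [← ENNReal.ofReal_tsum_of_nonneg ha0 ha]
      exact ENNReal.ofReal_lt_top
  have hms : AEMeasurable (fun x => ∑' n, ENNReal.ofReal (F n x)) μ := AEMeasurable.tsum hm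
  refine ⟨fun x => (∑' n, ENNReal.ofReal (F n x)).toReal, integrable_toReal_of_lintegral_ne_top hms hfin.ne,
    fun x => ENNReal.toReal_nonneg, ?_⟩
  filter_upwards [ae_lt_top' hms hfin.ne] with x hx n
  rw [← ENNReal.toReal_ofReal (hF0 n x)]
  exact ENNReal.toReal_mono hx.ne (ENNReal.le_tsum n)

variable {m : ℕ} {M : Type*} [MetricSpace M] [SecondCountableTopology M]
  [MeasurableSpace M] [BorelSpace M]
  [ChartedSpace (EuclideanSpace ℝ (Fin m)) M]
  [IsManifold (𝓡 m) ∞ M] [RiemannianBundle (fun x : M => TangentSpace (𝓡 m) x)]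
  [IsContMDiffRiemannianBundle (𝓡 m) ∞ (EuclideanSpace ℝ (Fin m))
      (fun x : M => TangentSpace (𝓡 m) x)]
variable {f ρ : M → ℝ}

theorem grad_sub_of_isTest {φ ψ : M → ℝ} (hψ : IsTest m ψ) (hφ : IsTest m φ) (x : M) :
    (grad (fun x => ψ x - φ x) x : TangentSpace (𝓡 m) x) = grad ψ x - grad φ x := by
  have h := grad_add (w := fun x => -1 * φ x) (hψ.mdifferentiableAt x)
    ((contMDiff_const.mul hφ.contMDiff_one).mdifferentiable (by norm_num) x :
      MDifferentiableAt (𝓡 m) 𝓘(ℝ, ℝ) (fun x => (-1:ℝ) * φ x) x)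
  rw [grad_const_mul _ (hφ.mdifferentiableAt x)] at h
  have e : (fun x => ψ x - φ x) = fun x => ψ x + -1 * φ x := by ext x; ring
  rw [e, h, neg_one_smul, sub_eq_add_neg]

/-- The energy infimum can be approached by uniformly bounded test functions. -/
theorem exists_bounded_test (hf : ContMDiff (𝓡 m) 𝓘(ℝ, ℝ) ∞ f) (hρ : Continuous ρ)
    (hρ0 : ∀ x, 0 < ρ x) (hρi : Integrable ρ (weightedVolume m f)) {ε : ℝ} (hε : 0 < ε) :
    ∃ φ : M → ℝ, IsTest m φ ∧ (∀ x, |φ x| ≤ 4) ∧ energy m f ρ φ ≤ capacity m f ρ + ε := by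
  obtain ⟨_, ⟨φ, hφ, rfl⟩, hlt⟩ := Real.lt_sInf_add_pos (s := energy m f ρ '' {φ | IsTest m φ})
    ⟨_, _, IsTest.zero, rfl⟩ hε
  obtain ⟨T, b, hT, hTb, hb, hT0, hT1, hT4⟩ := exists_truncation
  have hTφ : IsTest m (fun x => T (φ x)) := ⟨hT.contMDiff.comp hφ.1, hφ.2.comp_left hT0⟩
  refine ⟨fun x => T (φ x), hTφ, fun x => hT4 _, le_trans ?_ hlt.le⟩
  refine integral_mono (integrable_energy hf hρ hρi hTφ) (integrable_energy hf hρ hρi hφ) fun x => ?_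
  dsimp only
  rw [grad_comp (hTb (φ x)) (hφ.mdifferentiableAt x), real_inner_smul_left, real_inner_smul_right]
  have h1 : b (φ x) * b (φ x) ≤ 1 := by
    have := hb (φ x)
    rw [← abs_mul_abs_self]
    exact mul_le_one₀ this (abs_nonneg _) this
  have h2 : (1 - T (φ x)) ^ 2 ≤ (1 - φ x) ^ 2 := sq_le_sq.2 (hT1 _)
  have h3 : 0 ≤ inner ℝ (grad φ x : TangentSpace (𝓡 m) x) (grad φ x) := real_inner_self_nonneg
  refine add_le_add ?_ (mul_le_mul_of_nonneg_left h2 (hρ0 x).le)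
  rw [← mul_assoc]
  exact mul_le_of_le_one_left h3 h1

/-- Along a fast minimizing sequence, the functions and their gradients converge almost everywhere,
and the gradients are dominated in `L²`. -/
theorem exists_limit (hf : ContMDiff (𝓡 m) 𝓘(ℝ, ℝ) ∞ f) (hρ : Continuous ρ)
    (hρ0 : ∀ x, 0 < ρ x) (hρi : Integrable ρ (weightedVolume m f)) {φ : ℕ → M → ℝ}
    (hφ : ∀ n, IsTest m (φ n))
    (hφe : ∀ n, energy m f ρ (φ n) ≤ capacity m f ρ + (1 / 16) ^ n) :
    ∃ (u : M → ℝ) (Y : ∀ x : M, TangentSpace (𝓡 m) x) (H : M → ℝ),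
      Integrable H (weightedVolume m f) ∧ ∀ᵐ x ∂(weightedVolume m f),
        Tendsto (fun n => φ n x) atTop (𝓝 (u x)) ∧
        Tendsto (fun n => (grad (φ n) x : TangentSpace (𝓡 m) x)) atTop (𝓝 (Y x)) ∧
        ∀ n, inner ℝ (grad (φ n) x : TangentSpace (𝓡 m) x) (grad (φ n) x) ≤ H x := by
  let D : ℕ → M → ℝ := fun n x => φ (n + 1) x - φ n x
  have hD : ∀ n, IsTest m (D n) := fun n => (hφ (n + 1)).sub (hφ n)
  have hDg : ∀ n x, (grad (D n) x : TangentSpace (𝓡 m) x) = grad (φ (n + 1)) x - grad (φ n) x :=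
    fun n x => grad_sub_of_isTest (hφ (n + 1)) (hφ n) x
  -- the increments have quadratic form of order `16⁻ⁿ`; the weights `4ⁿ` leave a summable series and
  -- yield increments of order `2⁻ⁿ` almost everywhere
  let F : ℕ → M → ℝ := fun n x => 4 ^ n * (inner ℝ (grad (D n) x : TangentSpace (𝓡 m) x) (grad (D n) x) +
      ρ x * D n x ^ 2)
  obtain ⟨S, hS, hS0, hFS⟩ := exists_integrable_bound (μ := weightedVolume m f) (F := F)
    (fun n => (integrable_quad hf hρ (hD n)).const_mul _)
    (fun n x => mul_nonneg (by positivity) (add_nonneg real_inner_self_nonneg (mul_nonneg (hρ0 x).le (sq_nonneg _))))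
    (a := fun n => 6 * (1/4) ^ n)
    ((summable_geometric_of_lt_one (by norm_num) (by norm_num)).mul_left _) (by
      intro n
      rw [integral_const_mul]
      have h1 := quad_sub_le hf hρ hρ0 hρi (hφ n) (hφ (n + 1))
      have h2 := hφe n
      have h3 := hφe (n + 1)
      have h4 : ((1:ℝ) / 16) ^ (n + 1) ≤ (1 / 16) ^ n := pow_le_pow_of_le_one (by norm_num) (by norm_num) (by omega)
      have h5 : quad m f ρ (D n) ≤ 6 * (1/16) ^ n := by linarith
      have h6 : (4:ℝ) ^ n * (6 * (1/16) ^ n) = 6 * (1/4) ^ n := by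
        rw [mul_left_comm, ← mul_pow]; norm_num
      rw [← h6]
      exact mul_le_mul_of_nonneg_left h5 (by positivity))
  refine ⟨fun x => limUnder atTop fun n => φ n x,
    fun x => limUnder atTop fun n => (grad (φ n) x : TangentSpace (𝓡 m) x),
    fun x => 2 * inner ℝ (grad (φ 0) x : TangentSpace (𝓡 m) x) (grad (φ 0) x) + 32 * S x,
    ((integrable_inner_grad hf (hφ 0).contMDiff_one (hφ 0).contMDiff_one (hφ 0).2).const_mul _).add
      (hS.const_mul _), ?_⟩
  filter_upwards [hFS] with x hx
  have : FiniteDimensional ℝ (TangentSpace (𝓡 m) x) :=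
    inferInstanceAs (FiniteDimensional ℝ (EuclideanSpace ℝ (Fin m)))
  have : CompleteSpace (TangentSpace (𝓡 m) x) := FiniteDimensional.complete ℝ _
  have h4 : ∀ n : ℕ, (0:ℝ) < 4 ^ n := fun n => by positivity
  have hhalf : ∀ n : ℕ, ((1:ℝ)/2) ^ n = √ ((4 ^ n)⁻¹) := fun n => by
    rw [eq_comm, Real.sqrt_eq_iff_mul_self_eq (by positivity) (by positivity), ← mul_pow, ← inv_pow]
    norm_num
  have hdg : ∀ n, dist (grad (φ n) x : TangentSpace (𝓡 m) x) (grad (φ (n + 1)) x) ≤ √ (S x) * (1/2) ^ n := by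
    intro n
    rw [dist_comm, dist_eq_norm, ← hDg, hhalf, ← Real.sqrt_mul (hS0 x)]
    refine Real.le_sqrt_of_sq_le ?_
    rw [← real_inner_self_eq_norm_sq, ← div_eq_mul_inv, le_div_iff₀ (h4 n), mul_comm]
    have := hx n
    simp only [F, mul_add] at this
    have h5 : 0 ≤ 4 ^ n * (ρ x * D n x ^ 2) := by have := hρ0 x; positivity
    linarith
  have hdu : ∀ n, dist (φ n x) (φ (n + 1) x) ≤ √ (S x / ρ x) * (1/2) ^ n := by
    intro n
    rw [dist_comm, Real.dist_eq, hhalf, ← Real.sqrt_mul (div_nonneg (hS0 x) (hρ0 x).le)]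
    refine Real.le_sqrt_of_sq_le ?_
    rw [sq_abs, ← div_eq_mul_inv, le_div_iff₀ (h4 n), le_div_iff₀ (hρ0 x)]
    have := hx n
    simp only [F, mul_add] at this
    have h5 : 0 ≤ 4 ^ n * inner ℝ (grad (D n) x : TangentSpace (𝓡 m) x) (grad (D n) x) :=
      mul_nonneg (h4 n).le real_inner_self_nonneg
    have h6 : D n x = φ (n + 1) x - φ n x := rfl
    rw [h6] at this
    linarith
  have hlg := (cauchySeq_of_le_geometric _ _ (by norm_num) hdg).tendsto_limUnder
  refine ⟨(cauchySeq_of_le_geometric _ _ (by norm_num) hdu).tendsto_limUnder, hlg, fun n => ?_⟩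
  set Y := limUnder atTop fun n => (grad (φ n) x : TangentSpace (𝓡 m) x)
  have e0 := dist_le_of_le_geometric_of_tendsto _ _ (by norm_num) hdg hlg 0
  have en := dist_le_of_le_geometric_of_tendsto _ _ (by norm_num) hdg hlg n
  have hs : 0 ≤ √ (S x) := Real.sqrt_nonneg _
  have hp : ((1:ℝ)/2) ^ n ≤ 1 := pow_le_one₀ (by norm_num) (by norm_num)
  have e1 : dist (grad (φ n) x : TangentSpace (𝓡 m) x) (grad (φ 0) x) ≤ 4 * √ (S x) := by
    have h7 := dist_triangle_right (grad (φ n) x : TangentSpace (𝓡 m) x) (grad (φ 0) x) Y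
    have h8 : √ (S x) * (1/2) ^ n ≤ √ (S x) := mul_le_of_le_one_right hs hp
    norm_num at e0 en
    linarith
  have e2 : ‖(grad (φ n) x : TangentSpace (𝓡 m) x)‖ ≤ ‖(grad (φ 0) x : TangentSpace (𝓡 m) x)‖ + 4 * √ (S x) := by
    rw [dist_eq_norm] at e1
    have h9 := norm_sub_norm_le (grad (φ n) x : TangentSpace (𝓡 m) x) (grad (φ 0) x)
    linarith
  rw [real_inner_self_eq_norm_sq, real_inner_self_eq_norm_sq]
  have e3 := Real.sq_sqrt (hS0 x)
  have e4 := norm_nonneg (grad (φ n) x : TangentSpace (𝓡 m) x)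
  have e5 := pow_le_pow_left₀ e4 e2 2
  nlinarith [sq_nonneg (‖(grad (φ 0) x : TangentSpace (𝓡 m) x)‖ - 4 * √ (S x))]

end MinimizingSequence
end WeightedManifold

/-! ### The limit of a minimizing sequence -/

namespace WeightedManifold
section Equilibrium
set_option linter.unusedSectionVars false
open scoped Topology
open Filter

variable {m : ℕ} {M : Type*} [MetricSpace M] [SecondCountableTopology M]
  [MeasurableSpace M] [BorelSpace M]
  [ChartedSpace (EuclideanSpace ℝ (Fin m)) M]
  [IsManifold (𝓡 m) ∞ M] [RiemannianBundle (fun x : M => TangentSpace (𝓡 m) x)]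

/-- A bounded and fast minimizing sequence `φ` for the energy, together with the almost everywhere limits
`u` of `φ` and `Y` of `∇φ`, and an integrable bound `H` of `|∇φ|²`. -/
structure IsMinimizing (f ρ : M → ℝ) (φ : ℕ → M → ℝ) (u : M → ℝ)
    (Y : ∀ x : M, TangentSpace (𝓡 m) x) (H : M → ℝ) : Prop where
  isTest : ∀ n, IsTest m (φ n)
  bound : ∀ n x, |φ n x| ≤ 4
  energy_le : ∀ n, energy m f ρ (φ n) ≤ capacity m f ρ + (1 / 16) ^ n
  integrable : Integrable H (weightedVolume m f)
  tendsto : ∀ᵐ x ∂(weightedVolume m f), Tendsto (fun n => φ n x) atTop (𝓝 (u x))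
  tendsto_grad : ∀ᵐ x ∂(weightedVolume m f),
    Tendsto (fun n => (grad (φ n) x : TangentSpace (𝓡 m) x)) atTop (𝓝 (Y x))
  inner_le : ∀ᵐ x ∂(weightedVolume m f),
    ∀ n, inner ℝ (grad (φ n) x : TangentSpace (𝓡 m) x) (grad (φ n) x) ≤ H x

variable [IsContMDiffRiemannianBundle (𝓡 m) ∞ (EuclideanSpace ℝ (Fin m))
      (fun x : M => TangentSpace (𝓡 m) x)]
variable {f ρ : M → ℝ}

theorem exists_isMinimizing (hf : ContMDiff (𝓡 m) 𝓘(ℝ, ℝ) ∞ f) (hρ : Continuous ρ)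
    (hρ0 : ∀ x, 0 < ρ x) (hρi : Integrable ρ (weightedVolume m f)) :
    ∃ (φ : ℕ → M → ℝ) (u : M → ℝ) (Y : ∀ x : M, TangentSpace (𝓡 m) x) (H : M → ℝ),
      IsMinimizing f ρ φ u Y H := by
  choose φ h1 h2 h3 using fun n : ℕ =>
    exists_bounded_test (m := m) hf hρ hρ0 hρi (show (0:ℝ) < (1 / 16) ^ n by positivity)
  obtain ⟨u, Y, H, hH, h⟩ := exists_limit hf hρ hρ0 hρi h1 h3
  exact ⟨φ, u, Y, H, h1, h2, h3, hH, h.mono fun x hx => hx.1, h.mono fun x hx => hx.2.1,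
    h.mono fun x hx => hx.2.2⟩

namespace IsMinimizing
variable {φ : ℕ → M → ℝ} {u : M → ℝ} {Y : ∀ x : M, TangentSpace (𝓡 m) x} {H : M → ℝ}

theorem aestronglyMeasurable (h : IsMinimizing f ρ φ u Y H) :
    AEStronglyMeasurable u (weightedVolume m f) :=
  aestronglyMeasurable_of_tendsto_ae atTop
    (fun n => (h.isTest n).1.continuous.aestronglyMeasurable) h.tendsto

theorem abs_le (h : IsMinimizing f ρ φ u Y H) : ∀ᵐ x ∂(weightedVolume m f), |u x| ≤ 4 :=
  h.tendsto.mono fun x hx => le_of_tendsto' hx.abs fun n => h.bound n x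

theorem norm_sq_le (h : IsMinimizing f ρ φ u Y H) :
    ∀ᵐ x ∂(weightedVolume m f), inner ℝ (Y x) (Y x) ≤ H x := by
  filter_upwards [h.tendsto_grad, h.inner_le] with x h1 h2
  exact le_of_tendsto' (h1.inner h1) h2

theorem tendsto_inner (h : IsMinimizing f ρ φ u Y H) (V : ∀ x : M, TangentSpace (𝓡 m) x) :
    ∀ᵐ x ∂(weightedVolume m f), Tendsto (fun n => inner ℝ (grad (φ n) x) (V x)) atTop
      (𝓝 (inner ℝ (Y x) (V x))) := by
  filter_upwards [h.tendsto_grad] with x h1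
  exact h1.inner tendsto_const_nhds

theorem abs_inner_le {x : M} (v w : TangentSpace (𝓡 m) x) :
    |inner ℝ v w| ≤ inner ℝ v v + inner ℝ w w := by
  have h1 := abs_real_inner_le_norm v w
  rw [real_inner_self_eq_norm_sq, real_inner_self_eq_norm_sq]
  nlinarith [sq_nonneg (‖v‖ - ‖w‖), sq_nonneg ‖v‖, sq_nonneg ‖w‖]

/-- The limit field is square integrable. -/
theorem memLp_norm (h : IsMinimizing f ρ φ u Y H) :
    MemLp (fun x => ‖Y x‖) 2 (weightedVolume m f) := by
  have hm : AEStronglyMeasurable (fun x => ‖Y x‖) (weightedVolume m f) := by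
    refine aestronglyMeasurable_of_tendsto_ae atTop (f := fun n x => ‖(grad (φ n) x : TangentSpace (𝓡 m) x)‖)
      (fun n => ?_) (h.tendsto_grad.mono fun x hx => hx.norm)
    have := (continuous_inner_grad (h.isTest n).contMDiff_one (h.isTest n).contMDiff_one).sqrt
    refine Continuous.aestronglyMeasurable (this.congr fun x => ?_)
    rw [real_inner_self_eq_norm_sq, Real.sqrt_sq (norm_nonneg _)]
  rw [memLp_two_iff_integrable_sq hm]
  refine h.integrable.mono' (hm.pow 2) ?_
  filter_upwards [h.norm_sq_le] with x hx
  rw [Real.norm_eq_abs, abs_of_nonneg (sq_nonneg _), ← real_inner_self_eq_norm_sq]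
  exact hx

theorem integrable_inner (h : IsMinimizing f ρ φ u Y H) (hf : ContMDiff (𝓡 m) 𝓘(ℝ, ℝ) ∞ f)
    {ψ : M → ℝ} (hψ : IsTest m ψ) :
    Integrable (fun x => inner ℝ (Y x) (grad ψ x)) (weightedVolume m f) ∧
    Tendsto (fun n => ∫ x, inner ℝ (grad (φ n) x : TangentSpace (𝓡 m) x) (grad ψ x) ∂(weightedVolume m f))
      atTop (𝓝 (∫ x, inner ℝ (Y x) (grad ψ x) ∂(weightedVolume m f))) := by
  have hm : ∀ n, AEStronglyMeasurable (fun x => inner ℝ (grad (φ n) x : TangentSpace (𝓡 m) x) (grad ψ x))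
      (weightedVolume m f) := fun n =>
    (continuous_inner_grad (h.isTest n).contMDiff_one hψ.contMDiff_one).aestronglyMeasurable
  have hb : Integrable (fun x => H x + inner ℝ (grad ψ x : TangentSpace (𝓡 m) x) (grad ψ x)) (weightedVolume m f) :=
    h.integrable.add (integrable_inner_grad hf hψ.contMDiff_one hψ.contMDiff_one hψ.2)
  refine ⟨hb.mono' (aestronglyMeasurable_of_tendsto_ae atTop hm (h.tendsto_inner _)) ?_,
    tendsto_integral_of_dominated_convergence _ hm hb (fun n => ?_) (h.tendsto_inner _)⟩
  · filter_upwards [h.norm_sq_le] with x hx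
    exact (abs_inner_le _ _).trans (by linarith)
  · filter_upwards [h.inner_le] with x hx
    exact (abs_inner_le _ _).trans (by linarith [hx n])

theorem integrable_mul (h : IsMinimizing f ρ φ u Y H) {g : M → ℝ} (hg : Integrable g (weightedVolume m f)) :
    Integrable (fun x => g x * (1 - u x)) (weightedVolume m f) ∧
    Tendsto (fun n => ∫ x, g x * (1 - φ n x) ∂(weightedVolume m f))
      atTop (𝓝 (∫ x, g x * (1 - u x) ∂(weightedVolume m f))) := by
  have hb : Integrable (fun x => ‖g x‖ * 5) (weightedVolume m f) := hg.norm.mul_const _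
  have h5 : ∀ {t : ℝ}, |t| ≤ 4 → |1 - t| ≤ 5 := fun {t} ht => by
    rw [_root_.abs_le] at ht ⊢; constructor <;> linarith [ht.1, ht.2]
  refine ⟨hb.mono' (hg.aestronglyMeasurable.mul (aestronglyMeasurable_const.sub h.aestronglyMeasurable)) ?_,
    tendsto_integral_of_dominated_convergence _ (fun n => hg.aestronglyMeasurable.mul
      (aestronglyMeasurable_const.sub (h.isTest n).1.continuous.aestronglyMeasurable)) hb (fun n => ?_) ?_⟩
  · filter_upwards [h.abs_le] with x hx
    rw [norm_mul]
    exact mul_le_mul_of_nonneg_left (h5 hx) (norm_nonneg _)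
  · refine .of_forall fun x => ?_
    rw [norm_mul]
    exact mul_le_mul_of_nonneg_left (h5 (h.bound n x)) (norm_nonneg _)
  · filter_upwards [h.tendsto] with x hx
    exact (tendsto_const_nhds.sub hx).const_mul _

theorem tendsto_pow_zero : Tendsto (fun n : ℕ => ((1:ℝ) / 16) ^ n) atTop (𝓝 0) :=
  tendsto_pow_atTop_nhds_zero_of_lt_one (by norm_num) (by norm_num)

/-- The Euler-Lagrange equation of the minimization problem. -/
theorem integral_inner (h : IsMinimizing f ρ φ u Y H) (hf : ContMDiff (𝓡 m) 𝓘(ℝ, ℝ) ∞ f)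
    (hρ : Continuous ρ) (hρ0 : ∀ x, 0 < ρ x) (hρi : Integrable ρ (weightedVolume m f))
    {ψ : M → ℝ} (hψ : IsTest m ψ) :
    ∫ x, inner ℝ (Y x) (grad ψ x) ∂(weightedVolume m f) =
      ∫ x, ρ x * ψ x * (1 - u x) ∂(weightedVolume m f) := by
  have h1 := (h.integrable_inner hf hψ).2
  have h2 := (h.integrable_mul (integrable_mul_test hf hρ hψ)).2
  have h3 : ∀ n, (∫ x, inner ℝ (grad (φ n) x : TangentSpace (𝓡 m) x) (grad ψ x) ∂(weightedVolume m f)) -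
      ∫ x, ρ x * ψ x * (1 - φ n x) ∂(weightedVolume m f) = euler m f ρ (φ n) ψ := by
    intro n
    rw [euler, ← integral_sub (integrable_inner_grad hf (h.isTest n).contMDiff_one hψ.contMDiff_one hψ.2)]
    · refine integral_congr_ae (.of_forall fun x => ?_)
      dsimp only
      ring
    · refine (integrable_mul_test hf (hρ.mul (continuous_const.sub (h.isTest n).1.continuous)) hψ
        (g := fun x => ρ x * (1 - φ n x))).congr (.of_forall fun x => ?_)
      dsimp only
      ring
  have h4 : Tendsto (fun n => euler m f ρ (φ n) ψ) atTop (𝓝 0) := by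
    have h5 : Tendsto (fun n : ℕ => √ ((1 / 16) ^ n * quad m f ρ ψ)) atTop (𝓝 0) := by
      have := (tendsto_pow_zero.mul_const (quad m f ρ ψ)).sqrt
      simpa using this
    refine squeeze_zero_norm (fun n => ?_) h5
    refine Real.le_sqrt_of_sq_le ?_
    rw [Real.norm_eq_abs, sq_abs]
    refine (euler_sq_le hf hρ hρ0 hρi (h.isTest n) hψ).trans ?_
    exact mul_le_mul_of_nonneg_right (by linarith [h.energy_le n]) (quad_nonneg f hρ0 ψ)
  have h6 := h1.sub h2
  simp only [h3] at h6
  exact sub_eq_zero.1 (tendsto_nhds_unique h6 h4)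

/-- The total mass of the weighted divergence of the limit field is the infimum of the energy. -/
theorem integral_eq_capacity (h : IsMinimizing f ρ φ u Y H) (hf : ContMDiff (𝓡 m) 𝓘(ℝ, ℝ) ∞ f)
    (hρ : Continuous ρ) (hρ0 : ∀ x, 0 < ρ x) (hρi : Integrable ρ (weightedVolume m f)) :
    ∫ x, ρ x * (1 - u x) ∂(weightedVolume m f) = capacity m f ρ := by
  have h2 := (h.integrable_mul hρi).2
  set K := ∫ x, (H x + ρ x * 16) ∂(weightedVolume m f)
  have hq : ∀ n, quad m f ρ (φ n) ≤ K := by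
    intro n
    refine integral_mono_ae (integrable_quad hf hρ (h.isTest n)) (h.integrable.add (hρi.mul_const _)) ?_
    filter_upwards [h.inner_le] with x hx
    have h1 : φ n x ^ 2 ≤ 16 := by
      rw [← sq_abs]
      nlinarith [h.bound n x, abs_nonneg (φ n x)]
    exact add_le_add (hx n) (mul_le_mul_of_nonneg_left h1 (hρ0 x).le)
  -- the Euler-Lagrange functional, tested with the minimizing sequence itself, tends to zero
  have h4 : Tendsto (fun n => euler m f ρ (φ n) (φ n)) atTop (𝓝 0) := by
    have h5 : Tendsto (fun n : ℕ => √ ((1 / 16) ^ n * K)) atTop (𝓝 0) := by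
      have := (tendsto_pow_zero.mul_const K).sqrt
      simpa using this
    refine squeeze_zero_norm (fun n => ?_) h5
    refine Real.le_sqrt_of_sq_le ?_
    rw [Real.norm_eq_abs, sq_abs]
    refine (euler_sq_le hf hρ hρ0 hρi (h.isTest n) (h.isTest n)).trans ?_
    exact mul_le_mul (by linarith [h.energy_le n]) (hq n) (quad_nonneg f hρ0 _) (by positivity)
  have h6 : Tendsto (fun n => energy m f ρ (φ n)) atTop (𝓝 (capacity m f ρ)) := by
    refine tendsto_of_tendsto_of_tendsto_of_le_of_le tendsto_const_nhds ?_
      (fun n => capacity_le_energy f hρ0 (h.isTest n)) h.energy_le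
    simpa using tendsto_pow_zero.const_add (capacity m f ρ)
  have h7 := h4.add h2
  simp only [← energy_eq hf hρ hρi (h.isTest _), zero_add] at h7
  exact tendsto_nhds_unique h7 h6

/-- The limit `u` satisfies the Euler-Lagrange equation in the very weak sense. -/
theorem integral_mul_fLaplacian (h : IsMinimizing f ρ φ u Y H) (hf : ContMDiff (𝓡 m) 𝓘(ℝ, ℝ) ∞ f)
    (hρ : Continuous ρ) (hρ0 : ∀ x, 0 < ρ x) (hρi : Integrable ρ (weightedVolume m f))
    {ψ : M → ℝ} (hψ : IsTest m ψ) :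
    ∫ x, (1 - u x) * (fLaplacian m f ψ x - ρ x * ψ x) ∂(weightedVolume m f) = 0 := by
  have hΔ : Integrable (fun x => fLaplacian m f ψ x) (weightedVolume m f) := by
    have := isLocallyFiniteMeasure_weightedVolume hf
    refine (continuous_fLaplacian hf hψ.contMDiff_two).integrable_of_hasCompactSupport
      (HasCompactSupport.intro hψ.2 fun x hx => ?_)
    exact fLaplacian_eq_zero_of_notMem_tsupport hψ.contMDiff_two hx
  have h1 := h.integrable_mul hΔ
  have h2 := h.integrable_mul (integrable_mul_test hf hρ hψ)
  have h3 : ∀ n, ∫ x, fLaplacian m f ψ x * (1 - φ n x) ∂(weightedVolume m f) =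
      ∫ x, inner ℝ (grad (φ n) x : TangentSpace (𝓡 m) x) (grad ψ x) ∂(weightedVolume m f) := by
    intro n
    have hc : ContMDiff (𝓡 m) 𝓘(ℝ, ℝ) 1 (fun x => 1 - φ n x) := contMDiff_const.sub (h.isTest n).contMDiff_one
    have := integral_mul_fLaplacian_of_hasCompactSupport hf hψ.contMDiff_two hc hψ.2
    simp only [mul_comm (fLaplacian m f ψ _)]
    rw [this, ← integral_neg]
    refine integral_congr_ae (.of_forall fun x => ?_)
    dsimp only
    have e : (grad (fun x => 1 - φ n x) x : TangentSpace (𝓡 m) x) = - grad (φ n) x := by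
      have e1 := grad_add (u := fun _ : M => (1:ℝ)) (w := fun x => -1 * φ n x) (x := x)
        (mdifferentiableAt_const) ((contMDiff_const.mul (h.isTest n).contMDiff_one).mdifferentiable (by norm_num) x)
      rw [grad_const_mul _ ((h.isTest n).mdifferentiableAt x), grad_const, zero_add, neg_one_smul] at e1
      rw [← e1]
      congr 1
      ext x
      ring
    rw [e, inner_neg_right, neg_neg, real_inner_comm]
  have h4 := h1.2
  simp only [h3] at h4
  have h5 := tendsto_nhds_unique h4 (h.integrable_inner hf hψ).2
  rw [h.integral_inner hf hρ hρ0 hρi hψ] at h5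
  rw [← sub_eq_zero, ← integral_sub h1.1 h2.1] at h5
  rw [← h5]
  refine integral_congr_ae (.of_forall fun x => ?_)
  dsimp only
  ring

/-- If the energy has infimum zero, the minimizing sequence tends to `1` almost everywhere, and its
Dirichlet energies decay geometrically. -/
theorem of_capacity_eq_zero (h : IsMinimizing f ρ φ u Y H) (hf : ContMDiff (𝓡 m) 𝓘(ℝ, ℝ) ∞ f)
    (hρ : Continuous ρ) (hρ0 : ∀ x, 0 < ρ x) (hρi : Integrable ρ (weightedVolume m f))
    (h0 : capacity m f ρ = 0) :
    (∀ᵐ x ∂(weightedVolume m f), Tendsto (fun n => φ n x) atTop (𝓝 1)) ∧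
    ∀ n, ∫ x, inner ℝ (grad (φ n) x : TangentSpace (𝓡 m) x) (grad (φ n) x) ∂(weightedVolume m f) ≤ (1 / 16) ^ n := by
  have hle : ∀ n, energy m f ρ (φ n) ≤ (1/16) ^ n := fun n => by simpa [h0] using h.energy_le n
  constructor
  · obtain ⟨S, -, hS0, hS⟩ := exists_integrable_bound (μ := weightedVolume m f)
      (F := fun n x => 2 ^ n * (inner ℝ (grad (φ n) x : TangentSpace (𝓡 m) x) (grad (φ n) x) + ρ x * (1 - φ n x) ^ 2))
      (fun n => (integrable_energy hf hρ hρi (h.isTest n)).const_mul _)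
      (fun n x => mul_nonneg (by positivity) (add_nonneg real_inner_self_nonneg
        (mul_nonneg (hρ0 x).le (sq_nonneg _)))) (a := fun n => (1/8) ^ n)
      (summable_geometric_of_lt_one (by norm_num) (by norm_num)) (fun n => by
        rw [integral_const_mul]
        have : ((1:ℝ)/8) ^ n = 2 ^ n * (1/16) ^ n := by rw [← mul_pow]; norm_num
        rw [this]
        exact mul_le_mul_of_nonneg_left (hle n) (by positivity))
    filter_upwards [hS] with x hx
    have h1 : ∀ n, |φ n x - 1| ≤ √ ((1/2) ^ n * (S x / ρ x)) := by
      intro n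
      refine Real.le_sqrt_of_sq_le ?_
      rw [sq_abs, ← mul_div_assoc, le_div_iff₀ (hρ0 x)]
      have h2 := hx n
      have h3 : 0 ≤ inner ℝ (grad (φ n) x : TangentSpace (𝓡 m) x) (grad (φ n) x) := real_inner_self_nonneg
      have h4 : ((1:ℝ)/2) ^ n * 2 ^ n = 1 := by rw [← mul_pow]; norm_num
      have h5 := mul_le_mul_of_nonneg_left h2 (show (0:ℝ) ≤ (1/2) ^ n by positivity)
      rw [← mul_assoc, h4, one_mul] at h5
      nlinarith
    have h2 : Tendsto (fun n : ℕ => √ ((1/2) ^ n * (S x / ρ x))) atTop (𝓝 0) := by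
      have := ((tendsto_pow_atTop_nhds_zero_of_lt_one (r := (1/2:ℝ)) (by norm_num) (by norm_num)).mul_const (S x / ρ x)).sqrt
      simpa using this
    rw [tendsto_iff_norm_sub_tendsto_zero]
    exact squeeze_zero (fun n => norm_nonneg _) h1 h2
  · intro n
    refine le_trans (integral_mono (integrable_inner_grad hf (h.isTest n).contMDiff_one
      (h.isTest n).contMDiff_one (h.isTest n).2) (integrable_energy hf hρ hρi (h.isTest n)) fun x => ?_) (hle n)
    exact le_add_of_nonneg_right (mul_nonneg (hρ0 x).le (sq_nonneg _))

end IsMinimizing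
end Equilibrium
end WeightedManifold

/-! ### The criterion and the infimum of the energy -/

namespace WeightedManifold
section Criterion
set_option linter.unusedSectionVars false
open scoped Topology
open Filter

variable {m : ℕ} {M : Type*} [MetricSpace M] [SecondCountableTopology M]
  [MeasurableSpace M] [BorelSpace M]
  [ChartedSpace (EuclideanSpace ℝ (Fin m)) M]
  [IsManifold (𝓡 m) ∞ M] [RiemannianBundle (fun x : M => TangentSpace (𝓡 m) x)]
  [IsContMDiffRiemannianBundle (𝓡 m) ∞ (EuclideanSpace ℝ (Fin m))
      (fun x : M => TangentSpace (𝓡 m) x)]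
variable {f ρ : M → ℝ}

theorem continuousOn_coordField_grad {u : M → ℝ} (hu : ContMDiff (𝓡 m) 𝓘(ℝ, ℝ) 1 u) (p : M) :
    ContinuousOn (coordField (m := m) p (grad u)) (extChartAt (𝓡 m) p).source := by
  have h : ∀ i, ContinuousOn (fun y => ∑ j, (gram m p y)⁻¹ i j * pd j (u ∘ (extChartAt (𝓡 m) p).symm) y)
      (extChartAt (𝓡 m) p).target := fun i =>
    continuousOn_finsetSum _ fun j _ => (continuousOn_gram_inv p i j).mul
      (ContDiffOn.pd (k := 0) (n := 1) (contDiffOn_comp_extChartAt_symm (by exact_mod_cast le_top)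
        hu.contMDiffOn) (isOpen_extChartAt_target p) j (by simp)).continuousOn
  have h2 : ContinuousOn (fun x i => coordField (m := m) p (grad u) x i) (extChartAt (𝓡 m) p).source := by
    rw [continuousOn_pi]
    intro i
    refine ((h i).comp (continuousOn_extChartAt p) (fun x hx => (extChartAt (𝓡 m) p).map_source hx)).congr ?_
    intro x hx
    have := coordField_grad ((extChartAt (𝓡 m) p).map_source hx) (hu.mdifferentiable (by norm_num) _) i
    rw [(extChartAt (𝓡 m) p).left_inv hx] at this
    exact this
  exact (PiLp.continuous_toLp 2 _).comp_continuousOn h2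

/-- Measurability passes to the limit because the coordinate map is continuous on each tangent
space. -/
theorem measurableField_of_tendsto (hf : ContMDiff (𝓡 m) 𝓘(ℝ, ℝ) ∞ f) {φ : ℕ → M → ℝ}
    (hφ : ∀ n, ContMDiff (𝓡 m) 𝓘(ℝ, ℝ) 1 (φ n)) {Y : ∀ x : M, TangentSpace (𝓡 m) x}
    (hY : ∀ᵐ x ∂(weightedVolume m f),
      Tendsto (fun n => (grad (φ n) x : TangentSpace (𝓡 m) x)) atTop (𝓝 (Y x))) :
    MeasurableField Y := by
  intro p
  have hac : riemannianVolume m M ≪ weightedVolume m f := by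
    refine withDensity_absolutelyContinuous' ?_ (.of_forall fun x => ?_)
    · have := hf.continuous
      exact (by fun_prop : Measurable fun x => ENNReal.ofReal (Real.exp (-f x))).aemeasurable
    · simpa using Real.exp_pos _
  have hO : (chartAt (EuclideanSpace ℝ (Fin m)) p).source = (extChartAt (𝓡 m) p).source := by simp
  rw [hO]
  have hm := (isOpen_extChartAt_source (I := 𝓡 m) p).measurableSet
  refine aestronglyMeasurable_of_tendsto_ae atTop (f := fun n => coordField p (grad (φ n)))
    (fun n => (continuousOn_coordField_grad (hφ n) p).aestronglyMeasurable hm) ?_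
  rw [ae_restrict_iff' hm]
  filter_upwards [hac.ae_le hY] with x hx hxp
  have hb := mem_baseSet_of_mem_source hxp
  have hX : ∀ X : ∀ x : M, TangentSpace (𝓡 m) x, coordField p X x =
      (trivializationAt (EuclideanSpace ℝ (Fin m)) (TangentSpace (𝓡 m)) p).continuousLinearMapAt ℝ x (X x) := by
    intro X
    rw [Trivialization.continuousLinearMapAt_apply, Trivialization.coe_linearMapAt_of_mem _ hb]
    rfl
  simp only [hX]
  exact ((ContinuousLinearMap.continuous _).tendsto _).comp hx

/-- The property of vector fields in the Kelvin-Nevanlinna-Royden criterion. -/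
def KelvinNevanlinnaRoyden (f : M → ℝ) : Prop :=
  ∀ (X : ∀ x : M, TangentSpace (𝓡 m) x) (divX : M → ℝ),
    MeasurableField X → HasWeakFDivergence f X divX →
    MemLp (fun x => ‖X x‖) 2 (weightedVolume m f) →
    LocallyIntegrable (fun x => max (-divX x) 0) (weightedVolume m f) →
    (Integrable (fun x => max (-divX x) 0) (weightedVolume m f) ∨
      Integrable (fun x => max (divX x) 0) (weightedVolume m f)) →
    Integrable divX (weightedVolume m f) ∧ ∫ x, divX x ∂(weightedVolume m f) = 0

/-- The gradient of the energy minimizer is an admissible vector field, and the integral of its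
divergence is minus the infimum of the energy. -/
theorem capacity_eq_zero_of_kelvinNevanlinnaRoyden (hf : ContMDiff (𝓡 m) 𝓘(ℝ, ℝ) ∞ f)
    (hρ : Continuous ρ) (hρ0 : ∀ x, 0 < ρ x) (hρi : Integrable ρ (weightedVolume m f))
    (hK : KelvinNevanlinnaRoyden (m := m) f) : capacity m f ρ = 0 := by
  obtain ⟨φ, u, Y, H, h⟩ := exists_isMinimizing (m := m) hf hρ hρ0 hρi
  have hi := (h.integrable_mul hρi).1
  have hw : Integrable (fun x => -(ρ x * (1 - u x))) (weightedVolume m f) := hi.neg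
  have h1 := hK Y (fun x => -(ρ x * (1 - u x)))
    (measurableField_of_tendsto hf (fun n => (h.isTest n).contMDiff_one) h.tendsto_grad)
    ⟨hw.locallyIntegrable, fun ψ hψ hψc => by
      rw [h.integral_inner hf hρ hρ0 hρi ⟨hψ, hψc⟩, ← integral_neg]
      refine integral_congr_ae (.of_forall fun x => ?_)
      dsimp only
      ring⟩ h.memLp_norm hw.neg.pos_part.locallyIntegrable (Or.inl hw.neg.pos_part)
  have h2 := h1.2
  rw [integral_neg, h.integral_eq_capacity hf hρ hρ0 hρi, neg_eq_zero] at h2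
  exact h2

/-- Fatou's lemma for cutoff functions. -/
theorem lintegral_le_of_tendsto_cutoff {α : Type*} [MeasurableSpace α] {μ : Measure α}
    {g : α → ℝ} (hg0 : ∀ x, 0 ≤ g x) {η : ℕ → α → ℝ} (hη0 : ∀ n x, 0 ≤ η n x)
    (hη : ∀ᵐ x ∂μ, Tendsto (fun n => η n x) atTop (𝓝 1))
    (hi : ∀ n, Integrable (fun x => η n x * g x) μ) {L : ℝ}
    (hlim : Tendsto (fun n => ∫ x, η n x * g x ∂μ) atTop (𝓝 L)) :
    ∫⁻ x, ENNReal.ofReal (g x) ∂μ ≤ ENNReal.ofReal L := by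
  calc ∫⁻ x, ENNReal.ofReal (g x) ∂μ
      = ∫⁻ x, liminf (fun n => ENNReal.ofReal (η n x * g x)) atTop ∂μ := by
        refine lintegral_congr_ae ?_
        filter_upwards [hη] with x hx
        have : Tendsto (fun n => ENNReal.ofReal (η n x * g x)) atTop
            (𝓝 (ENNReal.ofReal (1 * g x))) :=
          (ENNReal.continuous_ofReal.tendsto _).comp (hx.mul_const _)
        rw [this.liminf_eq, one_mul]
    _ ≤ liminf (fun n => ∫⁻ x, ENNReal.ofReal (η n x * g x) ∂μ) atTop :=
        lintegral_liminf_le' fun n => (hi n).aestronglyMeasurable.aemeasurable.ennreal_ofReal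
    _ = ENNReal.ofReal L := by
        refine Tendsto.liminf_eq
          (((ENNReal.continuous_ofReal.tendsto _).comp hlim).congr fun n => ?_)
        exact ofReal_integral_eq_lintegral_ofReal (hi n)
          (.of_forall fun x => mul_nonneg (hη0 n x) (hg0 x))

/-- A `C¹` function with vanishing gradient on a connected manifold is constant. -/
theorem eq_of_grad_eq_zero [ConnectedSpace M] {u : M → ℝ} (hu : ContMDiff (𝓡 m) 𝓘(ℝ, ℝ) 1 u)
    (h : ∀ x, (grad u x : TangentSpace (𝓡 m) x) = 0) (x y : M) : u x = u y := by
  have hl : IsLocallyConstant u := by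
    rw [IsLocallyConstant.iff_eventually_eq]
    intro p
    have hp : extChartAt (𝓡 m) p p ∈ (extChartAt (𝓡 m) p).target := mem_extChartAt_target p
    have hT := isOpen_extChartAt_target (I := 𝓡 m) p
    obtain ⟨r, hr, hsub⟩ := Metric.isOpen_iff.1 hT _ hp
    have hd : DifferentiableOn ℝ (u ∘ (extChartAt (𝓡 m) p).symm) (Metric.ball (extChartAt (𝓡 m) p p) r) :=
      ((contDiffOn_comp_extChartAt_symm (n := 1) (by exact_mod_cast le_top) hu.contMDiffOn).differentiableOn
        (by norm_num)).mono hsub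
    have hz : ∀ z ∈ Metric.ball (extChartAt (𝓡 m) p p) r, fderiv ℝ (u ∘ (extChartAt (𝓡 m) p).symm) z = 0 := by
      intro z hz
      have hq := (extChartAt (𝓡 m) p).map_target (hsub hz)
      refine ContinuousLinearMap.coe_injective ((EuclideanSpace.basisFun (Fin m) ℝ).toBasis.ext fun i => ?_)
      have h1 := mfderiv_coordVec hq (hu.mdifferentiable (by norm_num) _) i
      rw [← inner_grad, h, inner_zero_left, (extChartAt (𝓡 m) p).right_inv (hsub hz)] at h1
      simpa [pd] using! h1.symm
    have hU : IsOpen ((extChartAt (𝓡 m) p).source ∩ extChartAt (𝓡 m) p ⁻¹' Metric.ball (extChartAt (𝓡 m) p p) r) :=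
      (continuousOn_extChartAt p).isOpen_inter_preimage (isOpen_extChartAt_source p) Metric.isOpen_ball
    filter_upwards [hU.mem_nhds ⟨mem_extChartAt_source p, Metric.mem_ball_self hr⟩] with q hq
    have h2 := (convex_ball (extChartAt (𝓡 m) p p) r).is_const_of_fderivWithin_eq_zero (𝕜 := ℝ) hd
      (fun z hz' => by rw [fderivWithin_of_isOpen Metric.isOpen_ball hz', hz z hz']) hq.2 (Metric.mem_ball_self hr)
    simpa only [Function.comp_apply, (extChartAt (𝓡 m) p).left_inv hq.1,
      (extChartAt (𝓡 m) p).left_inv (mem_extChartAt_source p)] using h2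
  exact hl.apply_eq_of_isPreconnected isPreconnected_univ (Set.mem_univ _) (Set.mem_univ _)

/-- If there are cutoff functions of arbitrarily small Dirichlet energy, then every `u` that is
bounded above and satisfies `Δ_f u ≥ 0` is constant: testing with `φ² e^{2u}` gives the Caccioppoli
inequality `∫ φ² e^{2u} |∇u|² ≤ sup e^{2u} ∫ |∇φ|²`. -/
theorem isFParabolic_of_capacity_eq_zero [ConnectedSpace M] (hf : ContMDiff (𝓡 m) 𝓘(ℝ, ℝ) ∞ f)
    (hρ : Continuous ρ) (hρ0 : ∀ x, 0 < ρ x) (hρi : Integrable ρ (weightedVolume m f))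
    (h0 : capacity m f ρ = 0) : IsFParabolic m f := by
  have := isOpenPosMeasure_weightedVolume hf
  obtain ⟨φ, v, Y, H, h⟩ := exists_isMinimizing (m := m) hf hρ hρ0 hρi
  obtain ⟨hφ1, hφ2⟩ := h.of_capacity_eq_zero hf hρ hρ0 hρi h0
  intro u hu hΔ ⟨C, hC⟩ x
  have hu1 : ContMDiff (𝓡 m) 𝓘(ℝ, ℝ) 1 u := hu.of_le (by norm_num)
  have hud := hu1.mdifferentiable (by norm_num)
  have hexp : ContMDiff (𝓡 m) 𝓘(ℝ, ℝ) 1 (fun x => Real.exp (2 * u x)) :=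
    Real.contDiff_exp.contMDiff.comp (contMDiff_const.mul hu1)
  set g : M → ℝ := fun x => Real.exp (2 * u x) *
    inner ℝ (grad u x : TangentSpace (𝓡 m) x) (grad u x) with hg
  have hgc : Continuous g := hexp.continuous.mul (continuous_inner_grad hu1 hu1)
  have hg0 : ∀ x, 0 ≤ g x := fun x => mul_nonneg (Real.exp_pos _).le real_inner_self_nonneg
  have hi : ∀ n, Integrable (fun x => (φ n x * φ n x) * g x) (weightedVolume m f) := by
    intro n
    refine (integrable_mul_test hf ((h.isTest n).1.continuous.mul hgc) (h.isTest n)).congr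
      (.of_forall fun x => ?_)
    simp only [Pi.mul_apply]
    ring
  have hle : ∀ n, ∫ x, (φ n x * φ n x) * g x ∂(weightedVolume m f) ≤
      Real.exp (2 * C) * (1 / 16) ^ n := by
    intro n
    have hφ := h.isTest n
    have hψ1 : ContMDiff (𝓡 m) 𝓘(ℝ, ℝ) 1 (fun x => φ n x * φ n x) :=
      hφ.contMDiff_one.mul hφ.contMDiff_one
    have hψ : ContMDiff (𝓡 m) 𝓘(ℝ, ℝ) 1 (fun x => (φ n x * φ n x) * Real.exp (2 * u x)) :=
      hψ1.mul hexp
    have hψc : HasCompactSupport (fun x => (φ n x * φ n x) * Real.exp (2 * u x)) :=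
      (hφ.2.mul_left (f := φ n)).mul_right
    have hG := integral_mul_fLaplacian hf hu hψ hψc
    have h1 : 0 ≤ ∫ x, (φ n x * φ n x) * Real.exp (2 * u x) * fLaplacian m f u x
        ∂(weightedVolume m f) :=
      integral_nonneg fun x => mul_nonneg (mul_nonneg (mul_self_nonneg _) (Real.exp_pos _).le) (hΔ x)
    rw [hG] at h1
    have h2 : ∫ x, (φ n x * φ n x) * g x ∂(weightedVolume m f) ≤
        ∫ x, (inner ℝ (grad u x : TangentSpace (𝓡 m) x)
          (grad (fun x => (φ n x * φ n x) * Real.exp (2 * u x)) x) +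
          Real.exp (2 * C) * inner ℝ (grad (φ n) x : TangentSpace (𝓡 m) x) (grad (φ n) x))
          ∂(weightedVolume m f) := by
      refine integral_mono (hi n) ((integrable_inner_grad hf hu1 hψ hψc).add
        ((integrable_inner_grad hf hφ.contMDiff_one hφ.contMDiff_one hφ.2).const_mul _)) fun x => ?_
      have hd : HasDerivAt (fun t : ℝ => Real.exp (2 * t)) (2 * Real.exp (2 * u x)) (u x) := by
        have := ((hasDerivAt_id (u x)).const_mul 2).exp
        simpa [mul_comm] using this
      dsimp only
      rw [grad_mul (hψ1.mdifferentiable (by norm_num) x) (hexp.mdifferentiable (by norm_num) x),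
        grad_comp hd (hud x), grad_mul (hφ.mdifferentiableAt x) (hφ.mdifferentiableAt x)]
      -- the square `|φ ∇u + ∇φ|² ≥ 0` absorbs the mixed term `2 φ ⟨∇u, ∇φ⟩`
      have h3 := real_inner_self_nonneg (x := φ n x • grad u x + (grad (φ n) x : TangentSpace (𝓡 m) x))
      have h4 : Real.exp (2 * u x) ≤ Real.exp (2 * C) :=
        Real.exp_le_exp.2 (by linarith [hC ⟨x, rfl⟩])
      have h5 : 0 ≤ inner ℝ (grad (φ n) x : TangentSpace (𝓡 m) x) (grad (φ n) x) :=
        real_inner_self_nonneg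
      simp only [inner_add_left, inner_add_right, real_inner_smul_left, real_inner_smul_right] at h3 ⊢
      rw [real_inner_comm (grad u x) (grad (φ n) x)] at h3
      have h6 := mul_le_mul_of_nonneg_right h4 h5
      have h7 := mul_nonneg (Real.exp_pos (2 * u x)).le h3
      simp only [hg]
      nlinarith
    refine h2.trans ?_
    rw [integral_add (integrable_inner_grad hf hu1 hψ hψc)
      ((integrable_inner_grad hf hφ.contMDiff_one hφ.contMDiff_one hφ.2).const_mul _),
      integral_const_mul]
    have h8 := mul_le_mul_of_nonneg_left (hφ2 n) (Real.exp_pos (2 * C)).le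
    linarith
  have hlim : Tendsto (fun n => ∫ x, (φ n x * φ n x) * g x ∂(weightedVolume m f)) atTop (𝓝 0) := by
    refine squeeze_zero (fun n => integral_nonneg fun x =>
      mul_nonneg (mul_self_nonneg _) (hg0 x)) hle ?_
    simpa using IsMinimizing.tendsto_pow_zero.const_mul (Real.exp (2 * C))
  have hlin := lintegral_le_of_tendsto_cutoff hg0 (fun n x => mul_self_nonneg (φ n x))
    (hφ1.mono fun x hx => by simpa using hx.mul hx) hi hlim
  rw [ENNReal.ofReal_zero, nonpos_iff_eq_zero,
    lintegral_eq_zero_iff' hgc.measurable.ennreal_ofReal.aemeasurable] at hlin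
  have hgz : g = fun _ => 0 := by
    refine (Continuous.ae_eq_iff_eq (weightedVolume m f) hgc continuous_const).1 ?_
    filter_upwards [hlin] with x hx
    exact le_antisymm (ENNReal.ofReal_eq_zero.1 hx) (hg0 x)
  have hgrad : ∀ x, (grad u x : TangentSpace (𝓡 m) x) = 0 := by
    intro x
    have := congrFun hgz x
    simp only [hg, mul_eq_zero, (Real.exp_pos _).ne', false_or] at this
    exact inner_self_eq_zero.1 this
  have hconst := eq_of_grad_eq_zero hu1 hgrad
  have : u = fun _ => u x := funext fun y => hconst y x
  rw [this]
  exact (ciSup_const).symm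

/-- A function with integrable negative part whose integrals against cutoff functions tend to zero
is integrable, with integral zero. -/
theorem integrable_of_tendsto_cutoff {α : Type*} [MeasurableSpace α] {μ : Measure α}
    {w : α → ℝ} (hw : AEStronglyMeasurable w μ) (hwn : Integrable (fun x => max (-w x) 0) μ)
    {η : ℕ → α → ℝ} (hη0 : ∀ n x, 0 ≤ η n x) {C : ℝ} (hηC : ∀ n x, η n x ≤ C)
    (hηm : ∀ n, AEStronglyMeasurable (η n) μ)
    (hη : ∀ᵐ x ∂μ, Tendsto (fun n => η n x) atTop (𝓝 1))
    (hi : ∀ n, Integrable (fun x => η n x * w x) μ)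
    (hlim : Tendsto (fun n => ∫ x, η n x * w x ∂μ) atTop (𝓝 0)) :
    Integrable w μ ∧ ∫ x, w x ∂μ = 0 := by
  have key : ∀ {v : α → ℝ}, Integrable v μ → (∀ n, Integrable (fun x => η n x * v x) μ) ∧
      Tendsto (fun n => ∫ x, η n x * v x ∂μ) atTop (𝓝 (∫ x, v x ∂μ)) := by
    intro v hv
    have hb : ∀ n x, ‖η n x * v x‖ ≤ C * ‖v x‖ := fun n x => by
      rw [norm_mul, Real.norm_eq_abs, abs_of_nonneg (hη0 n x)]
      exact mul_le_mul_of_nonneg_right (hηC n x) (norm_nonneg _)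
    refine ⟨fun n => (hv.norm.const_mul C).mono' ((hηm n).mul hv.aestronglyMeasurable)
      (.of_forall (hb n)), tendsto_integral_of_dominated_convergence _
      (fun n => (hηm n).mul hv.aestronglyMeasurable) (hv.norm.const_mul C)
      (fun n => .of_forall (hb n)) ?_⟩
    filter_upwards [hη] with x hx
    simpa using hx.mul_const (v x)
  have hsplit : ∀ x, w x = max (w x) 0 - max (-w x) 0 := fun x => by
    rcases le_total 0 (w x) with h | h
    · rw [max_eq_left h, max_eq_right (by linarith), sub_zero]
    · rw [max_eq_right h, max_eq_left (by linarith)]; ring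
  have hsum : ∀ n x, η n x * max (w x) 0 = η n x * w x + η n x * max (-w x) 0 := fun n x => by
    linear_combination (-η n x) * hsplit x
  have hlim' : Tendsto (fun n => ∫ x, η n x * max (w x) 0 ∂μ) atTop
      (𝓝 (∫ x, max (-w x) 0 ∂μ)) := by
    have := hlim.add (key hwn).2
    rw [zero_add] at this
    refine this.congr fun n => ?_
    rw [← integral_add (hi n) ((key hwn).1 n)]
    exact integral_congr_ae (.of_forall fun x => (hsum n x).symm)
  have hi' : ∀ n, Integrable (fun x => η n x * max (w x) 0) μ := fun n =>
    ((hi n).add ((key hwn).1 n)).congr (.of_forall fun x => (hsum n x).symm)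
  have hwp : Integrable (fun x => max (w x) 0) μ := by
    refine ⟨hw.sup aestronglyMeasurable_const, ?_⟩
    rw [hasFiniteIntegral_iff_ofReal (f := fun x => max (w x) 0)
      (.of_forall fun x => le_max_right _ _)]
    exact (lintegral_le_of_tendsto_cutoff (fun x => le_max_right _ _) hη0 hη hi' hlim').trans_lt
      ENNReal.ofReal_lt_top
  have hwi : Integrable w μ := (hwp.sub hwn).congr (.of_forall fun x => (hsplit x).symm)
  exact ⟨hwi, tendsto_nhds_unique (key hwi).2 hlim⟩

/-- Young's inequality for the derivative of `φ²`, with a free weight `c`. -/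
theorem abs_inner_grad_mul_self_le {φ : M → ℝ} {x : M} (hφ : MDifferentiableAt (𝓡 m) 𝓘(ℝ, ℝ) φ x)
    (hb : |φ x| ≤ 4) (V : TangentSpace (𝓡 m) x) {c : ℝ} (hc : 0 < c) :
    |inner ℝ V (grad (fun y => φ y * φ y) x)| ≤
      4 * c⁻¹ * ‖V‖ ^ 2 + 4 * c * inner ℝ (grad φ x : TangentSpace (𝓡 m) x) (grad φ x) := by
  have e : (grad (fun y => φ y * φ y) x : TangentSpace (𝓡 m) x) = (2 * φ x) • grad φ x := by
    rw [grad_mul hφ hφ, ← add_smul, two_mul]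
  rw [e, real_inner_smul_right, abs_mul, abs_mul, abs_two, real_inner_self_eq_norm_sq]
  have h1 := abs_real_inner_le_norm V (grad φ x)
  generalize ‖(grad φ x : TangentSpace (𝓡 m) x)‖ = b at *
  generalize ‖V‖ = a at *
  have h3 : 2 * |φ x| * |inner ℝ V (grad φ x)| ≤ 8 * (a * b) :=
    mul_le_mul (by linarith) h1 (abs_nonneg _) (by norm_num)
  have h4 : 4 * c⁻¹ * a ^ 2 + 4 * c * b ^ 2 - 8 * (a * b) = 4 * c⁻¹ * (a - c * b) ^ 2 := by
    field_simp
    ring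
  have h5 : 0 ≤ 4 * c⁻¹ * (a - c * b) ^ 2 := by positivity
  linarith

/-- The integral of a weak divergence against `φ²` is controlled by the Dirichlet energy of `φ`. -/
theorem abs_integral_mul_self_mul_le (hf : ContMDiff (𝓡 m) 𝓘(ℝ, ℝ) ∞ f)
    {X : ∀ x : M, TangentSpace (𝓡 m) x} {w : M → ℝ} (hw : HasWeakFDivergence f X w)
    (hX : Integrable (fun x => ‖X x‖ ^ 2) (weightedVolume m f)) {φ : M → ℝ} (hφ : IsTest m φ)
    (hb : ∀ x, |φ x| ≤ 4) {c : ℝ} (hc : 0 < c) :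
    |∫ x, φ x * φ x * w x ∂(weightedVolume m f)| ≤
      4 * c⁻¹ * (∫ x, ‖X x‖ ^ 2 ∂(weightedVolume m f)) +
        4 * c * ∫ x, inner ℝ (grad φ x : TangentSpace (𝓡 m) x) (grad φ x)
          ∂(weightedVolume m f) := by
  have hg := integrable_inner_grad hf hφ.contMDiff_one hφ.contMDiff_one hφ.2
  have h1 := hw.2 (fun x => φ x * φ x) (hφ.1.mul hφ.1) (hφ.2.mul_left (f := φ))
  rw [← abs_neg, ← h1, ← integral_const_mul, ← integral_const_mul,
    ← integral_add (hX.const_mul _) (hg.const_mul _)]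
  exact norm_integral_le_of_norm_le (f := fun x => inner ℝ (X x) (grad (fun y => φ y * φ y) x))
    ((hX.const_mul _).add (hg.const_mul _))
    (.of_forall fun x => abs_inner_grad_mul_self_le (hφ.mdifferentiableAt x) (hb x) (X x) hc)

/-- The squares of a minimizing sequence of zero energy are cutoff functions against which every
weak divergence of an `L²` field has integral tending to zero. -/
theorem tendsto_integral_mul_self_mul (hf : ContMDiff (𝓡 m) 𝓘(ℝ, ℝ) ∞ f)
    {X : ∀ x : M, TangentSpace (𝓡 m) x} {w : M → ℝ} (hw : HasWeakFDivergence f X w)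
    (hX : Integrable (fun x => ‖X x‖ ^ 2) (weightedVolume m f)) {φ : ℕ → M → ℝ}
    (hφ : ∀ n, IsTest m (φ n)) (hb : ∀ n x, |φ n x| ≤ 4)
    (he : ∀ n, ∫ x, inner ℝ (grad (φ n) x : TangentSpace (𝓡 m) x) (grad (φ n) x)
      ∂(weightedVolume m f) ≤ (1 / 16) ^ n) :
    Tendsto (fun n => ∫ x, φ n x * φ n x * w x ∂(weightedVolume m f)) atTop (𝓝 0) := by
  have hle : ∀ n, ‖∫ x, φ n x * φ n x * w x ∂(weightedVolume m f)‖ ≤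
      4 * (1 / 4) ^ n * (∫ x, ‖X x‖ ^ 2 ∂(weightedVolume m f)) + 4 * (1 / 4) ^ n := fun n => by
    -- the weight `4ⁿ` balances the decay `16⁻ⁿ` of the energies
    have h1 := abs_integral_mul_self_mul_le hf hw hX (hφ n) (hb n) (c := 4 ^ n) (by positivity)
    have h2 := mul_le_mul_of_nonneg_left (he n) (show (0:ℝ) ≤ 4 * 4 ^ n by positivity)
    have h3 : (4:ℝ) ^ n * (1 / 16) ^ n = (1 / 4) ^ n := by rw [← mul_pow]; norm_num
    have h4 : ((4:ℝ) ^ n)⁻¹ = (1 / 4) ^ n := by rw [one_div, inv_pow]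
    rw [mul_assoc 4 (4 ^ n) ((1 / 16 : ℝ) ^ n), h3] at h2
    rw [h4] at h1
    rw [Real.norm_eq_abs]
    linarith
  refine squeeze_zero_norm hle ?_
  have h4 : Tendsto (fun n : ℕ => 4 * ((1:ℝ) / 4) ^ n) atTop (𝓝 0) := by
    have := (tendsto_pow_atTop_nhds_zero_of_lt_one (r := (1:ℝ) / 4) (by norm_num)
      (by norm_num)).const_mul 4
    rwa [mul_zero] at this
  have h5 := (h4.mul_const (∫ x, ‖X x‖ ^ 2 ∂(weightedVolume m f))).add h4
  rwa [zero_mul, zero_add] at h5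

/-- The product of a locally integrable function and a compactly supported continuous function is
integrable. -/
theorem integrable_mul_of_locallyIntegrable [LocallyCompactSpace M] {μ : Measure M} {w ψ : M → ℝ}
    (hw : LocallyIntegrable w μ) (hψ : Continuous ψ) (hc : HasCompactSupport ψ) :
    Integrable (fun x => ψ x * w x) μ := by
  exact hw.integrable_smul_left_of_hasCompactSupport hψ hc

/-- If the infimum of the energy is zero, the squares of a minimizing sequence converge to `1` almost
everywhere, and the integral of `div_f X` can be computed with them. The assumption that one of the
parts of `div_f X` is integrable is what permits the passage to the limit. -/
theorem kelvinNevanlinnaRoyden_of_capacity_eq_zero (hf : ContMDiff (𝓡 m) 𝓘(ℝ, ℝ) ∞ f)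
    (hρ : Continuous ρ) (hρ0 : ∀ x, 0 < ρ x) (hρi : Integrable ρ (weightedVolume m f))
    (h0 : capacity m f ρ = 0) : KelvinNevanlinnaRoyden (m := m) f := by
  obtain ⟨φ, v, Y, H, h⟩ := exists_isMinimizing (m := m) hf hρ hρ0 hρi
  obtain ⟨hφ1, hφ2⟩ := h.of_capacity_eq_zero hf hρ hρ0 hρi h0
  intro X w _ hw hX _ hor
  have hc : ∀ n, Continuous fun x => φ n x * φ n x := fun n =>
    (h.isTest n).1.continuous.mul (h.isTest n).1.continuous
  have hη0 : ∀ n x, 0 ≤ φ n x * φ n x := fun n x => mul_self_nonneg _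
  have hηC : ∀ n x, φ n x * φ n x ≤ 16 := fun n x => by
    have h1 := abs_le.1 (h.bound n x)
    nlinarith [h1.1, h1.2]
  have hηlim : ∀ᵐ x ∂(weightedVolume m f), Tendsto (fun n => φ n x * φ n x) atTop (𝓝 1) :=
    hφ1.mono fun x hx => by
      have := hx.mul hx
      rwa [one_mul] at this
  have hi : ∀ n, Integrable (fun x => φ n x * φ n x * w x) (weightedVolume m f) := fun n =>
    have := ChartedSpace.locallyCompactSpace (EuclideanSpace ℝ (Fin m)) M
    integrable_mul_of_locallyIntegrable hw.1 (hc n) ((h.isTest n).2.mul_left (f := φ n))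
  have hX2 : Integrable (fun x => ‖X x‖ ^ 2) (weightedVolume m f) :=
    (memLp_two_iff_integrable_sq hX.aestronglyMeasurable).1 hX
  have hlim := tendsto_integral_mul_self_mul hf hw hX2 h.isTest h.bound hφ2
  have hwm := hw.1.aestronglyMeasurable
  rcases hor with hn | hp
  · exact integrable_of_tendsto_cutoff hwm hn hη0 hηC
      (fun n => (hc n).aestronglyMeasurable) hηlim hi hlim
  · have hi' : ∀ n, Integrable (fun x => φ n x * φ n x * -w x) (weightedVolume m f) := fun n =>
      (hi n).neg.congr (.of_forall fun x => (mul_neg _ _).symm)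
    have hlim' : Tendsto (fun n => ∫ x, φ n x * φ n x * -w x ∂(weightedVolume m f)) atTop
        (𝓝 0) := by
      simp only [mul_neg, integral_neg]
      have := hlim.neg
      rwa [neg_zero] at this
    have h1 := integrable_of_tendsto_cutoff (w := fun x => -w x) hwm.neg
      (by simpa only [neg_neg] using hp) hη0 hηC
      (fun n => (hc n).aestronglyMeasurable) hηlim hi' hlim'
    refine ⟨by simpa only [neg_neg] using h1.1.fun_neg, ?_⟩
    have h2 := h1.2
    rwa [integral_neg, neg_eq_zero] at h2

end Criterion
end WeightedManifold

/-! ### Regularity of the limit, and parabolicity -/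

namespace WeightedManifold
section EllipticRegularity
set_option linter.unusedSectionVars false
open scoped Topology
open Filter

variable {m : ℕ} {M : Type*} [MetricSpace M] [SecondCountableTopology M]
  [MeasurableSpace M] [BorelSpace M]
  [ChartedSpace (EuclideanSpace ℝ (Fin m)) M]
  [IsManifold (𝓡 m) ∞ M] [RiemannianBundle (fun x : M => TangentSpace (𝓡 m) x)]
  [IsContMDiffRiemannianBundle (𝓡 m) ∞ (EuclideanSpace ℝ (Fin m))
      (fun x : M => TangentSpace (𝓡 m) x)]
variable {f ρ : M → ℝ}

theorem pd_sum_mul {i : Fin m} {a b : Fin m → EuclideanSpace ℝ (Fin m) → ℝ}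
    {x : EuclideanSpace ℝ (Fin m)} (ha : ∀ j, DifferentiableAt ℝ (a j) x)
    (hb : ∀ j, DifferentiableAt ℝ (b j) x) :
    pd i (fun y => ∑ j, a j y * b j y) x = ∑ j, (a j x * pd i (b j) x + pd i (a j) x * b j x) := by
  rw [pd, fderiv_fun_sum fun j _ => (ha j).fun_mul (hb j), sum_apply]
  exact Finset.sum_congr rfl fun j _ => pd_mul (ha j) (hb j)

/-- The `f`-Laplacian in coordinates, in nondivergence form and multiplied by the density. -/
theorem dens_mul_chartLap (hf : ContMDiff (𝓡 m) 𝓘(ℝ, ℝ) ∞ f) (p : M)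
    {χ : EuclideanSpace ℝ (Fin m) → ℝ} (hχ : ContDiff ℝ ∞ χ) {y : EuclideanSpace ℝ (Fin m)}
    (hy : y ∈ (extChartAt (𝓡 m) p).target) :
    dens f p y * chartLap f p χ y = (∑ i, ∑ j, coef f p i j y * pd i (pd j χ) y) +
      ∑ j, (∑ i, pd i (coef f p i j) y) * pd j χ y := by
  have hd : ∀ i j, DifferentiableAt ℝ (coef f p i j) y := fun i j =>
    ((contDiffOn_coef hf p i j).contDiffAt ((isOpen_extChartAt_target p).mem_nhds hy)).differentiableAt
      (by simp)
  have hdχ : ∀ j, DifferentiableAt ℝ (pd j χ) y := fun j =>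
    (ContDiff.pd (k := ⊤) (n := ⊤) hχ j le_rfl).differentiable (by simp) y
  rw [chartLap, mul_inv_cancel_left₀ (dens_pos f hy).ne']
  simp only [Finset.sum_mul]
  rw [Finset.sum_comm (f := fun j i => pd i (coef f p i j) y * pd j χ y), ← Finset.sum_add_distrib]
  refine Finset.sum_congr rfl fun i _ => ?_
  rw [pd_sum_mul (hd i) hdχ, Finset.sum_add_distrib]

/-- The weighted Laplacian of a function transplanted from a chart. -/
theorem fLaplacian_pull_symm (hf : ContMDiff (𝓡 m) 𝓘(ℝ, ℝ) ∞ f) (p : M)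
    {χ : EuclideanSpace ℝ (Fin m) → ℝ} (hχ : ContDiff ℝ ∞ χ) (hc : HasCompactSupport χ)
    (hs : tsupport χ ⊆ (extChartAt (𝓡 m) p).target) {y : EuclideanSpace ℝ (Fin m)}
    (hy : y ∈ (extChartAt (𝓡 m) p).target) :
    fLaplacian m f (pull m p χ) ((extChartAt (𝓡 m) p).symm y) = chartLap f p χ y := by
  have h2 : ((2 : ℕ∞) : WithTop ℕ∞) ≤ ∞ := by exact_mod_cast le_top
  have hψ : ContMDiff (𝓡 m) 𝓘(ℝ, ℝ) 2 (pull m p χ) := (contMDiff_pull le_rfl hχ hc hs).of_le h2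
  rw [← chartLap_eq_fLaplacian hf hψ ((extChartAt (𝓡 m) p).map_target hy),
    (extChartAt (𝓡 m) p).right_inv hy]
  have hev : pull m p χ ∘ (extChartAt (𝓡 m) p).symm =ᶠ[𝓝 y] χ := by
    filter_upwards [(isOpen_extChartAt_target p).mem_nhds hy] with z hz
    exact pull_symm χ hz
  have hpd : ∀ {g h : EuclideanSpace ℝ (Fin m) → ℝ} {z : EuclideanSpace ℝ (Fin m)} (i : Fin m),
      g =ᶠ[𝓝 z] h → pd i g z = pd i h z := fun i e => by rw [pd, pd, e.fderiv_eq]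
  rw [chartLap, chartLap]
  congr 1
  refine Finset.sum_congr rfl fun i _ => hpd i ?_
  filter_upwards [hev.eventuallyEq_nhds] with z hz
  exact Finset.sum_congr rfl fun j _ => by rw [hpd j hz]

/-- A very weak solution of `Δ_f v = ρ v` is, in a chart, a very weak solution of an elliptic
equation with smooth coefficients. -/
theorem integral_chart_eq_zero (hf : ContMDiff (𝓡 m) 𝓘(ℝ, ℝ) ∞ f) (hρ : Continuous ρ)
    {v : M → ℝ} (hv : StronglyMeasurable v)
    (hweak : ∀ ψ, IsTest m ψ →
      ∫ x, v x * (fLaplacian m f ψ x - ρ x * ψ x) ∂(weightedVolume m f) = 0) (p : M)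
    {χ : EuclideanSpace ℝ (Fin m) → ℝ} (hχ : ContDiff ℝ ∞ χ) (hc : HasCompactSupport χ)
    (hs : tsupport χ ⊆ (extChartAt (𝓡 m) p).target) :
    ∫ y, v ((extChartAt (𝓡 m) p).symm y) *
      ((∑ i, ∑ j, coef f p i j y * pd i (pd j χ) y) +
        (∑ j, (∑ i, pd i (coef f p i j) y) * pd j χ y) +
        (-(dens f p y * ρ ((extChartAt (𝓡 m) p).symm y))) * χ y) = 0 := by
  have h2 : ((2 : ℕ∞) : WithTop ℕ∞) ≤ ∞ := by exact_mod_cast le_top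
  have hψ : IsTest m (pull m p χ) := ⟨contMDiff_pull le_rfl hχ hc hs, hasCompactSupport_pull hc hs⟩
  have h0 := hweak _ hψ
  have hm : AEStronglyMeasurable
      (fun x => v x * (fLaplacian m f (pull m p χ) x - ρ x * pull m p χ x))
      ((weightedVolume m f).restrict (extChartAt (𝓡 m) p).source) :=
    hv.aestronglyMeasurable.mul ((continuous_fLaplacian hf hψ.contMDiff_two).sub
      (hρ.mul hψ.1.continuous)).aestronglyMeasurable
  rw [← setIntegral_eq_integral_of_forall_compl_eq_zero (s := (extChartAt (𝓡 m) p).source)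
    (fun x hx => ?_), setIntegral_source hf p hm] at h0
  · rw [← h0, ← setIntegral_eq_integral_of_forall_compl_eq_zero
      (s := (extChartAt (𝓡 m) p).target) (fun y hy => ?_)]
    · refine setIntegral_congr_fun (measurableSet_target p) fun y hy => ?_
      rw [fLaplacian_pull_symm hf p hχ hc hs hy, pull_symm χ hy, ← dens_mul_chartLap hf p hχ hy]
      ring
    · have hy' : y ∉ tsupport χ := fun h => hy (hs h)
      have e1 : ∀ j, pd j χ y = 0 := fun j =>
        image_eq_zero_of_notMem_tsupport fun h => hy' (tsupport_pd_subset j χ h)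
      have e2 : ∀ i j, pd i (pd j χ) y = 0 := fun i j =>
        image_eq_zero_of_notMem_tsupport fun h => hy' (tsupport_pd_subset j χ (tsupport_pd_subset i _ h))
      simp only [e1, e2, image_eq_zero_of_notMem_tsupport hy', mul_zero, Finset.sum_const_zero,
        add_zero]
  · have hx' : x ∉ tsupport (pull m p χ) := fun h => hx (tsupport_pull_subset_source hc hs h)
    rw [fLaplacian_eq_zero_of_notMem_tsupport hψ.contMDiff_two hx',
      image_eq_zero_of_notMem_tsupport hx', mul_zero, sub_zero, mul_zero]

theorem memLp_mul_comp_symm {v : M → ℝ} (hv : StronglyMeasurable v) {C : ℝ}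
    (hC : ∀ x, |v x| ≤ C) (p : M) {χ : EuclideanSpace ℝ (Fin m) → ℝ} (hχ : Continuous χ)
    (hc : HasCompactSupport χ) (hs : tsupport χ ⊆ (extChartAt (𝓡 m) p).target) :
    MemLp (fun y => χ y * v ((extChartAt (𝓡 m) p).symm y)) 2 volume := by
  have hm : AEStronglyMeasurable (fun y => χ y * v ((extChartAt (𝓡 m) p).symm y))
      (volume.restrict (extChartAt (𝓡 m) p).target) :=
    hχ.aestronglyMeasurable.mul (hv.aestronglyMeasurable.comp_aemeasurable (aemeasurable_symm p))
  have hm' : AEStronglyMeasurable (fun y => χ y * v ((extChartAt (𝓡 m) p).symm y)) volume := by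
    rw [← aestronglyMeasurable_indicator_iff (measurableSet_target p)] at hm
    refine hm.congr (.of_forall fun y => Set.indicator_apply_eq_self.2 fun hy => ?_)
    rw [image_eq_zero_of_notMem_tsupport fun h => hy (hs h), zero_mul]
  refine ((hχ.memLp_of_hasCompactSupport hc).const_mul C).mono hm' (.of_forall fun y => ?_)
  rw [norm_mul, norm_mul, mul_comm]
  exact mul_le_mul_of_nonneg_right ((hC _).trans (le_abs_self C)) (norm_nonneg _)

/-- Bounded very weak solutions of `Δ_f v = ρ v` are locally of class `C²`, up to null sets. -/
theorem exists_open_contMDiffOn (hf : ContMDiff (𝓡 m) 𝓘(ℝ, ℝ) ∞ f)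
    (hρ : ContMDiff (𝓡 m) 𝓘(ℝ, ℝ) ∞ ρ)
    {v : M → ℝ} (hv : StronglyMeasurable v) {C : ℝ} (hC : ∀ x, |v x| ≤ C)
    (hweak : ∀ ψ, IsTest m ψ →
      ∫ x, v x * (fLaplacian m f ψ x - ρ x * ψ x) ∂(weightedVolume m f) = 0) (p : M) :
    ∃ U : Set M, IsOpen U ∧ p ∈ U ∧ ∃ V : M → ℝ, ContMDiffOn (𝓡 m) 𝓘(ℝ, ℝ) 2 V U ∧
      v =ᵐ[(weightedVolume m f).restrict U] V := by
  classical
  have hp : extChartAt (𝓡 m) p p ∈ (extChartAt (𝓡 m) p).target := mem_extChartAt_target p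
  obtain ⟨r, hr, hsub, W, hW, hae⟩ := exists_contDiff_two_of_weak (isOpen_extChartAt_target p)
    (contDiffOn_coef hf p)
    (b := fun j y => ∑ i, pd i (coef f p i j) y)
    (fun j => ContDiffOn.sum fun i _ => ContDiffOn.pd (k := ⊤) (n := ⊤) (contDiffOn_coef hf p i j)
      (isOpen_extChartAt_target p) i le_rfl)
    (c := fun y => -(dens f p y * ρ ((extChartAt (𝓡 m) p).symm y)))
    ((contDiffOn_dens hf p).mul (contDiffOn_comp_extChartAt_symm le_rfl hρ.contMDiffOn)).neg
    hp (coef_posDef f hp) (v := fun y => v ((extChartAt (𝓡 m) p).symm y))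
    (fun χ hχ hc hs => memLp_mul_comp_symm hv hC p hχ.continuous hc hs)
    (fun χ hχ hc hs => integral_chart_eq_zero hf hρ.continuous hv hweak p hχ hc hs)
  set U : Set M := (extChartAt (𝓡 m) p).source ∩
    extChartAt (𝓡 m) p ⁻¹' Metric.ball (extChartAt (𝓡 m) p p) r with hU
  have hUo : IsOpen U :=
    (continuousOn_extChartAt p).isOpen_inter_preimage (isOpen_extChartAt_source p) Metric.isOpen_ball
  have h2 : ((2 : ℕ∞) : WithTop ℕ∞) ≤ ∞ := by exact_mod_cast le_top
  have hV : ContMDiffOn (𝓡 m) 𝓘(ℝ, ℝ) 2 (W ∘ extChartAt (𝓡 m) p) U := by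
    refine hW.contMDiff.comp_contMDiffOn (((contMDiffOn_extChartAt (n := ∞)).of_le h2).mono ?_)
    intro x hx
    rw [← extChartAt_source (𝓡 m)]
    exact hx.1
  refine ⟨U, hUo, ⟨mem_extChartAt_source p, Metric.mem_ball_self hr⟩,
    U.piecewise (W ∘ extChartAt (𝓡 m) p) (fun _ => 0),
    hV.congr fun x hx => Set.piecewise_eq_of_mem _ _ _ hx, ?_⟩
  have hm : Measurable (U.piecewise (W ∘ extChartAt (𝓡 m) p) (fun _ => 0)) :=
    hV.continuousOn.measurable_piecewise continuousOn_const hUo.measurableSet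
  have hS : MeasurableSet {x | x ∈ U → v x = U.piecewise (W ∘ extChartAt (𝓡 m) p) (fun _ => 0) x} :=
    hUo.measurableSet.imp (measurableSet_eq_fun hv.measurable hm)
  rw [Filter.EventuallyEq, ae_restrict_iff' hUo.measurableSet]
  have key : ∀ᵐ x ∂((weightedVolume m f).restrict (extChartAt (𝓡 m) p).source), x ∈ U →
      v x = U.piecewise (W ∘ extChartAt (𝓡 m) p) (fun _ => 0) x := by
    rw [weightedVolume_restrict hf.continuous, ae_map_iff (aemeasurable_symm_chartMeasure f p) hS]
    refine (withDensity_absolutelyContinuous _ _).ae_le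
      ((ae_restrict_iff' (measurableSet_target p)).2 ?_)
    filter_upwards [hae] with y hy hyt hyU
    have h3 := hyU.2
    rw [Set.mem_preimage, (extChartAt (𝓡 m) p).right_inv hyt] at h3
    rw [Set.piecewise_eq_of_mem _ _ _ hyU, Function.comp_apply, (extChartAt (𝓡 m) p).right_inv hyt]
    exact hy h3
  rw [ae_restrict_iff' (isOpen_extChartAt_source p).measurableSet] at key
  exact key.mono fun x hx hxU => hx hxU.1 hxU

/-- Functions that are locally almost everywhere equal to `C²` functions are globally so. -/
theorem exists_contMDiff_of_locally {μ : Measure M} [μ.IsOpenPosMeasure] {v : M → ℝ}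
    (h : ∀ p, ∃ U : Set M, IsOpen U ∧ p ∈ U ∧ ∃ V : M → ℝ, ContMDiffOn (𝓡 m) 𝓘(ℝ, ℝ) 2 V U ∧
      v =ᵐ[μ.restrict U] V) :
    ∃ V : M → ℝ, ContMDiff (𝓡 m) 𝓘(ℝ, ℝ) 2 V ∧ v =ᵐ[μ] V := by
  choose U hUo hpU V hV hae using h
  -- two local representatives agree on the overlap, being continuous and equal almost everywhere
  have key : ∀ p, ∀ x ∈ U p, V x x = V p x := by
    intro p x hx
    refine Measure.eqOn_open_of_ae_eq (μ := μ) (U := U x ∩ U p) ?_ ((hUo x).inter (hUo p))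
      ((hV x).continuousOn.mono Set.inter_subset_left)
      ((hV p).continuousOn.mono Set.inter_subset_right) ⟨hpU x, hx⟩
    have h1 := ae_restrict_of_ae_restrict_of_subset (Set.inter_subset_left (t := U p)) (hae x)
    have h2 := ae_restrict_of_ae_restrict_of_subset (Set.inter_subset_right (s := U x)) (hae p)
    filter_upwards [h1, h2] with y h3 h4
    exact h3.symm.trans h4
  refine ⟨fun x => V x x, fun p => ?_, ?_⟩
  · refine ((hV p).contMDiffAt ((hUo p).mem_nhds (hpU p))).congr_of_eventuallyEq ?_
    filter_upwards [(hUo p).mem_nhds (hpU p)] with x hx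
    exact key p x hx
  · obtain ⟨S, hS, hSU⟩ := TopologicalSpace.countable_cover_nhds fun p => (hUo p).mem_nhds (hpU p)
    have h1 : ∀ p, ∀ᵐ x ∂μ, x ∈ U p → v x = V x x := fun p => by
      have h2 := (ae_restrict_iff' (hUo p).measurableSet).1 (hae p)
      filter_upwards [h2] with x hx hxU
      rw [hx hxU, key p x hxU]
    filter_upwards [(ae_ball_iff hS).2 fun p _ => h1 p] with x hx
    obtain ⟨p, hp, hxp⟩ := Set.mem_iUnion₂.1 (hSU.symm ▸ Set.mem_univ x)
    exact hx p hp hxp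

/-- Weyl's lemma for the operator `Δ_f - ρ`: bounded very weak solutions are `C²`. -/
theorem exists_contMDiff_ae_eq (hf : ContMDiff (𝓡 m) 𝓘(ℝ, ℝ) ∞ f)
    (hρ : ContMDiff (𝓡 m) 𝓘(ℝ, ℝ) ∞ ρ)
    {v : M → ℝ} (hv : StronglyMeasurable v) {C : ℝ} (hC : ∀ x, |v x| ≤ C)
    (hweak : ∀ ψ, IsTest m ψ →
      ∫ x, v x * (fLaplacian m f ψ x - ρ x * ψ x) ∂(weightedVolume m f) = 0) :
    ∃ V : M → ℝ, ContMDiff (𝓡 m) 𝓘(ℝ, ℝ) 2 V ∧ v =ᵐ[weightedVolume m f] V :=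
  have := isOpenPosMeasure_weightedVolume (m := m) hf
  exists_contMDiff_of_locally (exists_open_contMDiffOn hf hρ hv hC hweak)

/-- A very weak solution of `Δ_f v = ρ v` that is `C²` is a classical solution. -/
theorem fLaplacian_eq_of_weak (hf : ContMDiff (𝓡 m) 𝓘(ℝ, ℝ) ∞ f) (hρ : Continuous ρ)
    {v : M → ℝ} (hv : ContMDiff (𝓡 m) 𝓘(ℝ, ℝ) 2 v)
    (hweak : ∀ ψ, IsTest m ψ →
      ∫ x, v x * (fLaplacian m f ψ x - ρ x * ψ x) ∂(weightedVolume m f) = 0) (x : M) :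
    fLaplacian m f v x = ρ x * v x := by
  have := isOpenPosMeasure_weightedVolume (m := m) hf
  have := isLocallyFiniteMeasure_weightedVolume (m := m) hf
  have := ChartedSpace.locallyCompactSpace (EuclideanSpace ℝ (Fin m)) M
  have hg : Continuous fun x => fLaplacian m f v x - ρ x * v x :=
    (continuous_fLaplacian hf hv).sub (hρ.mul hv.continuous)
  have h1 : ContMDiff (𝓡 m) 𝓘(ℝ, ℝ) 1 v := hv.of_le (by norm_num)
  have h0 : ∀ᵐ x ∂(weightedVolume m f), fLaplacian m f v x - ρ x * v x = 0 := by
    refine ae_eq_zero_of_integral_contMDiff_smul_eq_zero (𝓡 m) hg.locallyIntegrable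
      fun ψ hψ hc => ?_
    have ht : IsTest m ψ := ⟨hψ, hc⟩
    have hi1 := integrable_mul_fLaplacian hf hv hψ.continuous hc
    have hi2 : Integrable (fun x => ψ x * (ρ x * v x)) (weightedVolume m f) :=
      ((hψ.continuous.mul (hρ.mul hv.continuous))).integrable_of_hasCompactSupport hc.mul_right
    have hi3 : Integrable (fun x => v x * fLaplacian m f ψ x) (weightedVolume m f) :=
      (hv.continuous.mul (continuous_fLaplacian hf ht.contMDiff_two)).integrable_of_hasCompactSupport
        (HasCompactSupport.intro hc fun x hx => by
          rw [Pi.mul_apply, fLaplacian_eq_zero_of_notMem_tsupport ht.contMDiff_two hx, mul_zero])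
    have e1 := integral_mul_fLaplacian hf hv ht.contMDiff_one hc
    have e2 := integral_mul_fLaplacian_of_hasCompactSupport hf ht.contMDiff_two h1 hc
    simp only [real_inner_comm] at e2
    have e3 := hweak ψ ht
    simp only [smul_eq_mul, mul_sub] at e3 ⊢
    rw [integral_sub hi1 hi2, e1, ← e2, ← e3, integral_sub hi3 (hi2.congr (.of_forall fun x => by ring))]
    congr 1
    exact integral_congr_ae (.of_forall fun x => by dsimp only; ring)
  have h3 := (Continuous.ae_eq_iff_eq (weightedVolume m f) hg continuous_const).1 h0
  exact sub_eq_zero.1 (congrFun h3 x)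

/-- If `M` is `f`-parabolic, the only bounded solution of `Δ_f v = ρ v` with `ρ > 0` is zero,
because `v²` is `f`-subharmonic. -/
theorem eq_zero_of_fLaplacian_eq (hf : ContMDiff (𝓡 m) 𝓘(ℝ, ℝ) ∞ f) (hρ0 : ∀ x, 0 < ρ x)
    (hpar : IsFParabolic (M := M) m f) {v : M → ℝ} (hv : ContMDiff (𝓡 m) 𝓘(ℝ, ℝ) 2 v) {C : ℝ}
    (hC : ∀ x, |v x| ≤ C) (h : ∀ x, fLaplacian m f v x = ρ x * v x) (x : M) : v x = 0 := by
  have hsq : ∀ y, fLaplacian m f (fun z => v z * v z) y = 2 * ρ y * (v y * v y) +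
      2 * inner ℝ (grad v y : TangentSpace (𝓡 m) y) (grad v y) := fun y => by
    rw [fLaplacian_sq hf hv, h]
    ring
  have hin : ∀ y, 0 ≤ inner ℝ (grad v y : TangentSpace (𝓡 m) y) (grad v y) := fun y =>
    real_inner_self_nonneg
  have hnn : ∀ y, 0 ≤ 2 * ρ y * (v y * v y) := fun y =>
    mul_nonneg (mul_nonneg zero_le_two (hρ0 y).le) (mul_self_nonneg _)
  have hconst := hpar (fun z => v z * v z) (hv.mul hv)
    (fun y => by rw [hsq]; linarith [hin y, hnn y])
    ⟨C * C, by
      rintro _ ⟨y, rfl⟩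
      exact (abs_mul_abs_self (v y)).symm.le.trans (mul_self_le_mul_self (abs_nonneg _) (hC y))⟩
  have h0 := hsq x
  rw [show (fun z => v z * v z) = fun _ => ⨆ y, v y * v y from funext hconst, fLaplacian_const] at h0
  have h1 : 2 * ρ x * (v x * v x) = 0 := le_antisymm (by linarith [hin x]) (hnn x)
  rcases mul_eq_zero.1 h1 with h2 | h2
  · linarith [hρ0 x]
  · exact mul_self_eq_zero.1 h2

/-- If `u` is the limit of a minimizing sequence, `1 - u` is a bounded very weak solution of
`Δ_f v = ρ v`, hence a classical one, and parabolicity forces it to vanish. -/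
theorem capacity_eq_zero_of_isFParabolic (hf : ContMDiff (𝓡 m) 𝓘(ℝ, ℝ) ∞ f)
    (hρ : ContMDiff (𝓡 m) 𝓘(ℝ, ℝ) ∞ ρ)
    (hρ0 : ∀ x, 0 < ρ x) (hρi : Integrable ρ (weightedVolume m f))
    (hpar : IsFParabolic (M := M) m f) : capacity m f ρ = 0 := by
  have := isOpenPosMeasure_weightedVolume (m := m) hf
  obtain ⟨φ, u, Y, H, h⟩ := exists_isMinimizing (m := m) hf hρ.continuous hρ0 hρi
  -- a Borel representative of `u` that is bounded everywhere
  set u' : M → ℝ := fun x => max (-4) (min 4 (h.aestronglyMeasurable.mk u x))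
  have hu' : u =ᵐ[weightedVolume m f] u' := by
    filter_upwards [h.aestronglyMeasurable.ae_eq_mk, h.abs_le] with x h1 h2
    rw [abs_le] at h2
    simp only [u', ← h1, min_eq_right h2.2, max_eq_right h2.1]
  have hm : StronglyMeasurable fun x => 1 - u' x :=
    stronglyMeasurable_const.sub (stronglyMeasurable_const.sup
      (stronglyMeasurable_const.inf h.aestronglyMeasurable.stronglyMeasurable_mk))
  have hb : ∀ x, |1 - u' x| ≤ 5 := fun x => by
    have h1 : -4 ≤ u' x := le_max_left _ _
    have h2 : u' x ≤ 4 := max_le (by norm_num) (min_le_left _ _)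
    rw [abs_le]
    constructor <;> linarith
  obtain ⟨V, hV, hVae⟩ := exists_contMDiff_ae_eq hf hρ hm hb fun ψ hψ => by
    rw [← h.integral_mul_fLaplacian hf hρ.continuous hρ0 hρi hψ]
    exact integral_congr_ae (hu'.mono fun x hx => by dsimp only; rw [hx])
  have hVu : ∀ᵐ x ∂(weightedVolume m f), 1 - u x = V x := by
    filter_upwards [hu', hVae] with x h1 h2
    rw [h1, h2]
  have hVC : ∀ x, |V x| ≤ 5 := by
    have h1 : (fun x => max |V x| 5) =ᵐ[weightedVolume m f] fun _ => 5 := by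
      filter_upwards [hVae] with x hx
      rw [← hx]
      exact max_eq_right (hb x)
    have h2 := (Continuous.ae_eq_iff_eq (weightedVolume m f)
      (hV.continuous.abs.max continuous_const) continuous_const).1 h1
    exact fun x => max_eq_right_iff.1 (congrFun h2 x)
  have hV0 := eq_zero_of_fLaplacian_eq hf hρ0 hpar hV hVC
    (fLaplacian_eq_of_weak hf hρ.continuous hV fun ψ hψ => by
      rw [← h.integral_mul_fLaplacian hf hρ.continuous hρ0 hρi hψ]
      exact integral_congr_ae (hVu.mono fun x hx => by dsimp only; rw [hx]))
  rw [← h.integral_eq_capacity hf hρ.continuous hρ0 hρi]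
  refine integral_eq_zero_of_ae (hVu.mono fun x hx => ?_)
  dsimp only
  rw [hx, hV0, mul_zero]
  rfl

end EllipticRegularity
end WeightedManifold

theorem mainTheorem2 (m : ℕ) (M : Type*) [MetricSpace M] [ConnectedSpace M] [CompleteSpace M]
    [SecondCountableTopology M] [MeasurableSpace M] [BorelSpace M]
    [ChartedSpace (EuclideanSpace ℝ (Fin m)) M] [IsManifold (𝓡 m) ∞ M]
    [RiemannianBundle (fun x : M => TangentSpace (𝓡 m) x)]
    [IsContMDiffRiemannianBundle (𝓡 m) ∞ (EuclideanSpace ℝ (Fin m))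
      (fun x : M => TangentSpace (𝓡 m) x)]
    [IsRiemannianManifold (𝓡 m) M]
    (f : M → ℝ) (hf : ContMDiff (𝓡 m) 𝓘(ℝ, ℝ) ∞ f) :
    WeightedManifold.IsFParabolic m f ↔
      ∀ (X : ∀ x : M, TangentSpace (𝓡 m) x) (divX : M → ℝ),
        WeightedManifold.MeasurableField X →
        WeightedManifold.HasWeakFDivergence f X divX →
        MemLp (fun x => ‖X x‖) 2 (WeightedManifold.weightedVolume m f) →
        LocallyIntegrable (fun x => max (-divX x) 0) (WeightedManifold.weightedVolume m f) →
        -- the integral of `divX` exists in `[-∞, ∞]`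
        (Integrable (fun x => max (-divX x) 0) (WeightedManifold.weightedVolume m f) ∨
          Integrable (fun x => max (divX x) 0) (WeightedManifold.weightedVolume m f)) →
        Integrable divX (WeightedManifold.weightedVolume m f) ∧
          ∫ x, divX x ∂(WeightedManifold.weightedVolume m f) = 0 := by
  have := WeightedManifold.isLocallyFiniteMeasure_weightedVolume (m := m) hf
  obtain ⟨ρ, hρ, hρ0, hρi⟩ := WeightedManifold.exists_contMDiff_pos_integrable (m := m)
    (WeightedManifold.weightedVolume m f)
  constructor
  · intro h
    exact WeightedManifold.kelvinNevanlinnaRoyden_of_capacity_eq_zero hf hρ.continuous hρ0 hρi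
      (WeightedManifold.capacity_eq_zero_of_isFParabolic hf hρ hρ0 hρi h)
  · intro h
    exact WeightedManifold.isFParabolic_of_capacity_eq_zero hf hρ.continuous hρ0 hρi
      (WeightedManifold.capacity_eq_zero_of_kelvinNevanlinnaRoyden hf hρ.continuous hρ0 hρi h)
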